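/- Let $\partial\Gamma$ be an oriented topological circle, $\partial\Gamma^{(3)+}$ the space of positively oriented triples in $\partial\Gamma$, and $\mathcal F(\mathbb R^4)$ the space of full flags in $\mathbb R^4$. A continuous map $\xi=(\xi^1,\xi^2,\xi^3):\partial\Gamma\to\mathcal F(\mathbb R^4)$ (with $\xi^4(x):=\mathbb R^4$) is a hyperconvex Frenet curve if for all positive integers $k_1,\dots,k_j$ with $p=\sum_l k_l\le 4$: (i) the sum $\xi^{k_1}(x_1)+\dots+\xi^{k_j}(x_j)$ is direct for all distinct $x_1,\dots,x_j\in\partial\Gamma$, and (ii) $\bigoplus_l\xi^{k_l}(x_l^m)\to\xi^p(x)$ as $m\to\infty$ whenever $(x^m_1,\dots,x^m_j)$ are $j$-tuples of distinct points converging to $(x,\dots,x)$. For such $\xi$ put $\Omega_\xi=\mathbb{RP}^3\setminus\bigcup_{x}\xi^2(x)$, and let $\Omega^1_\xi$ be the connected component of $\Omega_\xi$ that contains the points $$\mathrm{dev}_{\mathrm{pcf}}(x,y,z)=\bigl(\xi^1(x)\oplus(\xi^2(z)\cap\xi^3(x))\bigr)\cap\bigl((\xi^2(x)\cap\xi^3(z))\oplus(\xi^2(y)\cap\xi^3(x))\bigr),\qquad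 (x,y,z)\in\partial\Gamma^{(3)+}.$$ **Proposition 3.7.** Let $\xi:\partial\Gamma\to\mathcal F(\mathbb R^4)$ be a hyperconvex Frenet curve. Then the set $\Omega_\xi^1$ is well defined (all these points lie in $\Omega_\xi$ and in a single component of it), and the map $$\mathrm{dev}_{\mathrm{pctf}}(x,y,z)=(\xi^1(x)\oplus\xi^1(z))\cap\xi^3(y)$$ is a homeomorphism from $\partial\Gamma^{(3)+}$ onto $\Omega^1_\xi$. Moreover, for distinct $x,z\in\partial\Gamma$ let $\ell_{xz}=(\xi^1(x)\oplus\xi^1(z))\setminus\{\xi^1(x),\xi^1(z)\}$, a twice-punctured projective line. Then $\ell_{xz}\subset\Omega_\xi^1$; the map $\mathrm{dev}_{\mathrm{pctf}}$ sends $\{(x,y,z)\in\partial\Gamma^{(3)+}: y\in\partial\Gamma\}$ onto a connected component of $\ell_{xz}$; and the connected components of the sets $\ell_{xz}$ $(x\neq z)$ are the leaves of a topological foliation $\mathcal G_{\mathrm{tcf}}$ of $\Omega_\xi^1$ of dimension 1 and codimension 2. -/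

import Mathlib

open Filter Topology

noncomputable section

namespace FrenetCurve

/-- Real Euclidean space `ℝⁿ`. -/
abbrev E (n : ℕ) : Type := EuclideanSpace ℝ (Fin n)

/-- The topology on the set of all linear subspaces of `ℝⁿ` for which `W ↦ P_W` (orthogonal
projection onto `W`, in the operator norm) is an embedding. The dimension (the trace of `P_W`) is
locally constant, so this is the disjoint union of the Grassmannians `Gr_k(ℝⁿ)`, each with its
usual topology. -/
instance subspaceTopology (n : ℕ) : TopologicalSpace (Submodule ℝ (E n)) :=
  TopologicalSpace.induced (fun W : Submodule ℝ (E n) => W.starProjection) inferInstance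

/-- Full flags `V 0 ⊆ V 1 ⊆ ⋯ ⊆ V n` in `ℝⁿ` with `dim (V k) = k`, as a subspace of the product of
the Grassmannians. The entries `V 0 = 0` and `V n = ℝⁿ` carry no information and are kept only for
uniformity of notation. -/
def FullFlag (n : ℕ) : Type :=
  {V : Fin (n + 1) → Submodule ℝ (E n) //
    Monotone V ∧ ∀ k : Fin (n + 1), Module.finrank ℝ (V k) = (k : ℕ)}

instance fullFlagTopology (n : ℕ) : TopologicalSpace (FullFlag n) :=
  inferInstanceAs (TopologicalSpace
    {V : Fin (n + 1) → Submodule ℝ (E n) //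
      Monotone V ∧ ∀ k : Fin (n + 1), Module.finrank ℝ (V k) = (k : ℕ)})

variable {X : Type*} [TopologicalSpace X]

/-- `comp ξ k x` is the `k`-dimensional subspace `ξ^k(x)` of the flag `ξ(x)`. -/
def comp {n : ℕ} (ξ : X → FullFlag n) (k : Fin (n + 1)) (x : X) : Submodule ℝ (E n) :=
  (ξ x).1 k

/-- Hyperconvex Frenet curves in the full flag manifold of `ℝⁿ`: continuity, general position, and
limit compatibility. -/
structure IsHyperconvexFrenet {n : ℕ} (ξ : X → FullFlag n) : Prop where
  continuous : Continuous ξ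
  general_position : ∀ (j : ℕ) (k : Fin j → Fin (n + 1)), ∑ i, (k i : ℕ) ≤ n →
    ∀ x : Fin j → X, Function.Injective x → iSupIndep fun i => comp ξ (k i) (x i)
  limit_compatibility : ∀ (j : ℕ) (k : Fin j → Fin (n + 1)) (p : Fin (n + 1)),
    ∑ i, (k i : ℕ) = (p : ℕ) →
    ∀ (x : X) (u : ℕ → Fin j → X), (∀ m, Function.Injective (u m)) →
      Tendsto u atTop (𝓝 fun _ => x) →
      Tendsto (fun m => ⨆ i, comp ξ (k i) (u m i)) atTop (𝓝 (comp ξ p x))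

/-- Real projective space `ℝP³`: the lines through the origin in `ℝ⁴`. -/
def RP3 : Type := {L : Submodule ℝ (E 4) // Module.finrank ℝ L = 1}

instance rp3Topology : TopologicalSpace RP3 :=
  inferInstanceAs (TopologicalSpace {L : Submodule ℝ (E 4) // Module.finrank ℝ L = 1})

/-- The set `∂Ω_ξ ⊆ ℝP³`, the union of the projective lines `ξ²(x)`. -/
def bdryOmega (ξ : X → FullFlag 4) : Set RP3 := {p | ∃ x, p.1 ≤ comp ξ 2 x}

/-- `Ω_ξ`, the complement of `∂Ω_ξ` in `ℝP³`. -/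
def Omega (ξ : X → FullFlag 4) : Set RP3 := (bdryOmega ξ)ᶜ

/-- Positively oriented triples in a circle `X`, whose orientation is the one transported from
`ℝ/ℤ` by the homeomorphism `θ`. -/
def PosTriple (θ : X ≃ₜ UnitAddCircle) : Type _ :=
  {t : X × X × X // sbtw (θ t.1) (θ t.2.1) (θ t.2.2)}

instance posTripleTopology (θ : X ≃ₜ UnitAddCircle) : TopologicalSpace (PosTriple θ) :=
  inferInstanceAs (TopologicalSpace
    {t : X × X × X // sbtw (θ t.1) (θ t.2.1) (θ t.2.2)})

/-- For `y ≠ x`, the point `ξ_x^1(y) = ξ²(y) ∩ ξ³(x)` of the curve induced by `ξ` in `ξ³(x)`. -/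
def restr (ξ : X → FullFlag 4) (x y : X) : Submodule ℝ (E 4) := comp ξ 2 y ⊓ comp ξ 3 x

/-- The subspace
`dev_pcf(x, y, z) = (ξ¹(x) ⊕ ξ_x^1(z)) ∩ (ξ_z^1(x) ⊕ ξ_x^1(y))`, for distinct `x`, `y`, `z`. -/
def devPcf (ξ : X → FullFlag 4) (x y z : X) : Submodule ℝ (E 4) :=
  (comp ξ 1 x ⊔ restr ξ x z) ⊓ (restr ξ z x ⊔ restr ξ x y)

/-- The foliated component `Ω_ξ^1`: the connected component of `Ω_ξ` that contains the points
`dev_pcf(x, y, z)`, for `(x, y, z)` a positively oriented triple. -/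
def Omega1 (θ : X ≃ₜ UnitAddCircle) (ξ : X → FullFlag 4) : Set RP3 :=
  {p | ∃ (t : PosTriple θ) (q : RP3), q.1 = devPcf ξ t.1.1 t.1.2.1 t.1.2.2 ∧
    p ∈ connectedComponentIn (Omega ξ) q}

/-- The subspace `dev_pctf(x, y, z) = (ξ¹(x) ⊕ ξ¹(z)) ∩ ξ³(y)`. -/
def devPctf (ξ : X → FullFlag 4) (x y z : X) : Submodule ℝ (E 4) :=
  (comp ξ 1 x ⊔ comp ξ 1 z) ⊓ comp ξ 3 y

/-- The twice-punctured projective line `ℓ_xz = (ξ¹(x) ⊕ ξ¹(z)) - {ξ¹(x), ξ¹(z)}`. -/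
def secant (ξ : X → FullFlag 4) (x z : X) : Set RP3 :=
  {p | p.1 ≤ comp ξ 1 x ⊔ comp ξ 1 z ∧ p.1 ≠ comp ξ 1 x ∧ p.1 ≠ comp ξ 1 z}

/-- A leaf `g_xz` of the foliation of the space of positively oriented triples: the outer two
entries are fixed and the middle one varies. -/
def tripleLeaf (θ : X ≃ₜ UnitAddCircle) (x z : X) : Set (PosTriple θ) :=
  {t | t.1.1 = x ∧ t.1.2.2 = z}

/-- The leaves of `𝒢_tcf`, as subsets of `Ω_ξ^1`: the connected components of the `ℓ_xz`. -/
def tcfLeaves (θ : X ≃ₜ UnitAddCircle) (ξ : X → FullFlag 4) : Set (Set (Omega1 θ ξ)) :=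
  {l | ∃ x z, x ≠ z ∧ ∃ p ∈ secant ξ x z,
    Subtype.val '' l = connectedComponentIn (secant ξ x z) p}

/-- A topological foliation of `M` by leaves of dimension `d`, of codimension `q`, given by its set
of leaves: the leaves are connected and partition `M`, and around each point there is a chart onto
`ℝᵈ × ℝ^q` that carries each connected component of the trace of a leaf on the chart domain onto a
plaque `ℝᵈ × {c}`. -/
def IsFoliation {M : Type*} [TopologicalSpace M] (d q : ℕ) (L : Set (Set M)) : Prop :=
  Setoid.IsPartition L ∧ (∀ l ∈ L, IsConnected l) ∧
    ∀ p : M, ∃ φ : OpenPartialHomeomorph M (E d × E q),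
      p ∈ φ.source ∧ φ.target = Set.univ ∧
        ∀ l ∈ L, ∀ a ∈ φ.source ∩ l,
          φ '' connectedComponentIn (φ.source ∩ l) a = {v | v.2 = (φ a).2}

end FrenetCurve

end

/-! Everything rests on the union S of the punctured secant lines ℓ_xz (`secantUnion`), which turns
out to be both the range of dev_pctf and the component Ω_ξ^1. General position puts every ℓ_xz
inside Ω_ξ and shows that a point lies on at most one secant line (`secant_subset_Omega`,
`secant_unique`). On a fixed secant line the trace of the osculating plane ξ³(y) moves injectively
while y runs over one of the two arcs between x and z, and the two arcs fill the two components of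
ℓ_xz (`secant_inter`, `exists_mem_three`). The orientation of the triple selects the arc, so
dev_pctf is a continuous bijection from positive triples onto S.

The source of monotonicity is convexity. Away from one point of the circle ξ¹ lifts to a vector
curve v, and the determinant of four values of v at increasing parameters never vanishes, so it has
constant sign. A Grassmann–Plücker relation turns this into monotonicity of the trace, on a suitable
line, of the plane through three points of the curve (`exists_sign_triple_ratio`). By the Frenet
limit property osculating planes are limits of such planes, and strictness survives the limit
(`coeff_lt_coeff`).

Topologically, dev_pctf is proper as a map into Ω_ξ, because degenerating triples converge to points
of tangent lines (`isProperMap_pctfOmega`). Hence it is an embedding and S is closed in Ω_ξ. S is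
also open: lying on a secant line amounts to two equations in the two end points, whose sign
patterns permit a planar intermediate value argument (`eventually_exists_common_zero`,
`eventually_mem_secant`). As S is connected, it is a connected component of Ω_ξ.

It remains to locate dev_pcf(x,y,z). This point lies on the projective line through ξ¹(x) and ξ²(z)
∩ ξ³(x), which meets the tangent lines of the curve in these two points only. Some secant line of
the curve crosses the same projective line, and a sign computation puts the crossing and
dev_pcf(x,y,z) on the same side of the two marked points (`devPcf_spec`). A segment in Ω_ξ therefore
joins dev_pcf(x,y,z) to S.

The foliation is carried over from the space of positive triples, where forgetting the middle entry
is locally a product projection. -/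

noncomputable section

namespace FrenetCurve

/-! ### Determinants in ℝ⁴ -/

/-- The determinant of four vectors of `ℝ⁴`, expanded along `2 × 2` minors. -/
def vol (a b c d : E 4) : ℝ :=
  (a 0 * b 1 - a 1 * b 0) * (c 2 * d 3 - c 3 * d 2)
  - (a 0 * b 2 - a 2 * b 0) * (c 1 * d 3 - c 3 * d 1)
  + (a 0 * b 3 - a 3 * b 0) * (c 1 * d 2 - c 2 * d 1)
  + (a 1 * b 2 - a 2 * b 1) * (c 0 * d 3 - c 3 * d 0)
  - (a 1 * b 3 - a 3 * b 1) * (c 0 * d 2 - c 2 * d 0)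
  + (a 2 * b 3 - a 3 * b 2) * (c 0 * d 1 - c 1 * d 0)

lemma vol_swap12 (a b c d : E 4) : vol b a c d = -vol a b c d := by unfold vol; ring
lemma vol_swap23 (a b c d : E 4) : vol a c b d = -vol a b c d := by unfold vol; ring
lemma vol_swap34 (a b c d : E 4) : vol a b d c = -vol a b c d := by unfold vol; ring

lemma vol_lin1 (a b c d e : E 4) (s t : ℝ) :
    vol (s • d + t • e) a b c = s * vol d a b c + t * vol e a b c := by
  simp only [vol, PiLp.add_apply, PiLp.smul_apply, smul_eq_mul]; ring

/-- A Grassmann–Plücker relation. -/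
lemma vol_plucker (a b c d e f : E 4) :
    vol a b c e * vol a b d f - vol a b d e * vol a b c f = vol a b c d * vol a b e f := by
  simp only [vol]; ring

/-- Cramer's rule. -/
lemma vol_cramer (a b c d e : E 4) :
    vol a b c d • e = vol e b c d • a + vol a e c d • b + vol a b e d • c + vol a b c e • d := by
  ext i
  simp only [vol, PiLp.add_apply, PiLp.smul_apply, smul_eq_mul]
  fin_cases i <;> simp <;> ring

lemma vol_eq_det (a b c d : E 4) :
    vol a b c d = Matrix.det (Matrix.of ![a.ofLp, b.ofLp, c.ofLp, d.ofLp]) := by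
  simp only [Matrix.det_succ_row_zero, Fin.sum_univ_succ, vol, Matrix.submatrix_apply]
  simp [Fin.succAbove, Fin.lt_def]
  ring

lemma exists_relation_of_vol_eq_zero {a b c d : E 4} (h : vol a b c d = 0) :
    ∃ w : Fin 4 → ℝ, w ≠ 0 ∧ w 0 • a + w 1 • b + w 2 • c + w 3 • d = 0 := by
  rw [vol_eq_det] at h
  obtain ⟨w, hw, hw0⟩ := Matrix.exists_vecMul_eq_zero_iff.mpr h
  refine ⟨w, hw, ?_⟩
  ext i
  have := congrFun hw0 i
  simpa [Matrix.vecMul, dotProduct, Fin.sum_univ_four] using this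

lemma continuous_vol : Continuous fun p : E 4 × E 4 × E 4 × E 4 => vol p.1 p.2.1 p.2.2.1 p.2.2.2 := by
  unfold vol; fun_prop

lemma continuousOn_vol {T : Type*} [TopologicalSpace T] {s : Set T} {a b c d : T → E 4}
    (ha : ContinuousOn a s) (hb : ContinuousOn b s) (hc : ContinuousOn c s)
    (hd : ContinuousOn d s) : ContinuousOn (fun t => vol (a t) (b t) (c t) (d t)) s := by
  have h : ContinuousOn (fun t => (a t, b t, c t, d t)) s := ha.prodMk (hb.prodMk (hc.prodMk hd))
  have := Continuous.comp_continuousOn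
    (g := fun p : E 4 × E 4 × E 4 × E 4 => vol p.1 p.2.1 p.2.2.1 p.2.2.2) continuous_vol h
  simpa only [Function.comp_def] using this

lemma tendsto_vol {T : Type*} {l : Filter T} {a b c d : T → E 4} {a' b' c' d' : E 4}
    (ha : Tendsto a l (𝓝 a')) (hb : Tendsto b l (𝓝 b')) (hc : Tendsto c l (𝓝 c'))
    (hd : Tendsto d l (𝓝 d')) :
    Tendsto (fun t => vol (a t) (b t) (c t) (d t)) l (𝓝 (vol a' b' c' d')) := by
  have h : Tendsto (fun t => (a t, b t, c t, d t)) l (𝓝 (a', b', c', d')) :=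
    ha.prodMk_nhds (hb.prodMk_nhds (hc.prodMk_nhds hd))
  have := Filter.Tendsto.comp
    (g := fun p : E 4 × E 4 × E 4 × E 4 => vol p.1 p.2.1 p.2.2.1 p.2.2.2)
    (continuous_vol.tendsto (a', b', c', d')) h
  simpa only [Function.comp_def] using this

/-! ### Constancy of sign and spaces of increasing tuples -/

/-- A continuous function without zeros has constant sign on a preconnected set. -/
lemma mul_pos_of_preconnected {T : Type*} [TopologicalSpace T] {s : Set T} (hs : IsPreconnected s)
    {f : T → ℝ} (hf : ContinuousOn f s) (h0 : ∀ t ∈ s, f t ≠ 0) {a b : T} (ha : a ∈ s)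
    (hb : b ∈ s) : 0 < f a * f b := by
  have hpre := hs.image f hf
  rcases lt_or_gt_of_ne (h0 a ha) with h1 | h1 <;> rcases lt_or_gt_of_ne (h0 b hb) with h2 | h2
  · exact mul_pos_of_neg_of_neg h1 h2
  · obtain ⟨c, hc, hc0⟩ := hpre.ordConnected.out ⟨a, ha, rfl⟩ ⟨b, hb, rfl⟩ ⟨h1.le, h2.le⟩
    exact absurd hc0 (h0 c hc)
  · obtain ⟨c, hc, hc0⟩ := hpre.ordConnected.out ⟨b, hb, rfl⟩ ⟨a, ha, rfl⟩ ⟨h2.le, h1.le⟩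
    exact absurd hc0 (h0 c hc)
  · exact mul_pos h1 h2

/-- A continuous function without zeros on a nonempty preconnected set becomes positive after
multiplication by a suitable sign. -/
lemma exists_sign {T : Type*} [TopologicalSpace T] {s : Set T} (hs : IsPreconnected s)
    {f : T → ℝ} (hf : ContinuousOn f s) (h0 : ∀ t ∈ s, f t ≠ 0) :
    ∃ σ : ℝ, (σ = 1 ∨ σ = -1) ∧ ∀ t ∈ s, 0 < σ * f t := by
  rcases s.eq_empty_or_nonempty with rfl | ⟨a, ha⟩
  · exact ⟨1, Or.inl rfl, by simp⟩
  rcases lt_or_gt_of_ne (h0 a ha) with h | h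
  · refine ⟨-1, Or.inr rfl, fun t ht => ?_⟩
    have := mul_pos_of_preconnected hs hf h0 ha ht
    nlinarith
  · refine ⟨1, Or.inl rfl, fun t ht => ?_⟩
    have := mul_pos_of_preconnected hs hf h0 ha ht
    nlinarith

/-- Increasing pairs in an open interval. -/
def incPairs (l r : ℝ) : Set (ℝ × ℝ) := {p | l < p.1 ∧ p.1 < p.2 ∧ p.2 < r}

/-- Increasing triples in an open interval. -/
def incTriples (l r : ℝ) : Set (ℝ × ℝ × ℝ) := {p | l < p.1 ∧ p.1 < p.2.1 ∧ p.2.1 < p.2.2 ∧ p.2.2 < r}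

/-- Increasing quadruples in an open interval. -/
def incQuadruples (l r : ℝ) : Set (ℝ × ℝ × ℝ × ℝ) :=
  {p | l < p.1 ∧ p.1 < p.2.1 ∧ p.2.1 < p.2.2.1 ∧ p.2.2.1 < p.2.2.2 ∧ p.2.2.2 < r}

lemma comb_lt_comb {a b x y x' y' : ℝ} (ha : 0 ≤ a) (hb : 0 ≤ b) (hab : a + b = 1) (h : x < x')
    (h' : y < y') : a * x + b * y < a * x' + b * y' := by
  rcases ha.eq_or_lt with rfl | ha
  · have : b = 1 := by linarith
    subst this; simpa
  · nlinarith

lemma isPreconnected_incPairs (l r : ℝ) : IsPreconnected (incPairs l r) := by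
  refine Convex.isPreconnected ?_
  rintro ⟨x1, x2⟩ ⟨h1, h2, h3⟩ ⟨y1, y2⟩ ⟨k1, k2, k3⟩ a b ha hb hab
  have hl : l = a * l + b * l := by rw [← add_mul, hab, one_mul]
  have hr : r = a * r + b * r := by rw [← add_mul, hab, one_mul]
  refine ⟨?_, ?_, ?_⟩
  · rw [hl]; exact comb_lt_comb ha hb hab h1 k1
  · exact comb_lt_comb ha hb hab h2 k2
  · rw [hr]; exact comb_lt_comb ha hb hab h3 k3

lemma isPreconnected_incTriples (l r : ℝ) : IsPreconnected (incTriples l r) := by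
  refine Convex.isPreconnected ?_
  rintro ⟨x1, x2, x3⟩ ⟨h1, h2, h3, h4⟩ ⟨y1, y2, y3⟩ ⟨k1, k2, k3, k4⟩ a b ha hb hab
  have hl : l = a * l + b * l := by rw [← add_mul, hab, one_mul]
  have hr : r = a * r + b * r := by rw [← add_mul, hab, one_mul]
  refine ⟨?_, ?_, ?_, ?_⟩
  · rw [hl]; exact comb_lt_comb ha hb hab h1 k1
  · exact comb_lt_comb ha hb hab h2 k2
  · exact comb_lt_comb ha hb hab h3 k3
  · rw [hr]; exact comb_lt_comb ha hb hab h4 k4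

lemma isPreconnected_incQuadruples (l r : ℝ) : IsPreconnected (incQuadruples l r) := by
  refine Convex.isPreconnected ?_
  rintro ⟨x1, x2, x3, x4⟩ ⟨h1, h2, h3, h4, h5⟩ ⟨y1, y2, y3, y4⟩ ⟨k1, k2, k3, k4, k5⟩ a b ha hb hab
  have hl : l = a * l + b * l := by rw [← add_mul, hab, one_mul]
  have hr : r = a * r + b * r := by rw [← add_mul, hab, one_mul]
  refine ⟨?_, ?_, ?_, ?_, ?_⟩
  · rw [hl]; exact comb_lt_comb ha hb hab h1 k1
  · exact comb_lt_comb ha hb hab h2 k2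
  · exact comb_lt_comb ha hb hab h3 k3
  · exact comb_lt_comb ha hb hab h4 k4
  · rw [hr]; exact comb_lt_comb ha hb hab h5 k5

/-! ### Monotonicity of traces for convex curves -/

section Signs

variable {v : ℝ → E 4} {l r : ℝ}

/-- Increasing tuples form a convex, hence connected, set, so a determinant that vanishes nowhere on
it keeps its sign. The versions for triples and quadruples rest on the same fact. -/
lemma exists_sign_pairs (hv : ContinuousOn v (Set.Ioo l r)) {e f : E 4}
    (h : ∀ a b, l < a → a < b → b < r → vol (v a) (v b) e f ≠ 0) :
    ∃ σ : ℝ, (σ = 1 ∨ σ = -1) ∧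
      ∀ a b, l < a → a < b → b < r → 0 < σ * vol (v a) (v b) e f := by
  have hc : ContinuousOn (fun p : ℝ × ℝ => vol (v p.1) (v p.2) e f) (incPairs l r) := by
    refine continuousOn_vol ?_ ?_ continuousOn_const continuousOn_const
    · exact hv.comp (by fun_prop) fun p hp => ⟨hp.1, by linarith [hp.2.1, hp.2.2]⟩
    · exact hv.comp (by fun_prop) fun p hp => ⟨by linarith [hp.1, hp.2.1], hp.2.2⟩
  obtain ⟨σ, hσ, hs⟩ := exists_sign (isPreconnected_incPairs l r) hc
    fun p hp => h _ _ hp.1 hp.2.1 hp.2.2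
  exact ⟨σ, hσ, fun a b h1 h2 h3 => hs (a, b) ⟨h1, h2, h3⟩⟩

lemma exists_sign_triples (hv : ContinuousOn v (Set.Ioo l r)) {e : E 4}
    (h : ∀ a b c, l < a → a < b → b < c → c < r → vol (v a) (v b) (v c) e ≠ 0) :
    ∃ σ : ℝ, (σ = 1 ∨ σ = -1) ∧
      ∀ a b c, l < a → a < b → b < c → c < r → 0 < σ * vol (v a) (v b) (v c) e := by
  have hc : ContinuousOn (fun p : ℝ × ℝ × ℝ => vol (v p.1) (v p.2.1) (v p.2.2) e)
      (incTriples l r) := by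
    refine continuousOn_vol ?_ ?_ ?_ continuousOn_const
    · exact hv.comp (by fun_prop) fun p ⟨h1, h2, h3, h4⟩ => ⟨by linarith, by linarith⟩
    · exact hv.comp (by fun_prop) fun p ⟨h1, h2, h3, h4⟩ => ⟨by linarith, by linarith⟩
    · exact hv.comp (by fun_prop) fun p ⟨h1, h2, h3, h4⟩ => ⟨by linarith, by linarith⟩
  obtain ⟨σ, hσ, hs⟩ := exists_sign (isPreconnected_incTriples l r) hc
    fun p hp => h _ _ _ hp.1 hp.2.1 hp.2.2.1 hp.2.2.2
  exact ⟨σ, hσ, fun a b c h1 h2 h3 h4 => hs (a, b, c) ⟨h1, h2, h3, h4⟩⟩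

lemma exists_sign_quadruples (hv : ContinuousOn v (Set.Ioo l r))
    (h : ∀ a b c d, l < a → a < b → b < c → c < d → d < r → vol (v a) (v b) (v c) (v d) ≠ 0) :
    ∃ σ : ℝ, (σ = 1 ∨ σ = -1) ∧
      ∀ a b c d, l < a → a < b → b < c → c < d → d < r →
        0 < σ * vol (v a) (v b) (v c) (v d) := by
  have hc : ContinuousOn (fun p : ℝ × ℝ × ℝ × ℝ => vol (v p.1) (v p.2.1) (v p.2.2.1) (v p.2.2.2))
      (incQuadruples l r) := by
    refine continuousOn_vol ?_ ?_ ?_ ?_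
    · exact hv.comp (by fun_prop) fun p ⟨h1, h2, h3, h4, h5⟩ => ⟨by linarith, by linarith⟩
    · exact hv.comp (by fun_prop) fun p ⟨h1, h2, h3, h4, h5⟩ => ⟨by linarith, by linarith⟩
    · exact hv.comp (by fun_prop) fun p ⟨h1, h2, h3, h4, h5⟩ => ⟨by linarith, by linarith⟩
    · exact hv.comp (by fun_prop) fun p ⟨h1, h2, h3, h4, h5⟩ => ⟨by linarith, by linarith⟩
  obtain ⟨σ, hσ, hs⟩ := exists_sign (isPreconnected_incQuadruples l r) hc
    fun p hp => h _ _ _ _ hp.1 hp.2.1 hp.2.2.1 hp.2.2.2.1 hp.2.2.2.2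
  exact ⟨σ, hσ, fun a b c d h1 h2 h3 h4 h5 => hs (a, b, c, d) ⟨h1, h2, h3, h4, h5⟩⟩

/-- Exchanging one vector in a ratio of determinants. -/
lemma ratio_sub_ratio (a b c d e f : E 4) (hc : vol a b c f ≠ 0) (hd : vol a b d f ≠ 0) :
    vol a b d e / vol a b d f - vol a b c e / vol a b c f
      = -(vol a b c d * vol a b e f) / (vol a b c f * vol a b d f) := by
  rw [← vol_plucker a b c d e f]
  field_simp
  ring

/-- The plane spanned by `a`, `b`, `c` meets the line of `e` and `f` in the point `e - ρ • f` with
`ρ = vol a b c e / vol a b c f`. By the Plücker relation, exchanging `c` for `d` changes `ρ` by a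
quotient whose sign is known as soon as those of `vol a b c d` and `vol a b e f` are. -/
lemma ratio_lt_ratio {a b c d e f : E 4} {σ τ : ℝ} (hσ : 0 < σ * vol a b c d)
    (hτ : 0 < τ * vol a b e f) (hcd : 0 < vol a b c f * vol a b d f) :
    σ * τ * (vol a b d e / vol a b d f) < σ * τ * (vol a b c e / vol a b c f) := by
  have hc : vol a b c f ≠ 0 := left_ne_zero_of_mul hcd.ne'
  have hd : vol a b d f ≠ 0 := right_ne_zero_of_mul hcd.ne'
  rw [← sub_pos, ← neg_lt_zero, neg_sub, ← mul_sub, ratio_sub_ratio a b c d e f hc hd]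
  have : 0 < (σ * vol a b c d) * (τ * vol a b e f) / (vol a b c f * vol a b d f) := by positivity
  calc _ = -((σ * vol a b c d) * (τ * vol a b e f) / (vol a b c f * vol a b d f)) := by ring
    _ < 0 := by linarith

lemma mul_pos_of_sign {σ x y : ℝ} (hx : 0 < σ * x) (hy : 0 < σ * y) : 0 < x * y := by
  have : 0 < (σ * x) * (σ * y) := mul_pos hx hy
  nlinarith [sq_nonneg σ, show (σ * x) * (σ * y) = σ ^ 2 * (x * y) by ring]

/-- The planes through three points of a convex curve cut out points that move monotonically on the
line spanned by `e` and `f`. -/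
lemma exists_sign_triple_ratio (hv : ContinuousOn v (Set.Ioo l r)) {e f : E 4}
    (h4 : ∀ a b c d, l < a → a < b → b < c → c < d → d < r → vol (v a) (v b) (v c) (v d) ≠ 0)
    (h3 : ∀ a b c, l < a → a < b → b < c → c < r → vol (v a) (v b) (v c) f ≠ 0)
    (h2 : ∀ a b, l < a → a < b → b < r → vol (v a) (v b) e f ≠ 0) :
    ∃ σ : ℝ, σ ≠ 0 ∧ ∀ a b c a' b' c', l < a → a < b → b < c → c < a' → a' < b' → b' < c' →
      c' < r → σ * (vol (v a) (v b) (v c) e / vol (v a) (v b) (v c) f) <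
        σ * (vol (v a') (v b') (v c') e / vol (v a') (v b') (v c') f) := by
  obtain ⟨σ, hσ, hs⟩ := exists_sign_quadruples hv h4
  obtain ⟨ρ, hρ, hr⟩ := exists_sign_triples hv h3
  obtain ⟨τ, hτ, ht⟩ := exists_sign_pairs hv h2
  refine ⟨-(σ * τ), by rcases hσ with rfl | rfl <;> rcases hτ with rfl | rfl <;> norm_num, ?_⟩
  intro a b c a' b' c' h1 h2 h3 h4 h5 h6 h7
  -- One point is exchanged at a time: (a,b,c), (a,b,c'), (a,b',c'), (a',b',c'). All intermediate
  -- triples are increasing, so the constant signs make the three exchanges move the trace in the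
  -- same direction.
  have s1 := ratio_lt_ratio (σ := σ) (τ := τ)
    (hs a b c c' h1 h2 h3 (by linarith) h7) (ht a b h1 h2 (by linarith))
    (mul_pos_of_sign (hr a b c h1 h2 h3 (by linarith)) (hr a b c' h1 h2 (by linarith) h7))
  have e1 : ∀ x, vol (v a) (v c') (v b) x = -vol (v a) (v b) (v c') x := fun x => vol_swap23 ..
  have e2 : ∀ x, vol (v a) (v c') (v b') x = -vol (v a) (v b') (v c') x := fun x => vol_swap23 ..
  have e3 : ∀ x, vol (v b') (v c') (v a) x = vol (v a) (v b') (v c') x := fun x => by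
    unfold vol; ring
  have e4 : ∀ x, vol (v b') (v c') (v a') x = vol (v a') (v b') (v c') x := fun x => by
    unfold vol; ring
  have s2 := ratio_lt_ratio (a := v a) (b := v c') (c := v b) (d := v b') (e := e) (f := f)
    (σ := σ) (τ := τ)
    (by rw [e1, vol_swap34 _ _ (v b') (v c'), neg_neg]
        exact hs a b b' c' h1 h2 (by linarith) h6 h7)
    (ht a c' h1 (by linarith) (by linarith))
    (by rw [e1, e2, neg_mul_neg]
        exact mul_pos_of_sign (hr a b c' h1 h2 (by linarith) h7)
          (hr a b' c' h1 (by linarith) h6 h7))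
  have s3 := ratio_lt_ratio (a := v b') (b := v c') (c := v a) (d := v a') (e := e) (f := f)
    (σ := σ) (τ := τ)
    (by rw [e3, vol_swap34 _ _ (v a') (v c'), vol_swap23 _ (v a') (v b'), neg_neg]
        exact hs a a' b' c' h1 (by linarith) h5 h6 h7)
    (ht b' c' (by linarith) (by linarith) (by linarith))
    (by rw [e3, e4]
        exact mul_pos_of_sign (hr a b' c' h1 (by linarith) h6 h7)
          (hr a' b' c' (by linarith) h5 h6 h7))
  rw [e1, e1, e2, e2, neg_div_neg_eq, neg_div_neg_eq] at s2
  rw [e3, e3, e4, e4] at s3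
  linarith

/-- The planes through a fixed point and two points of a convex curve cut out points that move
monotonically on the line spanned by `e` and `f`. -/
lemma exists_sign_pair_ratio (hv : ContinuousOn v (Set.Ioo l r)) {o e f : E 4}
    (h3 : ∀ a b c, l < a → a < b → b < c → c < r → vol (v a) (v b) (v c) o ≠ 0)
    (h2 : ∀ a b, l < a → a < b → b < r → vol (v a) (v b) o f ≠ 0)
    (h1 : ∀ a, l < a → a < r → vol (v a) o e f ≠ 0) :
    ∃ σ : ℝ, σ ≠ 0 ∧ ∀ a b a' b', l < a → a < b → b < a' → a' < b' → b' < r →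
      σ * (vol (v a) (v b) o e / vol (v a) (v b) o f) <
        σ * (vol (v a') (v b') o e / vol (v a') (v b') o f) := by
  obtain ⟨σ, hσ, hs⟩ := exists_sign_triples hv h3
  obtain ⟨ρ, hρ, hr⟩ := exists_sign_pairs hv h2
  have hc : ContinuousOn (fun t => vol (v t) o e f) (Set.Ioo l r) :=
    continuousOn_vol hv continuousOn_const continuousOn_const continuousOn_const
  obtain ⟨τ, hτ, ht⟩ := exists_sign isPreconnected_Ioo hc fun t ht => h1 t ht.1 ht.2
  refine ⟨-(σ * τ), by rcases hσ with rfl | rfl <;> rcases hτ with rfl | rfl <;> norm_num, ?_⟩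
  intro a b a' b' k1 k2 k3 k4 k5
  have e1 : ∀ b x, vol (v a) o (v b) x = -vol (v a) (v b) o x := fun b x => vol_swap23 ..
  have e2 : ∀ a x, vol (v b') o (v a) x = vol (v a) (v b') o x := fun a x => by unfold vol; ring
  -- Again one exchange at a time, (a,b), (a,b'), (a',b'), with `o` kept as the third point of the
  -- plane.
  have s1 := ratio_lt_ratio (a := v a) (b := o) (c := v b) (d := v b') (e := e) (f := f)
    (σ := σ) (τ := τ)
    (by rw [e1, vol_swap34 _ _ (v b') o, neg_neg]; exact hs a b b' k1 k2 (by linarith) k5)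
    (ht a ⟨k1, by linarith⟩)
    (by rw [e1, e1, neg_mul_neg]
        exact mul_pos_of_sign (hr a b k1 k2 (by linarith)) (hr a b' k1 (by linarith) k5))
  have s2 := ratio_lt_ratio (a := v b') (b := o) (c := v a) (d := v a') (e := e) (f := f)
    (σ := σ) (τ := τ)
    (by rw [e2, vol_swap34 _ _ (v a') o, vol_swap23 _ (v a') (v b'), neg_neg]
        exact hs a a' b' k1 (by linarith) k4 k5)
    (ht b' ⟨by linarith, k5⟩)
    (by rw [e2, e2]
        exact mul_pos_of_sign (hr a b' k1 (by linarith) k5) (hr a' b' (by linarith) k4 k5))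
  rw [e1, e1, e1, e1, neg_div_neg_eq, neg_div_neg_eq] at s1
  rw [e2, e2, e2, e2] at s2
  linarith

end Signs

/-! ### A planar intermediate value theorem -/

section PlanarIntermediateValue

/-- A continuous function on an interval, negative at the left end, positive at the right end and
with a single zero `c` is negative to the left of `c`. -/
lemma neg_of_lt_zero_of_unique {g : ℝ → ℝ} {a b c x : ℝ} (hg : ContinuousOn g (Set.Icc a b))
    (ha : g a < 0) (hu : ∀ y ∈ Set.Icc a b, g y = 0 → y = c) (hcb : c ≤ b) (hx : a ≤ x)
    (hxc : x < c) : g x < 0 := by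
  by_contra! hn
  obtain ⟨y, hy, hy0⟩ := intermediate_value_Icc hx (hg.mono (Set.Icc_subset_Icc_right
    (hxc.le.trans hcb))) (show (0 : ℝ) ∈ Set.Icc (g a) (g x) from ⟨ha.le, hn⟩)
  have := hu y ⟨hy.1, hy.2.trans (hxc.le.trans hcb)⟩ hy0
  linarith [hy.2]

lemma pos_of_gt_zero_of_unique {g : ℝ → ℝ} {a b c x : ℝ} (hg : ContinuousOn g (Set.Icc a b))
    (hb : 0 < g b) (hu : ∀ y ∈ Set.Icc a b, g y = 0 → y = c) (hac : a ≤ c) (hx : x ≤ b)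
    (hxc : c < x) : 0 < g x := by
  by_contra! hn
  obtain ⟨y, hy, hy0⟩ := intermediate_value_Icc hx (hg.mono (Set.Icc_subset_Icc_left
    (hac.trans hxc.le))) (show (0 : ℝ) ∈ Set.Icc (g x) (g b) from ⟨hn, hb.le⟩)
  have := hu y ⟨(hac.trans hxc.le).trans hy.1, hy.2⟩ hy0
  linarith [hy.1]

/-- Two real functions of two variables whose signs around `(x₀, z₀)` are prescribed on opposite
quadrants, and the first of which has at most one zero on each horizontal line, keep a common zero
under small perturbations. -/
lemma eventually_exists_common_zero {T : Type*} [TopologicalSpace T] {p₀ : T} {x₀ z₀ η : ℝ}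
    (hη : 0 < η) {g h : T → ℝ → ℝ → ℝ}
    (hg : ∀ p, ∀ x ∈ Set.Icc (x₀ - η) (x₀ + η), ∀ z ∈ Set.Icc (z₀ - η) (z₀ + η),
      ContinuousAt (fun q : T × ℝ × ℝ => g q.1 q.2.1 q.2.2) (p, x, z))
    (hh : ∀ p, ∀ x ∈ Set.Icc (x₀ - η) (x₀ + η), ∀ z ∈ Set.Icc (z₀ - η) (z₀ + η),
      ContinuousAt (fun q : T × ℝ × ℝ => h q.1 q.2.1 q.2.2) (p, x, z))
    (g1 : ∀ x ∈ Set.Icc x₀ (x₀ + η), ∀ z ∈ Set.Icc z₀ (z₀ + η), x ≠ x₀ ∨ z ≠ z₀ → 0 < g p₀ x z)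
    (g2 : ∀ x ∈ Set.Icc (x₀ - η) x₀, ∀ z ∈ Set.Icc (z₀ - η) z₀, x ≠ x₀ ∨ z ≠ z₀ → g p₀ x z < 0)
    (h1 : ∀ x ∈ Set.Icc x₀ (x₀ + η), ∀ z ∈ Set.Icc (z₀ - η) z₀, x ≠ x₀ ∨ z ≠ z₀ → 0 < h p₀ x z)
    (h2 : ∀ x ∈ Set.Icc (x₀ - η) x₀, ∀ z ∈ Set.Icc z₀ (z₀ + η), x ≠ x₀ ∨ z ≠ z₀ → h p₀ x z < 0)
    (hu : ∀ᶠ p in 𝓝 p₀, ∀ z ∈ Set.Icc (z₀ - η) (z₀ + η), ∀ x ∈ Set.Icc (x₀ - η) (x₀ + η),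
      ∀ x' ∈ Set.Icc (x₀ - η) (x₀ + η), g p x z = 0 → g p x' z = 0 → x = x') :
    ∀ᶠ p in 𝓝 p₀, ∃ x ∈ Set.Icc (x₀ - η) (x₀ + η), ∃ z ∈ Set.Icc (z₀ - η) (z₀ + η),
      g p x z = 0 ∧ h p x z = 0 := by
  have mx0 : x₀ ∈ Set.Icc (x₀ - η) (x₀ + η) := ⟨by linarith, by linarith⟩
  have mz0 : z₀ ∈ Set.Icc (z₀ - η) (z₀ + η) := ⟨by linarith, by linarith⟩
  have mxr : x₀ + η ∈ Set.Icc (x₀ - η) (x₀ + η) := ⟨by linarith, by linarith⟩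
  have mxl : x₀ - η ∈ Set.Icc (x₀ - η) (x₀ + η) := ⟨by linarith, by linarith⟩
  have mapz : ∀ (x : ℝ) (p : T) (z : ℝ), Tendsto (fun q : T × ℝ => (q.1, x, q.2)) (𝓝 (p, z)) (𝓝 (p, x, z)) :=
    fun x p z => (by fun_prop : Continuous fun q : T × ℝ => (q.1, x, q.2)).tendsto (p, z)
  have evr : ∀ᶠ q : T × ℝ in 𝓝 (p₀, z₀), 0 < g q.1 (x₀ + η) q.2 :=
    ((hg p₀ _ mxr z₀ mz0).tendsto.comp (mapz _ _ _)).eventually_const_lt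
      (g1 _ ⟨by linarith, le_rfl⟩ z₀ ⟨le_rfl, by linarith⟩ (Or.inl (by linarith)))
  have evl : ∀ᶠ q : T × ℝ in 𝓝 (p₀, z₀), g q.1 (x₀ - η) q.2 < 0 :=
    ((hg p₀ _ mxl z₀ mz0).tendsto.comp (mapz _ _ _)).eventually_lt_const
      (g2 _ ⟨le_rfl, by linarith⟩ z₀ ⟨by linarith, le_rfl⟩ (Or.inl (by linarith)))
  obtain ⟨P, hP, Q, hQ, hPQ⟩ := eventually_prod_iff.1 ((nhds_prod_eq (x := p₀) (y := z₀)) ▸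
    evr.and evl)
  obtain ⟨δ', hδ', hδQ⟩ := Metric.eventually_nhds_iff_ball.1 hQ
  -- The height of the box is cut down to `δ`, so that on its whole left and right sides `g` stays
  -- negative and positive, respectively, for parameters near `p₀`.
  obtain ⟨δ, hδ, hδη, hδδ⟩ : ∃ δ > 0, δ ≤ η ∧ δ < δ' :=
    ⟨min η (δ' / 2), lt_min hη (by linarith), min_le_left _ _,
      (min_le_right _ _).trans_lt (by linarith)⟩
  have hQ' : ∀ z ∈ Set.Icc (z₀ - δ) (z₀ + δ), Q z := fun z hz => hδQ z (by
    rw [Metric.mem_ball, Real.dist_eq, abs_lt]; constructor <;> linarith [hz.1, hz.2])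
  have sub : Set.Icc (z₀ - δ) (z₀ + δ) ⊆ Set.Icc (z₀ - η) (z₀ + η) :=
    Set.Icc_subset_Icc (by linarith) (by linarith)
  have mzr : z₀ + δ ∈ Set.Icc (z₀ - δ) (z₀ + δ) := ⟨by linarith, by linarith⟩
  have mzl : z₀ - δ ∈ Set.Icc (z₀ - δ) (z₀ + δ) := ⟨by linarith, by linarith⟩
  have mapp : ∀ x z : ℝ, Tendsto (fun p : T => (p, x, z)) (𝓝 p₀) (𝓝 (p₀, x, z)) :=
    fun x z => (by fun_prop : Continuous fun p : T => (p, x, z)).tendsto p₀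
  have e1 : ∀ᶠ p in 𝓝 p₀, 0 < g p x₀ (z₀ + δ) :=
    ((hg p₀ _ mx0 _ (sub mzr)).tendsto.comp (mapp _ _)).eventually_const_lt
      (g1 _ ⟨le_rfl, by linarith⟩ _ ⟨by linarith, by linarith⟩ (Or.inr (by linarith)))
  have e2 : ∀ᶠ p in 𝓝 p₀, g p x₀ (z₀ - δ) < 0 :=
    ((hg p₀ _ mx0 _ (sub mzl)).tendsto.comp (mapp _ _)).eventually_lt_const
      (g2 _ ⟨by linarith, le_rfl⟩ _ ⟨by linarith, by linarith⟩ (Or.inr (by linarith)))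
  have mapx : ∀ z x : ℝ, Tendsto (fun q : T × ℝ => (q.1, q.2, z)) (𝓝 (p₀, x)) (𝓝 (p₀, x, z)) :=
    fun z x => (by fun_prop : Continuous fun q : T × ℝ => (q.1, q.2, z)).tendsto (p₀, x)
  have e3 : ∀ᶠ p in 𝓝 p₀, ∀ x ∈ Set.Icc (x₀ - η) x₀, h p x (z₀ + δ) < 0 := by
    refine isCompact_Icc.eventually_forall_of_forall_eventually fun x hx => ?_
    exact ((hh p₀ x ⟨hx.1, by linarith [hx.2]⟩ _ (sub mzr)).tendsto.comp
      (mapx _ _)).eventually_lt_const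
      (h2 _ hx _ ⟨by linarith, by linarith⟩ (Or.inr (by linarith)))
  have e4 : ∀ᶠ p in 𝓝 p₀, ∀ x ∈ Set.Icc x₀ (x₀ + η), 0 < h p x (z₀ - δ) := by
    refine isCompact_Icc.eventually_forall_of_forall_eventually fun x hx => ?_
    exact ((hh p₀ x ⟨by linarith [hx.1], hx.2⟩ _ (sub mzl)).tendsto.comp
      (mapx _ _)).eventually_const_lt
      (h1 _ hx _ ⟨by linarith, by linarith⟩ (Or.inr (by linarith)))
  filter_upwards [hP, e1, e2, e3, e4, hu] with p hp k1 k2 k3 k4 ku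
  have cx : ∀ z ∈ Set.Icc (z₀ - δ) (z₀ + δ),
      ContinuousOn (fun x => g p x z) (Set.Icc (x₀ - η) (x₀ + η)) := fun z hz x hx =>
    (ContinuousAt.comp (f := fun x : ℝ => (p, x, z)) (hg p x hx z (sub hz))
      (by fun_prop)).continuousWithinAt
  have cz : ∀ x ∈ Set.Icc (x₀ - η) (x₀ + η), ∀ z ∈ Set.Icc (z₀ - δ) (z₀ + δ),
      ContinuousAt (fun z => g p x z) z := fun x hx z hz =>
    ContinuousAt.comp (f := fun z : ℝ => (p, x, z)) (hg p x hx z (sub hz)) (by fun_prop)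
  have ex : ∀ z : ℝ, ∃ x, z ∈ Set.Icc (z₀ - δ) (z₀ + δ) →
      x ∈ Set.Icc (x₀ - η) (x₀ + η) ∧ g p x z = 0 := by
    intro z
    by_cases hz : z ∈ Set.Icc (z₀ - δ) (z₀ + δ)
    · obtain ⟨x, hx, hx0⟩ := intermediate_value_Icc (by linarith) (cx z hz)
        (show (0 : ℝ) ∈ Set.Icc _ _ from ⟨(hPQ hp (hQ' z hz)).2.le, (hPQ hp (hQ' z hz)).1.le⟩)
      exact ⟨x, fun _ => ⟨hx, hx0⟩⟩
    · exact ⟨0, fun h => absurd h hz⟩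
  -- By uniqueness of zeros on horizontal lines, the zero set of `g p` in the box is the graph of a
  -- function `φ` of `z`. Its continuity follows from the signs of `g p` on both sides of the graph.
  choose φ hφ using ex
  have uq : ∀ z ∈ Set.Icc (z₀ - δ) (z₀ + δ), ∀ x ∈ Set.Icc (x₀ - η) (x₀ + η),
      g p x z = 0 → x = φ z := fun z hz x hx h0 =>
    ku z (sub hz) x hx _ (hφ z hz).1 h0 (hφ z hz).2
  have neg : ∀ z ∈ Set.Icc (z₀ - δ) (z₀ + δ), ∀ x, x₀ - η ≤ x → x < φ z → g p x z < 0 :=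
    fun z hz x hx hxφ => neg_of_lt_zero_of_unique (g := fun x => g p x z) (cx z hz) (hPQ hp (hQ' z hz)).2 (uq z hz)
      (hφ z hz).1.2 hx hxφ
  have pos : ∀ z ∈ Set.Icc (z₀ - δ) (z₀ + δ), ∀ x, x ≤ x₀ + η → φ z < x → 0 < g p x z :=
    fun z hz x hx hxφ => pos_of_gt_zero_of_unique (g := fun x => g p x z) (cx z hz) (hPQ hp (hQ' z hz)).1 (uq z hz)
      (hφ z hz).1.1 hx hxφ
  have hφc : ContinuousOn φ (Set.Icc (z₀ - δ) (z₀ + δ)) := by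
    intro z hz
    refine tendsto_order.2 ⟨fun a ha => ?_, fun a ha => ?_⟩
    · have hlt : max a (x₀ - η) < φ z := max_lt ha (lt_of_le_of_ne (hφ z hz).1.1 fun h => by
        have := (hPQ hp (hQ' z hz)).2
        rw [h, (hφ z hz).2] at this
        exact lt_irrefl _ this)
      have hm : max a (x₀ - η) ∈ Set.Icc (x₀ - η) (x₀ + η) :=
        ⟨le_max_right _ _, hlt.le.trans (hφ z hz).1.2⟩
      have := ((cz _ hm z hz).tendsto.eventually_lt_const (neg z hz _ (le_max_right _ _) hlt))
      filter_upwards [this.filter_mono nhdsWithin_le_nhds, self_mem_nhdsWithin] with z' h1 hz'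
      refine (le_max_left a (x₀ - η)).trans_lt (not_le.1 fun h => ?_)
      rcases h.eq_or_lt with h | h
      · rw [← h, (hφ z' hz').2] at h1; exact lt_irrefl _ h1
      · exact lt_asymm h1 (pos z' hz' _ hm.2 h)
    · have hlt : φ z < min a (x₀ + η) := lt_min ha (lt_of_le_of_ne (hφ z hz).1.2 fun h => by
        have := (hPQ hp (hQ' z hz)).1
        rw [← h, (hφ z hz).2] at this
        exact lt_irrefl _ this)
      have hm : min a (x₀ + η) ∈ Set.Icc (x₀ - η) (x₀ + η) :=
        ⟨(hφ z hz).1.1.trans hlt.le, min_le_right _ _⟩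
      have := ((cz _ hm z hz).tendsto.eventually_const_lt (pos z hz _ (min_le_right _ _) hlt))
      filter_upwards [this.filter_mono nhdsWithin_le_nhds, self_mem_nhdsWithin] with z' h1 hz'
      refine (not_le.1 fun h => ?_ : φ z' < min a (x₀ + η)).trans_le (min_le_left _ _)
      rcases h.eq_or_lt with h | h
      · rw [h, (hφ z' hz').2] at h1; exact lt_irrefl _ h1
      · exact lt_asymm h1 (neg z' hz' _ hm.1 h)
  have hhc : ContinuousOn (fun z => h p (φ z) z) (Set.Icc (z₀ - δ) (z₀ + δ)) := fun z hz =>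
    ContinuousAt.comp_continuousWithinAt (f := fun z : ℝ => (p, φ z, z))
      (hh p (φ z) (hφ z hz).1 z (sub hz))
      (continuousWithinAt_const.prodMk ((hφc z hz).prodMk continuousWithinAt_id))
  -- The graph leaves the box through the left half of the top side, where `h` is negative, and the
  -- right half of the bottom side, where `h` is positive. Hence `h` vanishes somewhere on the
  -- graph.
  have l1 : φ (z₀ + δ) ≤ x₀ := not_lt.1 fun hlt =>
    lt_asymm k1 (neg _ mzr _ mx0.1 hlt)
  have l2 : x₀ ≤ φ (z₀ - δ) := not_lt.1 fun hlt =>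
    lt_asymm k2 (pos _ mzl _ mx0.2 hlt)
  obtain ⟨z, hz, hz0⟩ := intermediate_value_Icc' (by linarith) hhc
    (show (0 : ℝ) ∈ Set.Icc _ _ from ⟨(k3 _ ⟨(hφ _ mzr).1.1, l1⟩).le,
      (k4 _ ⟨l2, (hφ _ mzl).1.2⟩).le⟩)
  exact ⟨φ z, (hφ z hz).1, z, sub hz, (hφ z hz).2, hz0⟩

end PlanarIntermediateValue

/-! ### Convergence of subspaces -/

lemma tendsto_clm_apply {F G ι : Type*} [NormedAddCommGroup F] [NormedSpace ℝ F]
    [NormedAddCommGroup G] [NormedSpace ℝ G] {l : Filter ι} {A : ι → F →L[ℝ] G} {A' : F →L[ℝ] G}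
    {u : ι → F} {u' : F} (hA : Tendsto A l (𝓝 A')) (hu : Tendsto u l (𝓝 u')) :
    Tendsto (fun i => A i (u i)) l (𝓝 (A' u')) := by
  have h2 : Continuous fun p : (F →L[ℝ] G) × F => p.1 p.2 :=
    isBoundedBilinearMap_apply.continuous
  exact (h2.tendsto (A', u')).comp (hA.prodMk_nhds hu)

lemma tendsto_rank_one {F ι : Type*} [NormedAddCommGroup F] [InnerProductSpace ℝ F]
    {l : Filter ι} {u : ι → F} {u' : F} (hu : Tendsto u l (𝓝 u')) (h0 : u' ≠ 0) :
    Tendsto (fun i => (‖u i‖ ^ 2)⁻¹ • (innerSL ℝ (u i)).smulRight (u i)) l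
      (𝓝 ((‖u'‖ ^ 2)⁻¹ • (innerSL ℝ u').smulRight u')) := by
  have h1 : Continuous fun u : F => (innerSL ℝ u).smulRight u := by fun_prop
  exact ((hu.norm.pow 2).inv₀ (by positivity)).smul ((h1.tendsto u').comp hu)

section Grassmannian

variable {n : ℕ} {ι : Type*} {l : Filter ι}

lemma isEmbedding_starProjection (n : ℕ) :
    IsEmbedding fun W : Submodule ℝ (E n) => W.starProjection :=
  ⟨⟨rfl⟩, fun _ _ h => Submodule.starProjection_inj.1 h⟩

instance (n : ℕ) : T2Space (Submodule ℝ (E n)) := (isEmbedding_starProjection n).t2Space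

instance : T2Space RP3 :=
  inferInstanceAs (T2Space {L : Submodule ℝ (E 4) // Module.finrank ℝ L = 1})

lemma tendsto_submodule_iff {W : ι → Submodule ℝ (E n)} {W' : Submodule ℝ (E n)} :
    Tendsto W l (𝓝 W') ↔ Tendsto (fun i => (W i).starProjection) l (𝓝 W'.starProjection) :=
  (isEmbedding_starProjection n).tendsto_nhds_iff

lemma tendsto_rp3_iff {p : ι → RP3} {p' : RP3} :
    Tendsto p l (𝓝 p') ↔ Tendsto (fun i => (p i).1) l (𝓝 p'.1) :=
  tendsto_subtype_rng

lemma tendsto_starProjection_apply {W : ι → Submodule ℝ (E n)} {W' : Submodule ℝ (E n)}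
    (h : Tendsto W l (𝓝 W')) {u : ι → E n} {u' : E n} (hu : Tendsto u l (𝓝 u')) :
    Tendsto (fun i => (W i).starProjection (u i)) l (𝓝 (W'.starProjection u')) :=
  tendsto_clm_apply (tendsto_submodule_iff.1 h) hu

lemma mem_of_tendsto_submodule [l.NeBot] {W : ι → Submodule ℝ (E n)} {W' : Submodule ℝ (E n)}
    (h : Tendsto W l (𝓝 W')) {u : ι → E n} {u' : E n} (hu : Tendsto u l (𝓝 u'))
    (hm : ∀ᶠ i in l, u i ∈ W i) : u' ∈ W' := by
  rw [← Submodule.starProjection_eq_self_iff]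
  refine tendsto_nhds_unique (tendsto_starProjection_apply h hu) (hu.congr' ?_)
  filter_upwards [hm] with i hi
  exact (Submodule.starProjection_eq_self_iff.2 hi).symm

lemma le_of_tendsto_submodule [l.NeBot] {V W : ι → Submodule ℝ (E n)} {V' W' : Submodule ℝ (E n)}
    (hV : Tendsto V l (𝓝 V')) (hW : Tendsto W l (𝓝 W')) (hm : ∀ᶠ i in l, V i ≤ W i) :
    V' ≤ W' := by
  intro u hu
  have := tendsto_starProjection_apply hV (tendsto_const_nhds (x := u))
  rw [Submodule.starProjection_eq_self_iff.2 hu] at this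
  refine mem_of_tendsto_submodule hW this ?_
  filter_upwards [hm] with i hi
  exact hi (Submodule.starProjection_apply_mem _ _)

lemma starProjection_span_singleton (u : E n) :
    (ℝ ∙ u).starProjection = (‖u‖ ^ 2)⁻¹ • (innerSL ℝ u).smulRight u := by
  ext1 w
  rw [Submodule.starProjection_singleton]
  simp [div_eq_inv_mul, smul_smul]

lemma tendsto_span_singleton {u : ι → E n} {u' : E n} (hu : Tendsto u l (𝓝 u')) (h0 : u' ≠ 0) :
    Tendsto (fun i => ℝ ∙ u i) l (𝓝 (ℝ ∙ u')) := by
  rw [tendsto_submodule_iff]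
  simp_rw [starProjection_span_singleton]
  exact tendsto_rank_one hu h0

/-- A Gram–Schmidt step: the component of `u` orthogonal to `A` spans the orthogonal complement of
`A` in the sum (and is zero if `u` lies in `A`). -/
lemma starProjection_sup_span_singleton (A : Submodule ℝ (E n)) (u : E n) :
    (A ⊔ ℝ ∙ u).starProjection =
      A.starProjection + (ℝ ∙ (u - A.starProjection u)).starProjection := by
  have hperp := A.sub_starProjection_mem_orthogonal u
  set w := u - A.starProjection u with hw
  have hwA : ∀ x ∈ A, inner ℝ x w = 0 := fun x hx => (Submodule.mem_orthogonal _ _).1 hperp x hx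
  have hwmem : w ∈ A ⊔ ℝ ∙ u := Submodule.sub_mem _
    (Submodule.mem_sup_right (Submodule.mem_span_singleton_self u))
    (Submodule.mem_sup_left (Submodule.starProjection_apply_mem _ _))
  ext1 x
  refine Submodule.eq_starProjection_of_mem_of_inner_eq_zero ?_ ?_
  · refine Submodule.add_mem _ (Submodule.mem_sup_left (Submodule.starProjection_apply_mem _ _))
      ((Submodule.span_singleton_le_iff_mem _ _).2 hwmem (Submodule.starProjection_apply_mem _ _))
  · obtain ⟨c, hc⟩ := Submodule.mem_span_singleton.1
      ((ℝ ∙ w).starProjection_apply_mem x)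
    have k1 : ∀ y ∈ A, inner ℝ (x - A.starProjection x) y = 0 :=
      fun y hy => A.starProjection_inner_eq_zero x y hy
    have k2 : inner ℝ (x - (ℝ ∙ w).starProjection x) w = 0 :=
      (ℝ ∙ w).starProjection_inner_eq_zero x w (Submodule.mem_span_singleton_self w)
    intro y hy
    obtain ⟨a, ha, b, hb, rfl⟩ := Submodule.mem_sup.1 hy
    obtain ⟨d, rfl⟩ := Submodule.mem_span_singleton.1 hb
    have hu : u = w + A.starProjection u := by simp [hw]
    have hy' : a + d • u = (a + d • A.starProjection u) + d • w := by
      have : d • u = d • w + d • A.starProjection u := by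
        rw [← smul_add]; exact congrArg (d • ·) hu
      rw [this]; abel
    have hm : a + d • A.starProjection u ∈ A :=
      A.add_mem ha (A.smul_mem _ (Submodule.starProjection_apply_mem _ _))
    simp only [_root_.add_apply]
    rw [hy', inner_add_right, ← hc]
    have e1 : x - (A.starProjection x + c • w) = (x - A.starProjection x) - c • w := by abel
    have e2 : x - (A.starProjection x + c • w) = (x - c • w) - A.starProjection x := by abel
    rw [hc] at e2
    have t1 : inner ℝ (x - (A.starProjection x + c • w)) (a + d • A.starProjection u) = 0 := by
      rw [e1, inner_sub_left, k1 _ hm, inner_smul_left, real_inner_comm, hwA _ hm]; simp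
    have t2 : inner ℝ (x - (A.starProjection x + c • w)) (d • w) = 0 := by
      rw [hc, e2, inner_smul_right, inner_sub_left, k2,
        hwA _ (Submodule.starProjection_apply_mem _ _)]; simp
    rw [t1, t2, add_zero]

/-- Sums are not continuous in general; here the orthogonal component of the added vector stays
nonzero in the limit, which makes its rank one projection converge. -/
lemma tendsto_sup_span_singleton {A : ι → Submodule ℝ (E n)} {A' : Submodule ℝ (E n)}
    (hA : Tendsto A l (𝓝 A')) {u : ι → E n} {u' : E n} (hu : Tendsto u l (𝓝 u'))
    (hu' : u' ∉ A') : Tendsto (fun i => A i ⊔ ℝ ∙ u i) l (𝓝 (A' ⊔ ℝ ∙ u')) := by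
  rw [tendsto_submodule_iff]
  simp_rw [starProjection_sup_span_singleton]
  refine (tendsto_submodule_iff.1 hA).add (tendsto_submodule_iff.1 (tendsto_span_singleton ?_ ?_))
  · exact hu.sub (tendsto_starProjection_apply hA hu)
  · rw [sub_ne_zero]
    exact fun h => hu' (Submodule.starProjection_eq_self_iff.1 h.symm)

/-- The intersection point of a moving hyperplane with a fixed line depends continuously on the
hyperplane. -/
lemma tendsto_coeff_of_tendsto_submodule {H : ι → Submodule ℝ (E n)} {H' : Submodule ℝ (E n)}
    (hH : Tendsto H l (𝓝 H')) {e f : ι → E n} {e' f' : E n} (he : Tendsto e l (𝓝 e'))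
    (hf : Tendsto f l (𝓝 f')) (hf' : f' ∉ H') {ρ : ι → ℝ} {ρ' : ℝ}
    (hρ : ∀ᶠ i in l, e i - ρ i • f i ∈ H i) (hρ' : e' - ρ' • f' ∈ H') : Tendsto ρ l (𝓝 ρ') := by
  -- Applying `x ↦ x - Px`, with `P` the projection onto `H i`, to `e - ρ • f ∈ H i` and pairing
  -- with the fixed vector `N` exhibits `ρ` as a quotient of convergent quantities whose denominator
  -- tends to `‖N‖² ≠ 0`.
  set N := f' - H'.starProjection f' with hN
  have hN0 : N ≠ 0 := by
    rw [hN, sub_ne_zero]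
    exact fun h => hf' (Submodule.starProjection_eq_self_iff.1 h.symm)
  have lim : ∀ (x : ι → E n) (x' : E n), Tendsto x l (𝓝 x') →
      Tendsto (fun i => inner ℝ (x i - (H i).starProjection (x i)) N) l
      (𝓝 (inner ℝ (x' - H'.starProjection x') N)) := fun x x' hx =>
    (hx.sub (tendsto_starProjection_apply hH hx)).inner tendsto_const_nhds
  have key : ∀ (K : Submodule ℝ (E n)) (r : ℝ) (e f : E n), e - r • f ∈ K →
      inner ℝ (e - K.starProjection e) N = r * inner ℝ (f - K.starProjection f) N := by
    intro K r e f h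
    have := Submodule.starProjection_eq_self_iff.2 h
    rw [map_sub, map_smul] at this
    have h2 : e - K.starProjection e = r • (f - K.starProjection f) := by
      rw [smul_sub, sub_eq_sub_iff_sub_eq_sub, ← this]
    rw [h2, inner_smul_left]; simp
  have hpos : inner ℝ (f' - H'.starProjection f') N ≠ 0 := by
    rw [← hN]; simpa using hN0
  have h1 := (lim e e' he).div (lim f f' hf) hpos
  rw [key H' ρ' e' f' hρ', mul_div_cancel_right₀ _ hpos] at h1
  refine h1.congr' ?_
  filter_upwards [hρ, (lim f f' hf).eventually_ne hpos] with i hi h0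
  simp only [Pi.div_apply]
  rw [key _ _ _ _ hi, mul_div_cancel_right₀ _ h0]

end Grassmannian

/-! ### The oriented circle and its positive triples -/

section Circle

/-- Cutting the circle at `a` turns the cyclic order into the linear order of the parameters in
(0,1). All later sign arguments take place on that interval. -/
lemma sbtw_add_add_iff (a : UnitAddCircle) {s t : ℝ} (hs : s ∈ Set.Ioo (0 : ℝ) 1)
    (ht : t ∈ Set.Ioo (0 : ℝ) 1) : sbtw a (a + s) (a + t) ↔ s < t := by
  induction a using QuotientAddGroup.induction_on with | H a
  rw [sbtw_iff_not_btw, ← btw_cyclic, ← btw_cyclic, ← not_le, not_iff_not]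
  have e1 : ((a : ℝ) : UnitAddCircle) + (s : UnitAddCircle) = ((a + s : ℝ) : UnitAddCircle) := rfl
  have e2 : ((a : ℝ) : UnitAddCircle) + (t : UnitAddCircle) = ((a + t : ℝ) : UnitAddCircle) := rfl
  change btw (a : UnitAddCircle) ((a : UnitAddCircle) + t) ((a : UnitAddCircle) + s) ↔ _
  rw [e1, e2]
  refine QuotientAddGroup.btw_coe_iff'.trans ?_
  rw [add_sub_cancel_left, add_sub_cancel_left,
    (toIcoMod_eq_self _).2 ⟨ht.1.le, by simpa using ht.2⟩,
    (toIocMod_eq_self _).2 ⟨hs.1, by simpa using hs.2.le⟩]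

lemma exists_eq_add_of_ne {a b : UnitAddCircle} (h : b ≠ a) :
    ∃ s ∈ Set.Ioo (0 : ℝ) 1, b = a + s := by
  obtain ⟨s, hs, hs'⟩ := AddCircle.coe_image_Ico_eq (p := (1 : ℝ)) 0 ▸ Set.mem_univ (b - a)
  refine ⟨s, ⟨lt_of_le_of_ne hs.1 ?_, by simpa using hs.2⟩, by rw [hs']; abel⟩
  rintro rfl
  apply h
  rw [← sub_eq_zero, ← hs']; rfl

lemma coe_injOn_Ico : Set.InjOn (fun s : ℝ => (s : UnitAddCircle)) (Set.Ico 0 1) := by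
  intro s hs t ht h
  have h' : ((s - t : ℝ) : UnitAddCircle) = 0 := by
    rw [AddCircle.coe_sub, sub_eq_zero]; exact h
  obtain ⟨n, hn⟩ := (AddCircle.coe_eq_zero_iff 1).1 h'
  rw [zsmul_eq_mul, mul_one] at hn
  have h1 : (n : ℝ) < 1 := by rw [hn]; linarith [hs.2, ht.1]
  have h2 : (-1 : ℝ) < n := by rw [hn]; linarith [hs.1, ht.2]
  have : n = 0 := by
    have h1 : n < 1 := by exact_mod_cast h1
    have h2 : -1 < n := by exact_mod_cast h2
    omega
  rw [this, Int.cast_zero] at hn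
  linarith

lemma sbtw_ne {a b c : UnitAddCircle} (h : sbtw a b c) : a ≠ b ∧ b ≠ c ∧ a ≠ c := by
  refine ⟨?_, ?_, ?_⟩ <;> rintro rfl
  · exact sbtw_irrefl_left h
  · exact sbtw_irrefl_right h
  · exact sbtw_irrefl_left_right h

lemma sbtw_or_sbtw {a b c : UnitAddCircle} (hab : a ≠ b) (hbc : b ≠ c) (hac : a ≠ c) :
    sbtw a b c ∨ sbtw c b a := by
  by_contra! h
  simp only [sbtw_iff_not_btw, not_not] at h
  rcases btw_antisymm h.2 h.1 with h | h | h
  · exact hab h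
  · exact hbc h
  · exact hac h.symm

/-- After subtraction of the first entry, positive triples correspond to the image of the open
triangle 0 < s < t < 1 under the quotient map, which is open. -/
lemma isOpen_sbtw : IsOpen {t : UnitAddCircle × UnitAddCircle × UnitAddCircle |
    sbtw t.1 t.2.1 t.2.2} := by
  have hm : IsOpenMap fun s : ℝ => (s : UnitAddCircle) := QuotientAddGroup.isOpenMap_coe
  have ho : IsOpen {p : ℝ × ℝ | 0 < p.1 ∧ p.1 < p.2 ∧ p.2 < 1} :=
    (isOpen_lt continuous_const continuous_fst).inter
      ((isOpen_lt continuous_fst continuous_snd).inter (isOpen_lt continuous_snd continuous_const))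
  have himg := (hm.prodMap hm) _ ho
  have hc : Continuous fun t : UnitAddCircle × UnitAddCircle × UnitAddCircle =>
      (t.2.1 - t.1, t.2.2 - t.1) := by fun_prop
  convert himg.preimage hc using 1
  ext ⟨a, b, c⟩
  constructor
  · intro h
    obtain ⟨h1, h2, h3⟩ : a ≠ b ∧ b ≠ c ∧ a ≠ c := sbtw_ne h
    obtain ⟨s, hs, rfl⟩ := exists_eq_add_of_ne h1.symm
    obtain ⟨t, ht, rfl⟩ := exists_eq_add_of_ne h3.symm
    exact ⟨(s, t), ⟨hs.1, (sbtw_add_add_iff a hs ht).1 h, ht.2⟩, by simp⟩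
  · rintro ⟨⟨s, t⟩, ⟨h1, h2, h3⟩, h⟩
    simp only [Prod.map_apply, Prod.mk.injEq] at h
    have hb : b = a + s := by rw [h.1]; abel
    have hc : c = a + t := by rw [h.2]; abel
    subst hb hc
    exact (sbtw_add_add_iff a ⟨h1, h2.trans h3⟩ ⟨h1.trans h2, h3⟩).2 h2

variable {X : Type*} [TopologicalSpace X] (θ : X ≃ₜ UnitAddCircle)

/-- The point of the circle `X` at oriented distance `t` from `b`. -/
def shift (b : X) (t : ℝ) : X := θ.symm (θ b + (t : UnitAddCircle))

lemma continuous_shift (b : X) : Continuous (shift θ b) :=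
  θ.symm.continuous.comp (continuous_const.add (AddCircle.continuous_mk' 1))

lemma continuous_shift_uncurry : Continuous fun p : X × ℝ => shift θ p.1 p.2 :=
  θ.symm.continuous.comp ((θ.continuous.comp continuous_fst).add
    ((AddCircle.continuous_mk' 1).comp continuous_snd))

lemma shift_zero (b : X) : shift θ b 0 = b := by simp [shift]

lemma shift_one (b : X) : shift θ b 1 = b := by
  have : ((1 : ℝ) : UnitAddCircle) = 0 := AddCircle.coe_period 1
  simp [shift, this]

lemma shift_injOn (b : X) : Set.InjOn (shift θ b) (Set.Ico 0 1) := fun _ hs _ ht h =>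
  coe_injOn_Ico hs ht (add_left_cancel (θ.symm.injective h))

lemma shift_ne (b : X) {s t : ℝ} (hs : s ∈ Set.Ioo (0 : ℝ) 1) (ht : t ∈ Set.Ioo (0 : ℝ) 1)
    (h : s ≠ t) : shift θ b s ≠ shift θ b t := fun he =>
  h (shift_injOn θ b ⟨hs.1.le, hs.2⟩ ⟨ht.1.le, ht.2⟩ he)

lemma shift_ne_base (b : X) {s : ℝ} (hs : s ∈ Set.Ioo (0 : ℝ) 1) : shift θ b s ≠ b := fun he =>
  hs.1.ne' (shift_injOn θ b ⟨hs.1.le, hs.2⟩ ⟨le_rfl, one_pos⟩ (he.trans (shift_zero θ b).symm))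

lemma exists_shift_eq {b y : X} (h : y ≠ b) : ∃ s ∈ Set.Ioo (0 : ℝ) 1, shift θ b s = y := by
  obtain ⟨s, hs, h⟩ := exists_eq_add_of_ne (θ.injective.ne h)
  exact ⟨s, hs, by rw [shift, ← h, θ.symm_apply_apply]⟩

lemma sbtw_shift_iff (b : X) {s t : ℝ} (hs : s ∈ Set.Ioo (0 : ℝ) 1) (ht : t ∈ Set.Ioo (0 : ℝ) 1) :
    sbtw (θ b) (θ (shift θ b s)) (θ (shift θ b t)) ↔ s < t := by
  simp only [shift, θ.apply_symm_apply]
  exact sbtw_add_add_iff _ hs ht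

lemma isOpen_posTriple : IsOpen {t : X × X × X | sbtw (θ t.1) (θ t.2.1) (θ t.2.2)} :=
  isOpen_sbtw.preimage (f := fun t : X × X × X => (θ t.1, θ t.2.1, θ t.2.2)) (by fun_prop)

lemma PosTriple.ne {θ : X ≃ₜ UnitAddCircle} (t : PosTriple θ) :
    t.1.1 ≠ t.1.2.1 ∧ t.1.2.1 ≠ t.1.2.2 ∧ t.1.1 ≠ t.1.2.2 := by
  obtain ⟨h1, h2, h3⟩ := sbtw_ne t.2
  exact ⟨fun h => h1 (congrArg θ h), fun h => h2 (congrArg θ h), fun h => h3 (congrArg θ h)⟩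

/-- The positively oriented triples starting from `x` with prescribed parameters. -/
def PosTriple.ofParams (x : X) (s t : ℝ) (hs : 0 < s) (hst : s < t) (ht : t < 1) : PosTriple θ :=
  ⟨(x, shift θ x s, shift θ x t),
    (sbtw_shift_iff θ x ⟨hs, hst.trans ht⟩ ⟨hs.trans hst, ht⟩).2 hst⟩

lemma PosTriple.exists_params (t : PosTriple θ) :
    ∃ s r : ℝ, ∃ (h1 : 0 < s) (h2 : s < r) (h3 : r < 1),
      t = PosTriple.ofParams θ t.1.1 s r h1 h2 h3 := by
  obtain ⟨⟨x, y, z⟩, ht⟩ := t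
  obtain ⟨h1, h2, h3⟩ : x ≠ y ∧ y ≠ z ∧ x ≠ z := PosTriple.ne (⟨(x, y, z), ht⟩ : PosTriple θ)
  obtain ⟨s, hs, rfl⟩ := exists_shift_eq θ h1.symm
  obtain ⟨r, hr, rfl⟩ := exists_shift_eq θ h3.symm
  exact ⟨s, r, hs.1, (sbtw_shift_iff θ x hs hr).1 ht, hr.2, rfl⟩

lemma t2Space_of_homeomorph (θ : X ≃ₜ UnitAddCircle) : T2Space X := θ.isEmbedding.t2Space

end Circle

/-! ### General position, lifts and limits for Frenet curves -/

section Frenet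

variable {X : Type*} [TopologicalSpace X] {ξ : X → FullFlag 4}

lemma finrank_comp (ξ : X → FullFlag 4) (k : Fin 5) (x : X) :
    Module.finrank ℝ (comp ξ k x) = (k : ℕ) := (ξ x).2.2 k

lemma comp_mono (ξ : X → FullFlag 4) (x : X) {k l : Fin 5} (h : k ≤ l) :
    comp ξ k x ≤ comp ξ l x := (ξ x).2.1 h

lemma IsHyperconvexFrenet.continuous_comp (hξ : IsHyperconvexFrenet ξ) (k : Fin 5) :
    Continuous (comp ξ k) :=
  (continuous_apply k).comp (continuous_subtype_val.comp hξ.continuous)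

lemma IsHyperconvexFrenet.eq_zero_of_sum (hξ : IsHyperconvexFrenet ξ) {j : ℕ} (k : Fin j → Fin 5)
    (hk : ∑ i, (k i : ℕ) ≤ 4) (x : Fin j → X) (hx : Function.Injective x) (u : Fin j → E 4)
    (hu : ∀ i, u i ∈ comp ξ (k i) (x i)) (h0 : ∑ i, u i = 0) : ∀ i, u i = 0 := fun i =>
  (iSupIndep_iff_finsetSum_eq_zero_imp_eq_zero _).1 (hξ.general_position j k hk x hx)
    Finset.univ u (fun i _ => hu i) h0 i (Finset.mem_univ i)

lemma IsHyperconvexFrenet.eq_zero_of_add₂ (hξ : IsHyperconvexFrenet ξ) (k l : Fin 5)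
    (hk : (k : ℕ) + l ≤ 4) {x y : X} (hxy : x ≠ y) {u w : E 4} (hu : u ∈ comp ξ k x)
    (hw : w ∈ comp ξ l y) (h0 : u + w = 0) : u = 0 ∧ w = 0 := by
  have := hξ.eq_zero_of_sum ![k, l] (by simpa [Fin.sum_univ_two] using hk) ![x, y]
    (by intro i j; fin_cases i <;> fin_cases j <;> simp [hxy, hxy.symm]) ![u, w]
    (by intro i; fin_cases i <;> simpa) (by simpa [Fin.sum_univ_two] using h0)
  exact ⟨this 0, this 1⟩

lemma IsHyperconvexFrenet.eq_zero_of_mem (hξ : IsHyperconvexFrenet ξ) (k l : Fin 5)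
    (hk : (k : ℕ) + l ≤ 4) {x y : X} (hxy : x ≠ y) {u : E 4} (hu : u ∈ comp ξ k x)
    (hw : u ∈ comp ξ l y) : u = 0 :=
  (hξ.eq_zero_of_add₂ k l hk hxy hu (neg_mem hw) (add_neg_cancel u)).1

lemma IsHyperconvexFrenet.eq_zero_of_add₃ (hξ : IsHyperconvexFrenet ξ) (k l m : Fin 5)
    (hk : (k : ℕ) + l + m ≤ 4) {x y z : X} (hxy : x ≠ y) (hyz : y ≠ z) (hxz : x ≠ z) {u w t : E 4}
    (hu : u ∈ comp ξ k x) (hw : w ∈ comp ξ l y) (ht : t ∈ comp ξ m z) (h0 : u + w + t = 0) :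
    u = 0 ∧ w = 0 ∧ t = 0 := by
  have := hξ.eq_zero_of_sum ![k, l, m] (by simpa [Fin.sum_univ_three] using hk) ![x, y, z]
    (by intro i j; fin_cases i <;> fin_cases j <;> simp [hxy, hxy.symm, hyz, hyz.symm, hxz,
      hxz.symm]) ![u, w, t]
    (by intro i; fin_cases i <;> simpa) (by simpa [Fin.sum_univ_three] using h0)
  exact ⟨this 0, this 1, this 2⟩

lemma IsHyperconvexFrenet.eq_zero_of_add₄ (hξ : IsHyperconvexFrenet ξ) {x y z p : X}
    (hxy : x ≠ y) (hyz : y ≠ z) (hxz : x ≠ z) (hxp : x ≠ p) (hyp : y ≠ p) (hzp : z ≠ p)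
    {u w t s : E 4} (hu : u ∈ comp ξ 1 x) (hw : w ∈ comp ξ 1 y) (ht : t ∈ comp ξ 1 z)
    (hs : s ∈ comp ξ 1 p) (h0 : u + w + t + s = 0) : u = 0 ∧ w = 0 ∧ t = 0 ∧ s = 0 := by
  have := hξ.eq_zero_of_sum ![1, 1, 1, 1] (by simp [Fin.sum_univ_four]) ![x, y, z, p]
    (by intro i j; fin_cases i <;> fin_cases j <;> simp [hxy, hxy.symm, hyz, hyz.symm, hxz,
      hxz.symm, hxp, hxp.symm, hyp, hyp.symm, hzp, hzp.symm]) ![u, w, t, s]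
    (by intro i; fin_cases i <;> simpa) (by simpa [Fin.sum_univ_four] using h0)
  exact ⟨this 0, this 1, this 2, this 3⟩

lemma IsHyperconvexFrenet.vol_ne_zero (hξ : IsHyperconvexFrenet ξ) {x y z p : X}
    (hxy : x ≠ y) (hyz : y ≠ z) (hxz : x ≠ z) (hxp : x ≠ p) (hyp : y ≠ p) (hzp : z ≠ p)
    {u w t s : E 4} (hu : u ∈ comp ξ 1 x) (hw : w ∈ comp ξ 1 y) (ht : t ∈ comp ξ 1 z)
    (hs : s ∈ comp ξ 1 p) (hu0 : u ≠ 0) (hw0 : w ≠ 0) (ht0 : t ≠ 0) (hs0 : s ≠ 0) :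
    vol u w t s ≠ 0 := by
  intro h
  obtain ⟨c, hc, h0⟩ := exists_relation_of_vol_eq_zero h
  obtain ⟨k1, k2, k3, k4⟩ := hξ.eq_zero_of_add₄ hxy hyz hxz hxp hyp hzp
    (Submodule.smul_mem _ (c 0) hu) (Submodule.smul_mem _ (c 1) hw)
    (Submodule.smul_mem _ (c 2) ht) (Submodule.smul_mem _ (c 3) hs) h0
  rw [smul_eq_zero_iff_left hu0] at k1
  rw [smul_eq_zero_iff_left hw0] at k2
  rw [smul_eq_zero_iff_left ht0] at k3
  rw [smul_eq_zero_iff_left hs0] at k4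
  exact hc (by ext i; fin_cases i <;> assumption)

lemma coeff_eq_zero {A : Submodule ℝ (E 4)} {e f : E 4} (he : e ∉ A) (hf : f ∈ A) (hf0 : f ≠ 0)
    {s t : ℝ} (h : s • e + t • f = 0) : s = 0 ∧ t = 0 := by
  have hs : s = 0 := by
    by_contra hs
    apply he
    have : e = s⁻¹ • (-(t • f)) := by
      rw [← eq_neg_of_add_eq_zero_left h, smul_smul, inv_mul_cancel₀ hs, one_smul]
    rw [this]
    exact A.smul_mem _ (A.neg_mem (A.smul_mem _ hf))
  subst hs
  simpa [hf0] using h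

/-- Two points and a tangent line of the curve are in general position. -/
lemma IsHyperconvexFrenet.vol_tangent_ne_zero (hξ : IsHyperconvexFrenet ξ) {x y z : X}
    (hxy : x ≠ y) (hyz : y ≠ z) (hxz : x ≠ z) {u w e f : E 4} (hu : u ∈ comp ξ 1 y)
    (hw : w ∈ comp ξ 1 z) (he : e ∈ comp ξ 2 x) (he' : e ∉ comp ξ 1 x) (hf : f ∈ comp ξ 1 x)
    (hu0 : u ≠ 0) (hw0 : w ≠ 0) (hf0 : f ≠ 0) : vol u w e f ≠ 0 := by
  intro h
  obtain ⟨c, hc, h0⟩ := exists_relation_of_vol_eq_zero h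
  have hf2 : f ∈ comp ξ 2 x := comp_mono ξ x (by decide) hf
  obtain ⟨k1, k2, k3⟩ := hξ.eq_zero_of_add₃ 1 1 2 (by decide) hyz hxz.symm hxy.symm
    (Submodule.smul_mem _ (c 0) hu) (Submodule.smul_mem _ (c 1) hw)
    (Submodule.add_mem _ (Submodule.smul_mem _ (c 2) he) (Submodule.smul_mem _ (c 3) hf2))
    (by rw [← h0]; abel)
  rw [smul_eq_zero_iff_left hu0] at k1
  rw [smul_eq_zero_iff_left hw0] at k2
  obtain ⟨k3, k4⟩ := coeff_eq_zero he' hf hf0 k3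
  exact hc (by ext i; fin_cases i <;> assumption)

lemma exists_span_eq (ξ : X → FullFlag 4) (x : X) :
    ∃ e : E 4, e ≠ 0 ∧ e ∈ comp ξ 1 x ∧ comp ξ 1 x = ℝ ∙ e := by
  obtain ⟨e, he, h⟩ := finrank_eq_one_iff'.1 (finrank_comp ξ 1 x)
  refine ⟨e, fun h0 => he (Subtype.ext h0), e.2, le_antisymm (fun u hu => ?_) ?_⟩
  · obtain ⟨c, hc⟩ := h ⟨u, hu⟩
    exact Submodule.mem_span_singleton.2 ⟨c, congrArg Subtype.val hc⟩
  · exact (Submodule.span_singleton_le_iff_mem _ _).2 e.2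

lemma comp_one_eq_span {x : X} {e : E 4} (he : e ∈ comp ξ 1 x) (he0 : e ≠ 0) :
    comp ξ 1 x = ℝ ∙ e := by
  refine (Submodule.eq_of_le_of_finrank_eq
    ((Submodule.span_singleton_le_iff_mem _ _).2 he) ?_).symm
  rw [finrank_span_singleton he0, finrank_comp]; rfl

lemma exists_mem_two_not_mem_one (ξ : X → FullFlag 4) (x : X) :
    ∃ e ∈ comp ξ 2 x, e ∉ comp ξ 1 x := by
  by_contra! h
  have := Submodule.finrank_mono (show comp ξ 2 x ≤ comp ξ 1 x from h)
  rw [finrank_comp, finrank_comp] at this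
  exact absurd this (by decide)

/-- A vector `n` normal to the hyperplane `ξ³(b)`, and a section `v` of `ξ¹` over the complement
of `b`, normalized by `⟨n, v⟩ = 1`. -/
structure IsLift (ξ : X → FullFlag 4) (b : X) (n : E 4) (v : X → E 4) : Prop where
  mem_iff : ∀ u, u ∈ comp ξ 3 b ↔ inner ℝ n u = 0
  mem : ∀ y, y ≠ b → v y ∈ comp ξ 1 y
  inner_eq : ∀ y, y ≠ b → inner ℝ n (v y) = 1
  continuousAt : ∀ y, y ≠ b → ContinuousAt v y

lemma exists_normal (ξ : X → FullFlag 4) (b : X) :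
    ∃ n : E 4, ∀ u, u ∈ comp ξ 3 b ↔ inner ℝ n u = 0 := by
  have h := (comp ξ 3 b).finrank_add_finrank_orthogonal
  rw [finrank_comp, finrank_euclideanSpace_fin] at h
  have h1 : Module.finrank ℝ (comp ξ 3 b)ᗮ = 1 := by
    have : ((3 : Fin 5) : ℕ) = 3 := rfl
    omega
  obtain ⟨n, hn, hs⟩ := finrank_eq_one_iff'.1 h1
  refine ⟨n, fun u => ⟨fun hu => Submodule.inner_left_of_mem_orthogonal hu n.2, fun hu => ?_⟩⟩
  rw [← (comp ξ 3 b).orthogonal_orthogonal, Submodule.mem_orthogonal]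
  intro w hw
  obtain ⟨c, hc⟩ := hs ⟨w, hw⟩
  rw [show w = c • (n : E 4) from (congrArg Subtype.val hc).symm, inner_smul_left, hu, mul_zero]

/-- The projection of the normal `n` onto ξ¹(y) is continuous in `y`. For `y ≠ b` it is not
annihilated by `n`, since ξ¹(y) meets ξ³(b) trivially, so it can be rescaled into the affine chart
⟨n, ·⟩ = 1. -/
lemma IsHyperconvexFrenet.exists_isLift (hξ : IsHyperconvexFrenet ξ) (b : X) :
    ∃ n v, IsLift ξ b n v := by
  obtain ⟨n, hn⟩ := exists_normal ξ b
  set w : X → E 4 := fun y => (comp ξ 1 y).starProjection n with hw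
  have hwc : Continuous w := continuous_iff_continuousAt.2 fun y =>
    tendsto_starProjection_apply ((hξ.continuous_comp 1).tendsto y) tendsto_const_nhds
  have hw0 : ∀ y, y ≠ b → inner ℝ n (w y) ≠ 0 := by
    intro y hy h
    obtain ⟨u, hu0, hu, hspan⟩ := exists_span_eq ξ y
    have hwm : w y ∈ comp ξ 1 y := Submodule.starProjection_apply_mem _ _
    have hwz : w y = 0 := hξ.eq_zero_of_mem 1 3 (by decide) hy hwm ((hn _).2 h)
    have h1 : inner ℝ (n - w y) u = 0 := (comp ξ 1 y).starProjection_inner_eq_zero n u hu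
    rw [hwz, sub_zero] at h1
    exact hu0 (hξ.eq_zero_of_mem 1 3 (by decide) hy hu ((hn _).2 h1))
  refine ⟨n, fun y => (inner ℝ n (w y))⁻¹ • w y, hn, fun y _ => ?_, fun y hy => ?_, fun y hy => ?_⟩
  · exact Submodule.smul_mem _ _ (Submodule.starProjection_apply_mem _ _)
  · rw [inner_smul_right, inv_mul_cancel₀ (hw0 y hy)]
  · have hc : ContinuousAt (fun y => inner ℝ n (w y)) y :=
      (continuous_const.inner hwc).continuousAt
    exact (hc.inv₀ (hw0 y hy)).smul hwc.continuousAt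

lemma IsLift.ne_zero {b : X} {n : E 4} {v : X → E 4} (h : IsLift ξ b n v) {y : X} (hy : y ≠ b) :
    v y ≠ 0 := fun h0 => by
  have := h.inner_eq y hy
  rw [h0, inner_zero_right] at this
  exact zero_ne_one this

lemma IsLift.continuousOn_shift {b : X} {n : E 4} {v : X → E 4} (h : IsLift ξ b n v)
    (θ : X ≃ₜ UnitAddCircle) : ContinuousOn (fun t => v (shift θ b t)) (Set.Ioo 0 1) :=
  fun _ ht => ((h.continuousAt _ (shift_ne_base θ b ht)).comp
    (continuous_shift θ b).continuousAt).continuousWithinAt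

/-- By Cramer's rule the quotient of determinants is the coordinate, on the line of `e` and `f`, of
its intersection with the span of `a`, `b`, `c`. This links the determinant inequalities to
subspaces. -/
lemma coeff_mem {A B C : Submodule ℝ (E 4)} {a b c e f : E 4} (ha : a ∈ A) (hb : b ∈ B)
    (hc : c ∈ C) (h : vol a b c f ≠ 0) :
    e - (vol a b c e / vol a b c f) • f ∈ A ⊔ B ⊔ C := by
  have h1 := vol_cramer a b c f e
  have h2 : e - (vol a b c e / vol a b c f) • f =
      (vol a b c f)⁻¹ • (vol e b c f • a + vol a e c f • b + vol a b e f • c) := by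
    rw [eq_inv_smul_iff₀ h, smul_sub, smul_smul, mul_div_cancel₀ _ h, h1]
    abel
  rw [h2]
  refine Submodule.smul_mem _ _ (Submodule.add_mem _ (Submodule.add_mem _ ?_ ?_) ?_)
  · exact Submodule.mem_sup_left (Submodule.mem_sup_left (Submodule.smul_mem _ _ ha))
  · exact Submodule.mem_sup_left (Submodule.mem_sup_right (Submodule.smul_mem _ _ hb))
  · exact Submodule.mem_sup_right (Submodule.smul_mem _ _ hc)

/-- The sequential limit condition becomes a filter statement because the circle is first countable.
-/
lemma IsHyperconvexFrenet.tendsto_sup_pair (hξ : IsHyperconvexFrenet ξ) (θ : X ≃ₜ UnitAddCircle)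
    (x : X) : Tendsto (fun p : X × X => comp ξ 1 p.1 ⊔ comp ξ 1 p.2)
      (𝓝 (x, x) ⊓ 𝓟 {p | p.1 ≠ p.2}) (𝓝 (comp ξ 2 x)) := by
  have : FirstCountableTopology X := θ.isInducing.firstCountableTopology
  refine tendsto_of_seq_tendsto fun u hu => ?_
  obtain ⟨hu1, hu2⟩ := tendsto_inf.1 hu
  obtain ⟨N, hN⟩ := eventually_atTop.1 (tendsto_principal.1 hu2)
  -- The limit condition asks for distinct points at every index, whereas here they are distinct
  -- only from `N` on; the first terms are dropped.
  rw [← tendsto_add_atTop_iff_nat N]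
  have h1 := (continuous_fst.tendsto _).comp hu1
  have h2 := (continuous_snd.tendsto _).comp hu1
  have := hξ.limit_compatibility 2 ![1, 1] 2 (by simp [Fin.sum_univ_two]) x
    (fun m => ![(u (m + N)).1, (u (m + N)).2])
    (fun m => by
      have hne : (u (m + N)).1 ≠ (u (m + N)).2 := hN (m + N) (by omega)
      intro i j; fin_cases i <;> fin_cases j <;> simp [hne, hne.symm])
    (by
      rw [tendsto_pi_nhds]
      intro i
      fin_cases i
      · exact (tendsto_add_atTop_iff_nat N).2 h1
      · exact (tendsto_add_atTop_iff_nat N).2 h2)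
  refine this.congr fun m => ?_
  apply le_antisymm
  · exact iSup_le fun i => by fin_cases i; exacts [le_sup_left, le_sup_right]
  · exact sup_le (le_iSup_of_le 0 le_rfl) (le_iSup_of_le 1 le_rfl)

lemma IsHyperconvexFrenet.tendsto_sup_triple (hξ : IsHyperconvexFrenet ξ) (θ : X ≃ₜ UnitAddCircle)
    (x : X) : Tendsto (fun p : X × X × X => comp ξ 1 p.1 ⊔ comp ξ 1 p.2.1 ⊔ comp ξ 1 p.2.2)
      (𝓝 (x, x, x) ⊓ 𝓟 {p | p.1 ≠ p.2.1 ∧ p.2.1 ≠ p.2.2 ∧ p.1 ≠ p.2.2}) (𝓝 (comp ξ 3 x)) := by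
  have : FirstCountableTopology X := θ.isInducing.firstCountableTopology
  refine tendsto_of_seq_tendsto fun u hu => ?_
  obtain ⟨hu1, hu2⟩ := tendsto_inf.1 hu
  obtain ⟨N, hN⟩ := eventually_atTop.1 (tendsto_principal.1 hu2)
  rw [← tendsto_add_atTop_iff_nat N]
  have h1 := (continuous_fst.tendsto _).comp hu1
  have h2 := (continuous_snd.fst.tendsto _).comp hu1
  have h3 := (continuous_snd.snd.tendsto _).comp hu1
  have := hξ.limit_compatibility 3 ![1, 1, 1] 3 (by simp [Fin.sum_univ_three]) x
    (fun m => ![(u (m + N)).1, (u (m + N)).2.1, (u (m + N)).2.2])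
    (fun m => by
      obtain ⟨n1, n2, n3⟩ : (u (m + N)).1 ≠ (u (m + N)).2.1 ∧ (u (m + N)).2.1 ≠ (u (m + N)).2.2 ∧
        (u (m + N)).1 ≠ (u (m + N)).2.2 := hN (m + N) (by omega)
      intro i j
      fin_cases i <;> fin_cases j <;> simp [n1, n1.symm, n2, n2.symm, n3, n3.symm])
    (by
      rw [tendsto_pi_nhds]
      intro i
      fin_cases i
      · exact (tendsto_add_atTop_iff_nat N).2 h1
      · exact (tendsto_add_atTop_iff_nat N).2 h2
      · exact (tendsto_add_atTop_iff_nat N).2 h3)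
  refine this.congr fun m => ?_
  apply le_antisymm
  · refine iSup_le fun i => ?_
    fin_cases i
    exacts [le_sup_of_le_left le_sup_left, le_sup_of_le_left le_sup_right, le_sup_right]
  · exact sup_le (sup_le (le_iSup_of_le 0 le_rfl) (le_iSup_of_le 1 le_rfl))
      (le_iSup_of_le 2 le_rfl)

lemma eventually_add_mul_lt {s t : ℝ} (hst : s < t) (c : ℝ) :
    ∀ᶠ h : ℝ in 𝓝[>] 0, s + c * h < t := by
  have : Tendsto (fun h : ℝ => s + c * h) (𝓝[>] 0) (𝓝 s) := by
    have : Tendsto (fun h : ℝ => s + c * h) (𝓝 0) (𝓝 (s + c * 0)) :=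
      (by fun_prop : Continuous fun h : ℝ => s + c * h).tendsto 0
    rw [mul_zero, add_zero] at this
    exact this.mono_left nhdsWithin_le_nhds
  exact this.eventually_lt_const hst

lemma tendsto_shift_add (θ : X ≃ₜ UnitAddCircle) (b : X) (s c : ℝ) :
    Tendsto (fun h => shift θ b (s + c * h)) (𝓝[>] 0) (𝓝 (shift θ b s)) := by
  have h1 : Continuous fun h : ℝ => shift θ b (s + c * h) :=
    (continuous_shift θ b).comp (by fun_prop)
  have := h1.tendsto 0
  rw [mul_zero, add_zero] at this
  exact this.mono_left nhdsWithin_le_nhds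

lemma IsHyperconvexFrenet.tendsto_sup_pair_shift (hξ : IsHyperconvexFrenet ξ)
    (θ : X ≃ₜ UnitAddCircle) (b : X) {s : ℝ} (hs : s ∈ Set.Ioo (0 : ℝ) 1) :
    Tendsto (fun h => comp ξ 1 (shift θ b s) ⊔ comp ξ 1 (shift θ b (s + 1 * h))) (𝓝[>] 0)
      (𝓝 (comp ξ 2 (shift θ b s))) := by
  have := hξ.tendsto_sup_pair θ (shift θ b s)
  refine Tendsto.comp (g := fun p : X × X => comp ξ 1 p.1 ⊔ comp ξ 1 p.2)
    (f := fun h => (shift θ b s, shift θ b (s + 1 * h))) this ?_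
  refine tendsto_inf.2 ⟨tendsto_const_nhds.prodMk_nhds (tendsto_shift_add θ b s 1),
    tendsto_principal.2 ?_⟩
  filter_upwards [eventually_add_mul_lt hs.2 1, self_mem_nhdsWithin] with h h1 h2
  have h2 : 0 < h := h2
  exact shift_ne θ b hs ⟨by linarith [hs.1], h1⟩ (by linarith)

lemma IsHyperconvexFrenet.tendsto_sup_triple_shift (hξ : IsHyperconvexFrenet ξ)
    (θ : X ≃ₜ UnitAddCircle) (b : X) {s : ℝ} (hs : s ∈ Set.Ioo (0 : ℝ) 1) :
    Tendsto (fun h => comp ξ 1 (shift θ b s) ⊔ comp ξ 1 (shift θ b (s + 1 * h)) ⊔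
      comp ξ 1 (shift θ b (s + 2 * h))) (𝓝[>] 0) (𝓝 (comp ξ 3 (shift θ b s))) := by
  have := hξ.tendsto_sup_triple θ (shift θ b s)
  refine Tendsto.comp
    (g := fun p : X × X × X => comp ξ 1 p.1 ⊔ comp ξ 1 p.2.1 ⊔ comp ξ 1 p.2.2)
    (f := fun h => (shift θ b s, shift θ b (s + 1 * h), shift θ b (s + 2 * h))) this ?_
  refine tendsto_inf.2 ⟨tendsto_const_nhds.prodMk_nhds ((tendsto_shift_add θ b s 1).prodMk_nhds
    (tendsto_shift_add θ b s 2)), tendsto_principal.2 ?_⟩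
  filter_upwards [eventually_add_mul_lt hs.2 1, eventually_add_mul_lt hs.2 2,
    self_mem_nhdsWithin] with h h1 h2 h3
  have h3 : 0 < h := h3
  exact ⟨shift_ne θ b hs ⟨by linarith [hs.1], h1⟩ (by linarith),
    shift_ne θ b ⟨by linarith [hs.1], h1⟩ ⟨by linarith [hs.1], h2⟩ (by linarith),
    shift_ne θ b hs ⟨by linarith [hs.1], h2⟩ (by linarith)⟩

end Frenet

/-! ### Traces of osculating planes on tangent and secant lines -/

section OsculatingPlanes

variable {X : Type*} [TopologicalSpace X] {ξ : X → FullFlag 4}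

/-- The planes through the points at `s`, `s + h`, `s + 2h` tend to the osculating plane at `s`, so
their traces on the line of `e` and `f` tend to its trace. -/
lemma IsHyperconvexFrenet.tendsto_triple_ratio (hξ : IsHyperconvexFrenet ξ)
    (θ : X ≃ₜ UnitAddCircle) {b : X} {n : E 4} {v : X → E 4} (hv : IsLift ξ b n v) {r s ρ : ℝ}
    (hs : s ∈ Set.Ioo (0 : ℝ) 1) (hsr : s < r) (hr : r ≤ 1) {e f : E 4}
    (h3 : ∀ a b' c, s ≤ a → a < b' → b' < c → c < r →
      vol (v (shift θ b a)) (v (shift θ b b')) (v (shift θ b c)) f ≠ 0)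
    (hρ : e - ρ • f ∈ comp ξ 3 (shift θ b s)) (hf : f ∉ comp ξ 3 (shift θ b s)) :
    Tendsto (fun h => vol (v (shift θ b s)) (v (shift θ b (s + 1 * h)))
        (v (shift θ b (s + 2 * h))) e /
      vol (v (shift θ b s)) (v (shift θ b (s + 1 * h))) (v (shift θ b (s + 2 * h))) f)
      (𝓝[>] 0) (𝓝 ρ) := by
  refine tendsto_coeff_of_tendsto_submodule (hξ.tendsto_sup_triple_shift θ b hs)
    tendsto_const_nhds tendsto_const_nhds hf ?_ hρ
  filter_upwards [eventually_add_mul_lt hsr 1, eventually_add_mul_lt hsr 2,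
    self_mem_nhdsWithin] with h h1 h2 hp
  have hp : 0 < h := hp
  exact coeff_mem (hv.mem _ (shift_ne_base θ b hs))
    (hv.mem _ (shift_ne_base θ b ⟨by linarith [hs.1], by linarith⟩))
    (hv.mem _ (shift_ne_base θ b ⟨by linarith [hs.1], by linarith⟩))
    (h3 _ _ _ le_rfl (by linarith) (by linarith) h2)

/-- Osculating hyperplanes cut a suitable line monotonically. -/
lemma IsHyperconvexFrenet.coeff_lt_coeff (hξ : IsHyperconvexFrenet ξ)
    (θ : X ≃ₜ UnitAddCircle) {b : X} {n : E 4} {v : X → E 4} (hv : IsLift ξ b n v)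
    {l r σ : ℝ} (hl : 0 ≤ l) (hr : r ≤ 1) {e f : E 4}
    (h3 : ∀ a b' c, l < a → a < b' → b' < c → c < r →
      vol (v (shift θ b a)) (v (shift θ b b')) (v (shift θ b c)) f ≠ 0)
    (hσ : ∀ a₁ a₂ a₃ c₁ c₂ c₃, l < a₁ → a₁ < a₂ → a₂ < a₃ → a₃ < c₁ → c₁ < c₂ → c₂ < c₃ →
      c₃ < r →
      σ * (vol (v (shift θ b a₁)) (v (shift θ b a₂)) (v (shift θ b a₃)) e /
        vol (v (shift θ b a₁)) (v (shift θ b a₂)) (v (shift θ b a₃)) f) <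
      σ * (vol (v (shift θ b c₁)) (v (shift θ b c₂)) (v (shift θ b c₃)) e /
        vol (v (shift θ b c₁)) (v (shift θ b c₂)) (v (shift θ b c₃)) f))
    {s t ρ ρ' : ℝ} (hs : l < s) (hst : s < t) (ht : t < r)
    (hρ : e - ρ • f ∈ comp ξ 3 (shift θ b s)) (hf : f ∉ comp ξ 3 (shift θ b s))
    (hρ' : e - ρ' • f ∈ comp ξ 3 (shift θ b t)) (hf' : f ∉ comp ξ 3 (shift θ b t)) :
    σ * ρ < σ * ρ' := by
  have l1 := hξ.tendsto_triple_ratio θ hv ⟨hl.trans_lt hs, by linarith⟩ (hst.trans ht) hr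
    (fun a b' c ha => h3 a b' c (hs.trans_le ha)) hρ hf
  have l2 := hξ.tendsto_triple_ratio θ hv ⟨by linarith, by linarith⟩ ht hr
    (fun a b' c ha => h3 a b' c (by linarith)) hρ' hf'
  -- Limits only preserve weak inequalities. Two fixed triples, at `s + d, s + 2d, s + 3d` and at `s
  -- + 4d, s + 5d, s + 6d`, are inserted between `s` and `t = s + 7d`, and the strict inequality
  -- between these two survives.
  obtain ⟨d, hd, htd⟩ : ∃ d > 0, t = s + 7 * d := ⟨(t - s) / 7, by linarith, by ring⟩
  have m1 := le_of_tendsto (l1.const_mul σ) (b := σ * _) (by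
    filter_upwards [eventually_add_mul_lt (show s < s + d by linarith) 2,
      self_mem_nhdsWithin] with h h1 hp
    have hp : 0 < h := hp
    exact (hσ s (s + 1 * h) (s + 2 * h) (s + d) (s + 2 * d) (s + 3 * d) hs (by linarith)
      (by linarith) h1 (by linarith) (by linarith) (by linarith)).le)
  have m2 := ge_of_tendsto (l2.const_mul σ) (b := σ * _) (by
    filter_upwards [eventually_add_mul_lt ht 2, self_mem_nhdsWithin] with h h1 hp
    have hp : 0 < h := hp
    exact (hσ (s + 4 * d) (s + 5 * d) (s + 6 * d) t (t + 1 * h) (t + 2 * h) (by linarith)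
      (by linarith) (by linarith) (by linarith) (by linarith) (by linarith) h1).le)
  exact (m1.trans_lt (hσ _ _ _ _ _ _ (by linarith) (by linarith) (by linarith)
    (by linarith) (by linarith) (by linarith) (by linarith))).trans_le m2

lemma IsLift.vol_shift_ne_zero (hξ : IsHyperconvexFrenet ξ) (θ : X ≃ₜ UnitAddCircle) {b : X}
    {n : E 4} {v : X → E 4} (hv : IsLift ξ b n v) {s₁ s₂ s₃ s₄ : ℝ} (h₁ : 0 < s₁) (h₁₂ : s₁ < s₂)
    (h₂₃ : s₂ < s₃) (h₃₄ : s₃ < s₄) (h₄ : s₄ < 1) :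
    vol (v (shift θ b s₁)) (v (shift θ b s₂)) (v (shift θ b s₃)) (v (shift θ b s₄)) ≠ 0 := by
  have m₁ : s₁ ∈ Set.Ioo (0 : ℝ) 1 := ⟨by linarith, by linarith⟩
  have m₂ : s₂ ∈ Set.Ioo (0 : ℝ) 1 := ⟨by linarith, by linarith⟩
  have m₃ : s₃ ∈ Set.Ioo (0 : ℝ) 1 := ⟨by linarith, by linarith⟩
  have m₄ : s₄ ∈ Set.Ioo (0 : ℝ) 1 := ⟨by linarith, by linarith⟩
  refine hξ.vol_ne_zero (shift_ne θ b m₁ m₂ ?_) (shift_ne θ b m₂ m₃ ?_) (shift_ne θ b m₁ m₃ ?_)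
    (shift_ne θ b m₁ m₄ ?_) (shift_ne θ b m₂ m₄ ?_) (shift_ne θ b m₃ m₄ ?_)
    (hv.mem _ (shift_ne_base θ b m₁)) (hv.mem _ (shift_ne_base θ b m₂))
    (hv.mem _ (shift_ne_base θ b m₃)) (hv.mem _ (shift_ne_base θ b m₄))
    (hv.ne_zero (shift_ne_base θ b m₁)) (hv.ne_zero (shift_ne_base θ b m₂))
    (hv.ne_zero (shift_ne_base θ b m₃)) (hv.ne_zero (shift_ne_base θ b m₄)) <;> linarith

lemma IsLift.vol_shift_base_ne_zero (hξ : IsHyperconvexFrenet ξ) (θ : X ≃ₜ UnitAddCircle) {b : X}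
    {n : E 4} {v : X → E 4} (hv : IsLift ξ b n v) {f : E 4} (hf : f ∈ comp ξ 1 b) (hf0 : f ≠ 0)
    {s₁ s₂ s₃ : ℝ} (h₁ : 0 < s₁) (h₁₂ : s₁ < s₂) (h₂₃ : s₂ < s₃) (h₃ : s₃ < 1) :
    vol (v (shift θ b s₁)) (v (shift θ b s₂)) (v (shift θ b s₃)) f ≠ 0 := by
  have m₁ : s₁ ∈ Set.Ioo (0 : ℝ) 1 := ⟨by linarith, by linarith⟩
  have m₂ : s₂ ∈ Set.Ioo (0 : ℝ) 1 := ⟨by linarith, by linarith⟩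
  have m₃ : s₃ ∈ Set.Ioo (0 : ℝ) 1 := ⟨by linarith, by linarith⟩
  refine hξ.vol_ne_zero (shift_ne θ b m₁ m₂ ?_) (shift_ne θ b m₂ m₃ ?_) (shift_ne θ b m₁ m₃ ?_)
    (shift_ne_base θ b m₁) (shift_ne_base θ b m₂) (shift_ne_base θ b m₃)
    (hv.mem _ (shift_ne_base θ b m₁)) (hv.mem _ (shift_ne_base θ b m₂))
    (hv.mem _ (shift_ne_base θ b m₃)) hf
    (hv.ne_zero (shift_ne_base θ b m₁)) (hv.ne_zero (shift_ne_base θ b m₂))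
    (hv.ne_zero (shift_ne_base θ b m₃)) hf0 <;> linarith

/-- A tangent line and two osculating hyperplanes have no common point. -/
lemma IsHyperconvexFrenet.tangent_inter (hξ : IsHyperconvexFrenet ξ) (θ : X ≃ₜ UnitAddCircle)
    {x y z : X} (hxy : x ≠ y) (hyz : y ≠ z) (hxz : x ≠ z) {u : E 4} (hu : u ∈ comp ξ 2 x)
    (huy : u ∈ comp ξ 3 y) (huz : u ∈ comp ξ 3 z) : u = 0 := by
  by_contra hu0
  obtain ⟨n, v, hv⟩ := hξ.exists_isLift x
  obtain ⟨f, hf0, hf, hspan⟩ := exists_span_eq ξ x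
  have hfn : ∀ w, w ≠ x → f ∉ comp ξ 3 w := fun w hw h =>
    hf0 (hξ.eq_zero_of_mem 1 3 (by decide) hw.symm hf h)
  have hu1 : u ∉ comp ξ 1 x := fun h =>
    hu0 (hξ.eq_zero_of_mem 1 3 (by decide) hxy h huy)
  -- As `u` lies outside ξ¹(x), the vectors `u` and `f` span the tangent line. An osculating plane
  -- containing `u` has coordinate 0 on it, and strict monotonicity allows only one such plane away
  -- from `x`.
  obtain ⟨σ, hσ0, hσ⟩ := exists_sign_triple_ratio (hv.continuousOn_shift θ) (e := u) (f := f)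
    (fun a b c d h1 h2 h3 h4 h5 => hv.vol_shift_ne_zero hξ θ h1 h2 h3 h4 h5)
    (fun a b c h1 h2 h3 h4 => hv.vol_shift_base_ne_zero hξ θ hf hf0 h1 h2 h3 h4)
    (fun a b h1 h2 h3 => by
      have m₁ : a ∈ Set.Ioo (0 : ℝ) 1 := ⟨by linarith, by linarith⟩
      have m₂ : b ∈ Set.Ioo (0 : ℝ) 1 := ⟨by linarith, by linarith⟩
      exact hξ.vol_tangent_ne_zero (shift_ne_base θ x m₁).symm (shift_ne θ x m₁ m₂ h2.ne)
        (shift_ne_base θ x m₂).symm (hv.mem _ (shift_ne_base θ x m₁))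
        (hv.mem _ (shift_ne_base θ x m₂)) hu hu1 hf (hv.ne_zero (shift_ne_base θ x m₁))
        (hv.ne_zero (shift_ne_base θ x m₂)) hf0)
  have key : ∀ s t, 0 < s → s < t → t < 1 → u ∈ comp ξ 3 (shift θ x s) →
      u ∈ comp ξ 3 (shift θ x t) → False := fun s t h1 h2 h3 k1 k2 => by
    have := hξ.coeff_lt_coeff θ hv le_rfl le_rfl
      (fun a b c h1 h2 h3 h4 => hv.vol_shift_base_ne_zero hξ θ hf hf0 h1 h2 h3 h4) hσ h1 h2 h3
      (ρ := 0) (ρ' := 0) (by simpa using k1)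
      (hfn _ (shift_ne_base θ x ⟨h1, by linarith⟩)) (by simpa using k2)
      (hfn _ (shift_ne_base θ x ⟨by linarith, h3⟩))
    exact lt_irrefl _ this
  obtain ⟨s, hs, rfl⟩ := exists_shift_eq θ hxy.symm
  obtain ⟨t, ht, rfl⟩ := exists_shift_eq θ hxz.symm
  rcases lt_trichotomy s t with h | h | h
  · exact key s t hs.1 h ht.2 huy huz
  · exact hyz (by rw [h])
  · exact key t s ht.1 h hs.2 huz huy

/-- The coordinates of the points in which the osculating hyperplanes cut the secant line through
`x` and `z`: on both sides of `z` they are injective, and the two sides have opposite signs. -/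
lemma IsHyperconvexFrenet.secant_coeff (hξ : IsHyperconvexFrenet ξ) (θ : X ≃ₜ UnitAddCircle)
    {x : X} {n : E 4} {v : X → E 4} (hv : IsLift ξ x n v) {f : E 4} (hf : f ∈ comp ξ 1 x)
    (hf0 : f ≠ 0) {ζ : ℝ} (hζ : ζ ∈ Set.Ioo (0 : ℝ) 1) {s t ρ ρ' : ℝ} (hs : s ∈ Set.Ioo (0 : ℝ) 1)
    (ht : t ∈ Set.Ioo (0 : ℝ) 1) (hρ : v (shift θ x ζ) - ρ • f ∈ comp ξ 3 (shift θ x s))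
    (hρ' : v (shift θ x ζ) - ρ' • f ∈ comp ξ 3 (shift θ x t)) (hst : s < t) :
    (t < ζ → ρ ≠ ρ') ∧ (ζ < s → ρ ≠ ρ') ∧ (s < ζ → ζ < t → ρ * ρ' < 0) := by
  have hfn : ∀ w, w ≠ x → f ∉ comp ξ 3 w := fun w hw h =>
    hf0 (hξ.eq_zero_of_mem 1 3 (by decide) hw.symm hf h)
  have hfs := hfn _ (shift_ne_base θ x hs)
  have hft := hfn _ (shift_ne_base θ x ht)
  have h4 := fun a b c d h1 h2 h3 h4 h5 => hv.vol_shift_ne_zero hξ θ (s₁ := a) (s₂ := b)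
    (s₃ := c) (s₄ := d) h1 h2 h3 h4 h5
  have h3 := fun a b c h1 h2 h3 h4 => hv.vol_shift_base_ne_zero hξ θ hf hf0 (s₁ := a) (s₂ := b)
    (s₃ := c) h1 h2 h3 h4
  have hc := hv.continuousOn_shift θ
  refine ⟨fun htζ => ?_, fun hζs => ?_, fun hsζ hζt => ?_⟩
  -- With `e = v (shift θ x ζ)`, the determinant of `v a`, `v b`, `e`, `f` vanishes when `a` or `b`
  -- equals ζ. Monotonicity is therefore applied separately on each side of ζ.
  · have h3' := fun a b c (h1 : 0 < a) (h2 : a < b) (h3' : b < c) (h4 : c < ζ) =>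
      h3 a b c h1 h2 h3' (h4.trans hζ.2)
    obtain ⟨σ, hσ0, hσ⟩ := exists_sign_triple_ratio (l := 0) (r := ζ)
      (hc.mono (Set.Ioo_subset_Ioo_right hζ.2.le)) (e := v (shift θ x ζ)) (f := f)
      (fun a b c d k1 k2 k3 k4 k5 => h4 a b c d k1 k2 k3 k4 (k5.trans hζ.2)) h3'
      (fun a b k1 k2 k3 => h3 a b ζ k1 k2 k3 hζ.2)
    have := hξ.coeff_lt_coeff θ hv le_rfl hζ.2.le h3' hσ hs.1 hst htζ hρ hfs hρ' hft
    exact fun h => by rw [h] at this; exact lt_irrefl _ this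
  · have h3' := fun a b c (h1 : ζ < a) (h2 : a < b) (h3' : b < c) (h4 : c < 1) =>
      h3 a b c (hζ.1.trans h1) h2 h3' h4
    obtain ⟨σ, hσ0, hσ⟩ := exists_sign_triple_ratio (l := ζ) (r := 1)
      (hc.mono (Set.Ioo_subset_Ioo_left hζ.1.le)) (e := v (shift θ x ζ)) (f := f)
      (fun a b c d k1 k2 k3 k4 k5 => h4 a b c d (hζ.1.trans k1) k2 k3 k4 k5) h3'
      (fun a b k1 k2 k3 => by
        have : vol (v (shift θ x a)) (v (shift θ x b)) (v (shift θ x ζ)) f =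
          vol (v (shift θ x ζ)) (v (shift θ x a)) (v (shift θ x b)) f := by unfold vol; ring
        rw [this]
        exact h3 ζ a b hζ.1 k1 k2 k3)
    have := hξ.coeff_lt_coeff θ hv hζ.1.le le_rfl h3' hσ hζs hst ht.2 hρ hfs hρ' hft
    exact fun h => by rw [h] at this; exact lt_irrefl _ this
  · have nz : ∀ (w : X) (r : ℝ), w ≠ shift θ x ζ → v (shift θ x ζ) - r • f ∈ comp ξ 3 w → r ≠ 0 := by
      rintro w r hw h rfl
      rw [zero_smul, sub_zero] at h
      exact hv.ne_zero (shift_ne_base θ x hζ) (hξ.eq_zero_of_mem 1 3 (by decide) hw.symm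
        (hv.mem _ (shift_ne_base θ x hζ)) h)
    have n1 := nz _ _ (shift_ne θ x hs hζ hsζ.ne) hρ
    have n2 := nz _ _ (shift_ne θ x ht hζ hζt.ne') hρ'
    obtain ⟨σ, -, hσ⟩ := exists_sign_quadruples hc h4
    obtain ⟨τ, -, hτ⟩ := exists_sign_triples hc h3
    have l1 := hξ.tendsto_triple_ratio θ hv hs hsζ hζ.2.le
      (fun a b' c ha k1 k2 k3 => h3 a b' c (hs.1.trans_le ha) k1 k2 (k3.trans hζ.2)) hρ hfs
    have l2 := hξ.tendsto_triple_ratio θ hv ht ht.2 le_rfl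
      (fun a b' c ha k1 k2 k3 => h3 a b' c (ht.1.trans_le ha) k1 k2 k3) hρ' hft
    have hle : ρ * ρ' ≤ 0 := by
      refine le_of_tendsto (l1.mul l2) ?_
      filter_upwards [eventually_add_mul_lt hsζ 2, eventually_add_mul_lt ht.2 2,
        self_mem_nhdsWithin] with h k1 k2 hp
      have hp : 0 < h := hp
      have q1 := hσ s (s + 1 * h) (s + 2 * h) ζ hs.1 (by linarith) (by linarith) k1 hζ.2
      have q2 := hσ ζ t (t + 1 * h) (t + 2 * h) hζ.1 hζt (by linarith) (by linarith) k2
      have q3 := hτ s (s + 1 * h) (s + 2 * h) hs.1 (by linarith) (by linarith) (k1.trans hζ.2)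
      have q4 := hτ t (t + 1 * h) (t + 2 * h) ht.1 (by linarith) (by linarith) k2
      -- The point at ζ comes last in the quadruple before ζ and first in the one after it. Moving
      -- it past three points is an odd permutation, whence the opposite signs on the two sides.
      have hsw : vol (v (shift θ x t)) (v (shift θ x (t + 1 * h))) (v (shift θ x (t + 2 * h)))
          (v (shift θ x ζ)) = -vol (v (shift θ x ζ)) (v (shift θ x t)) (v (shift θ x (t + 1 * h)))
          (v (shift θ x (t + 2 * h))) := by unfold vol; ring
      rw [hsw, div_mul_div_comm]
      have r1 := mul_pos_of_sign q1 q2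
      have r2 := mul_pos_of_sign q3 q4
      rw [mul_neg, neg_div]
      exact neg_nonpos.2 (div_pos r1 r2).le
    exact lt_of_le_of_ne hle (mul_ne_zero n1 n2)

/-- A secant line and two osculating hyperplanes have no common point. -/
lemma IsHyperconvexFrenet.secant_inter (hξ : IsHyperconvexFrenet ξ) (θ : X ≃ₜ UnitAddCircle)
    {x z y y' : X} (hxz : x ≠ z) (hyx : y ≠ x) (hyz : y ≠ z) (hyx' : y' ≠ x) (hyz' : y' ≠ z)
    (hyy : y ≠ y') {u : E 4} (hu : u ∈ comp ξ 1 x ⊔ comp ξ 1 z) (huy : u ∈ comp ξ 3 y)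
    (huy' : u ∈ comp ξ 3 y') : u = 0 := by
  by_contra hu0
  obtain ⟨n, v, hv⟩ := hξ.exists_isLift x
  obtain ⟨f, hf0, hf, hspan⟩ := exists_span_eq ξ x
  obtain ⟨ζ, hζ, rfl⟩ := exists_shift_eq θ hxz.symm
  obtain ⟨s, hs, rfl⟩ := exists_shift_eq θ hyx
  obtain ⟨t, ht, rfl⟩ := exists_shift_eq θ hyx'
  rw [hspan, comp_one_eq_span (hv.mem _ hxz.symm) (hv.ne_zero hxz.symm)] at hu
  obtain ⟨a, ha, c, hc, rfl⟩ := Submodule.mem_sup.1 hu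
  obtain ⟨α, rfl⟩ := Submodule.mem_span_singleton.1 ha
  obtain ⟨β, rfl⟩ := Submodule.mem_span_singleton.1 hc
  have hβ : β ≠ 0 := by
    rintro rfl
    rw [zero_smul, add_zero] at huy hu0
    exact hu0 (hξ.eq_zero_of_mem 1 3 (by decide) hyx.symm (Submodule.smul_mem _ _ hf) huy)
  -- Up to scaling, `u` is `e - ρ • f` with one value of `ρ`, so both osculating planes would have
  -- the same coordinate on the secant line.
  have hmem : ∀ w, α • f + β • v (shift θ x ζ) ∈ comp ξ 3 w →
      v (shift θ x ζ) - (-(β⁻¹ * α)) • f ∈ comp ξ 3 w := fun w hw => by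
    have := Submodule.smul_mem _ β⁻¹ hw
    rw [smul_add, smul_smul, smul_smul, inv_mul_cancel₀ hβ, one_smul] at this
    rwa [neg_smul, sub_neg_eq_add, add_comm (v _)]
  have key : ∀ s ∈ Set.Ioo (0 : ℝ) 1, ∀ t ∈ Set.Ioo (0 : ℝ) 1, shift θ x s ≠ shift θ x ζ →
      shift θ x t ≠ shift θ x ζ → s < t →
      α • f + β • v (shift θ x ζ) ∈ comp ξ 3 (shift θ x s) →
      α • f + β • v (shift θ x ζ) ∈ comp ξ 3 (shift θ x t) → False := by
    intro s hs t ht hsζ htζ hst k1 k2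
    obtain ⟨c1, c2, c3⟩ := hξ.secant_coeff θ hv hf hf0 hζ hs ht (hmem _ k1) (hmem _ k2) hst
    have hsζ : s ≠ ζ := fun h => hsζ (by rw [h])
    have htζ : t ≠ ζ := fun h => htζ (by rw [h])
    rcases lt_or_gt_of_ne hsζ with h1 | h1
    · rcases lt_or_gt_of_ne htζ with h2 | h2
      · exact c1 h2 rfl
      · exact absurd (c3 h1 h2) (not_lt.2 (mul_self_nonneg _))
    · exact c2 h1 rfl
  rcases lt_trichotomy s t with h | h | h
  · exact key s hs t ht hyz hyz' h huy huy'
  · exact hyy (by rw [h])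
  · exact key t ht s hs hyz' hyz h huy' huy

end OsculatingPlanes

/-! ### Secant lines and the map dev_pctf -/

section Secants

variable {X : Type*} [TopologicalSpace X] {ξ : X → FullFlag 4}

lemma exists_coeff_mem (ξ : X → FullFlag 4) {y : X} {e f : E 4} (hf : f ∉ comp ξ 3 y) :
    ∃ ρ : ℝ, e - ρ • f ∈ comp ξ 3 y := by
  obtain ⟨n, hn⟩ := exists_normal ξ y
  rw [hn] at hf
  refine ⟨inner ℝ n e / inner ℝ n f, (hn _).2 ?_⟩
  rw [inner_sub_right, inner_smul_right, div_mul_cancel₀ _ hf, sub_self]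

lemma IsHyperconvexFrenet.not_mem_three (hξ : IsHyperconvexFrenet ξ) {x y : X} (hxy : x ≠ y)
    {f : E 4} (hf : f ∈ comp ξ 1 x) (hf0 : f ≠ 0) : f ∉ comp ξ 3 y := fun h =>
  hf0 (hξ.eq_zero_of_mem 1 3 (by decide) hxy hf h)

lemma IsHyperconvexFrenet.sub_smul_ne_zero (hξ : IsHyperconvexFrenet ξ) {x z : X} (hxz : x ≠ z)
    {e f : E 4} (hf : f ∈ comp ξ 1 x) (he : e ∈ comp ξ 1 z) (he0 : e ≠ 0) (ρ : ℝ) :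
    e - ρ • f ≠ 0 := fun h => he0 (hξ.eq_zero_of_add₂ 1 1 (by decide) hxz.symm he
      (Submodule.neg_mem _ (Submodule.smul_mem _ ρ hf)) (by rwa [← sub_eq_add_neg])).1

/-- An explicit generator reduces dimension and continuity of dev_pctf to the single coefficient
`ρ`. -/
lemma IsHyperconvexFrenet.devPctf_eq_span (hξ : IsHyperconvexFrenet ξ) {x y z : X} (hxy : x ≠ y)
    {e f : E 4} (hf : f ∈ comp ξ 1 x) (hf0 : f ≠ 0)
    (he : e ∈ comp ξ 1 z) (he0 : e ≠ 0) {ρ : ℝ} (hρ : e - ρ • f ∈ comp ξ 3 y) :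
    devPctf ξ x y z = ℝ ∙ (e - ρ • f) := by
  apply le_antisymm
  · rintro u ⟨hu, huy⟩
    rw [comp_one_eq_span hf hf0, comp_one_eq_span he he0] at hu
    obtain ⟨a, ha, c, hc, rfl⟩ := Submodule.mem_sup.1 hu
    obtain ⟨α, rfl⟩ := Submodule.mem_span_singleton.1 ha
    obtain ⟨β, rfl⟩ := Submodule.mem_span_singleton.1 hc
    have h1 := Submodule.sub_mem _ huy (Submodule.smul_mem _ β hρ)
    have h2 : α • f + β • e - β • (e - ρ • f) = (α + β * ρ) • f := by
      rw [smul_sub, smul_smul, add_smul]; abel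
    rw [h2] at h1
    have h3 : α + β * ρ = 0 := by
      by_contra h0
      exact hξ.not_mem_three hxy hf hf0 ((Submodule.smul_mem_iff _ h0).1 h1)
    rw [h3, zero_smul, sub_eq_zero] at h2
    rw [h2]
    exact Submodule.mem_span_singleton.2 ⟨β, rfl⟩
  · rw [Submodule.span_singleton_le_iff_mem]
    exact ⟨Submodule.sub_mem _ (Submodule.mem_sup_right he)
      (Submodule.mem_sup_left (Submodule.smul_mem _ _ hf)), hρ⟩

lemma IsHyperconvexFrenet.finrank_devPctf (hξ : IsHyperconvexFrenet ξ) {x y z : X} (hxy : x ≠ y)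
    (hxz : x ≠ z) : Module.finrank ℝ (devPctf ξ x y z) = 1 := by
  obtain ⟨f, hf0, hf, -⟩ := exists_span_eq ξ x
  obtain ⟨e, he0, he, -⟩ := exists_span_eq ξ z
  obtain ⟨ρ, hρ⟩ := exists_coeff_mem ξ (e := e) (hξ.not_mem_three hxy hf hf0)
  rw [hξ.devPctf_eq_span hxy hf hf0 he he0 hρ]
  exact finrank_span_singleton (hξ.sub_smul_ne_zero hxz hf he he0 ρ)

/-- The map `dev_pctf` with values in projective space. -/
def pctfPoint {θ : X ≃ₜ UnitAddCircle} (hξ : IsHyperconvexFrenet ξ) (t : PosTriple θ) : RP3 :=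
  ⟨devPctf ξ t.1.1 t.1.2.1 t.1.2.2, hξ.finrank_devPctf t.ne.1 t.ne.2.2⟩

lemma IsHyperconvexFrenet.continuous_pctfPoint {θ : X ≃ₜ UnitAddCircle}
    (hξ : IsHyperconvexFrenet ξ) : Continuous (pctfPoint (θ := θ) hξ) := by
  have := t2Space_of_homeomorph θ
  refine continuous_iff_continuousAt.2 fun t₀ => tendsto_rp3_iff.2 ?_
  obtain ⟨⟨x₀, y₀, z₀⟩, ht₀⟩ := t₀
  obtain ⟨hxy, hyz, hxz⟩ : x₀ ≠ y₀ ∧ y₀ ≠ z₀ ∧ x₀ ≠ z₀ :=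
    PosTriple.ne (⟨(x₀, y₀, z₀), ht₀⟩ : PosTriple θ)
  -- Lifting off `y₀` provides continuous generators of ξ¹ at both outer entries, which stay away
  -- from `y₀` near the given triple.
  obtain ⟨n, v, hv⟩ := hξ.exists_isLift y₀
  have ex : ∀ t : PosTriple θ, ∃ ρ : ℝ, t.1.1 ≠ y₀ →
      v t.1.2.2 - ρ • v t.1.1 ∈ comp ξ 3 t.1.2.1 := fun t => by
    by_cases h : t.1.1 = y₀
    · exact ⟨0, fun h' => absurd h h'⟩
    · obtain ⟨ρ, hρ⟩ := exists_coeff_mem ξ (e := v t.1.2.2)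
        (hξ.not_mem_three t.ne.1 (hv.mem _ h) (hv.ne_zero h))
      exact ⟨ρ, fun _ => hρ⟩
  choose ρ hρ using ex
  set t₀ : PosTriple θ := ⟨(x₀, y₀, z₀), ht₀⟩
  have c1 : Continuous fun t : PosTriple θ => t.1.1 := continuous_subtype_val.fst
  have c2 : Continuous fun t : PosTriple θ => t.1.2.1 := continuous_subtype_val.snd.fst
  have c3 : Continuous fun t : PosTriple θ => t.1.2.2 := continuous_subtype_val.snd.snd
  have e1 : ∀ᶠ t : PosTriple θ in 𝓝 t₀, t.1.1 ≠ y₀ := (c1.tendsto t₀).eventually_ne hxy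
  have e2 : ∀ᶠ t : PosTriple θ in 𝓝 t₀, t.1.2.2 ≠ y₀ := (c3.tendsto t₀).eventually_ne hyz.symm
  have lx : Tendsto (fun t : PosTriple θ => v t.1.1) (𝓝 t₀) (𝓝 (v x₀)) :=
    (hv.continuousAt x₀ hxy).tendsto.comp (c1.tendsto t₀)
  have lz : Tendsto (fun t : PosTriple θ => v t.1.2.2) (𝓝 t₀) (𝓝 (v z₀)) :=
    (hv.continuousAt z₀ hyz.symm).tendsto.comp (c3.tendsto t₀)
  have lρ : Tendsto ρ (𝓝 t₀) (𝓝 (ρ t₀)) :=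
    tendsto_coeff_of_tendsto_submodule (((hξ.continuous_comp 3).comp c2).tendsto t₀) lz lx
      (hξ.not_mem_three hxy (hv.mem _ hxy) (hv.ne_zero hxy))
      (e1.mono fun t ht => hρ t ht) (hρ t₀ hxy)
  have lim := tendsto_span_singleton (lz.sub (lρ.smul lx))
    (hξ.sub_smul_ne_zero hxz (hv.mem _ hxy) (hv.mem _ hyz.symm) (hv.ne_zero hyz.symm) _)
  have heq : ∀ t : PosTriple θ, t.1.1 ≠ y₀ → t.1.2.2 ≠ y₀ →
      (pctfPoint hξ t).1 = ℝ ∙ (v t.1.2.2 - ρ t • v t.1.1) := fun t h1 h2 =>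
    hξ.devPctf_eq_span t.ne.1 (hv.mem _ h1) (hv.ne_zero h1) (hv.mem _ h2) (hv.ne_zero h2) (hρ t h1)
  rw [heq t₀ hxy hyz.symm]
  refine lim.congr' ?_
  filter_upwards [e1, e2] with t h1 h2
  exact (heq t h1 h2).symm

/-- A nonzero vector spanning a point of projective space. -/
lemma exists_rep (p : RP3) : ∃ u : E 4, u ≠ 0 ∧ p.1 = ℝ ∙ u := by
  obtain ⟨u, hu, h⟩ := finrank_eq_one_iff'.1 p.2
  refine ⟨u, fun h0 => hu (Subtype.ext h0), le_antisymm (fun w hw => ?_) ?_⟩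
  · obtain ⟨c, hc⟩ := h ⟨w, hw⟩
    exact Submodule.mem_span_singleton.2 ⟨c, congrArg Subtype.val hc⟩
  · exact (Submodule.span_singleton_le_iff_mem _ _).2 u.2

/-- The point of projective space spanned by a nonzero vector. -/
def mkPoint (u : E 4) (hu : u ≠ 0) : RP3 := ⟨ℝ ∙ u, finrank_span_singleton hu⟩

lemma exists_eq_mkPoint (p : RP3) : ∃ (u : E 4) (hu : u ≠ 0), p = mkPoint u hu := by
  obtain ⟨u, hu, h⟩ := exists_rep p
  exact ⟨u, hu, Subtype.ext h⟩

lemma eq_of_le_of_finrank_one {p q : Submodule ℝ (E 4)} (hp : Module.finrank ℝ p = 1)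
    (hq : Module.finrank ℝ q = 1) (h : p ≤ q) : p = q :=
  Submodule.eq_of_le_of_finrank_eq h (hp.trans hq.symm)

lemma mkPoint_mem_secant_iff {x z : X} {u : E 4} (hu : u ≠ 0) :
    mkPoint u hu ∈ secant ξ x z ↔
      u ∈ comp ξ 1 x ⊔ comp ξ 1 z ∧ u ∉ comp ξ 1 x ∧ u ∉ comp ξ 1 z := by
  have key : ∀ w, (mkPoint u hu).1 = comp ξ 1 w ↔ u ∈ comp ξ 1 w := fun w =>
    ⟨fun h => h ▸ Submodule.mem_span_singleton_self u, fun h => (comp_one_eq_span h hu).symm⟩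
  simp only [secant, Set.mem_ofPred_eq, ne_eq, key]
  rw [mkPoint, Submodule.span_singleton_le_iff_mem]

lemma mkPoint_mem_Omega_iff {u : E 4} (hu : u ≠ 0) :
    mkPoint u hu ∈ Omega ξ ↔ ∀ w, u ∉ comp ξ 2 w := by
  change (¬ ∃ w, (ℝ ∙ u) ≤ comp ξ 2 w) ↔ _
  simp only [Submodule.span_singleton_le_iff_mem, not_exists]

/-- A vector on a secant line away from its end points. -/
lemma exists_decomposition {x z : X} {u : E 4} (hu : u ∈ comp ξ 1 x ⊔ comp ξ 1 z)
    (hx : u ∉ comp ξ 1 x) (hz : u ∉ comp ξ 1 z) :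
    ∃ a ∈ comp ξ 1 x, ∃ c ∈ comp ξ 1 z, a ≠ 0 ∧ c ≠ 0 ∧ u = a + c := by
  obtain ⟨a, ha, c, hc, rfl⟩ := Submodule.mem_sup.1 hu
  refine ⟨a, ha, c, hc, ?_, ?_, rfl⟩
  · rintro rfl; exact hz (by simpa using hc)
  · rintro rfl; exact hx (by simpa using ha)

lemma IsHyperconvexFrenet.not_mem_of_add (hξ : IsHyperconvexFrenet ξ) {x z : X} (hxz : x ≠ z)
    {a c : E 4} (ha : a ∈ comp ξ 1 x) (hc : c ∈ comp ξ 1 z) (hc0 : c ≠ 0) :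
    a + c ∉ comp ξ 1 x := fun h => hc0 (hξ.eq_zero_of_mem 1 1 (by decide) hxz
      ((Submodule.add_mem_iff_right _ ha).1 h) hc)

lemma IsHyperconvexFrenet.secant_subset_Omega (hξ : IsHyperconvexFrenet ξ) {x z : X}
    (hxz : x ≠ z) : secant ξ x z ⊆ Omega ξ := by
  intro p hp
  obtain ⟨u, hu, rfl⟩ := exists_eq_mkPoint p
  rw [mkPoint_mem_secant_iff] at hp
  rw [mkPoint_mem_Omega_iff]
  obtain ⟨a, ha, c, hc, ha0, hc0, rfl⟩ := exists_decomposition hp.1 hp.2.1 hp.2.2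
  intro w hw
  rcases eq_or_ne w x with rfl | hwx
  · exact hc0 (hξ.eq_zero_of_mem 2 1 (by decide) hxz
      ((Submodule.add_mem_iff_right _ (comp_mono ξ w (by decide) ha)).1 hw) hc)
  rcases eq_or_ne w z with rfl | hwz
  · exact ha0 (hξ.eq_zero_of_mem 2 1 (by decide) hxz.symm
      ((Submodule.add_mem_iff_left _ (comp_mono ξ w (by decide) hc)).1 hw) ha)
  exact ha0 (hξ.eq_zero_of_add₃ 1 1 2 (by decide) hxz hwz.symm hwx.symm ha hc
    (Submodule.neg_mem _ hw) (by abel)).1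

/-- A point lies on at most one secant line. -/
lemma IsHyperconvexFrenet.secant_unique (hξ : IsHyperconvexFrenet ξ) {x z x' z' : X}
    (hxz : x ≠ z) (hxz' : x' ≠ z') {p : RP3} (hp : p ∈ secant ξ x z) (hp' : p ∈ secant ξ x' z') :
    (x' = x ∧ z' = z) ∨ (x' = z ∧ z' = x) := by
  obtain ⟨u, hu, rfl⟩ := exists_eq_mkPoint p
  rw [mkPoint_mem_secant_iff] at hp hp'
  obtain ⟨a, ha, c, hc, ha0, hc0, rfl⟩ := exists_decomposition hp.1 hp.2.1 hp.2.2
  obtain ⟨a', ha', c', hc', ha0', hc0', he⟩ := exists_decomposition hp'.1 hp'.2.1 hp'.2.2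
  have main : ∀ {x z x' z' : X} {a c a' c' : E 4}, x ≠ z → x' ≠ z' → a ∈ comp ξ 1 x →
      c ∈ comp ξ 1 z → a' ∈ comp ξ 1 x' → c' ∈ comp ξ 1 z' → a ≠ 0 → c ≠ 0 → c' ≠ 0 →
      a + c = a' + c' → x = x' → z' = z := by
    rintro x z x' z' a c a' c' hxz hxz' ha hc ha' hc' ha0 hc0 hc0' he rfl
    by_contra hzz
    exact hc0 (hξ.eq_zero_of_add₃ 1 1 1 (by decide) hxz (Ne.symm hzz) hxz'
      (Submodule.sub_mem _ ha ha') hc (Submodule.neg_mem _ hc')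
      (by rw [sub_add_eq_add_sub, he]; abel)).2.1
  by_cases h1 : x = x'
  · exact Or.inl ⟨h1.symm, main hxz hxz' ha hc ha' hc' ha0 hc0 hc0' he h1⟩
  by_cases h2 : x = z'
  · exact Or.inr ⟨main hxz hxz'.symm ha hc hc' ha' ha0 hc0 ha0' (by rw [he, add_comm]) h2, h2.symm⟩
  by_cases h3 : z = x'
  · exact absurd (main hxz.symm hxz' hc ha ha' hc' hc0 ha0 hc0' (by rw [← he, add_comm]) h3).symm h2
  by_cases h4 : z = z'
  · exact absurd (main hxz.symm hxz'.symm hc ha hc' ha' hc0 ha0 ha0'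
      (by rw [add_comm c, he, add_comm]) h4).symm h1
  · exact absurd (hξ.eq_zero_of_add₄ hxz h3 h1 h2 h4 hxz' ha hc (Submodule.neg_mem _ ha')
      (Submodule.neg_mem _ hc') (by rw [he]; abel)).1 ha0

lemma IsHyperconvexFrenet.pctfPoint_mem_secant {θ : X ≃ₜ UnitAddCircle}
    (hξ : IsHyperconvexFrenet ξ) (t : PosTriple θ) :
    pctfPoint hξ t ∈ secant ξ t.1.1 t.1.2.2 := by
  have key : ∀ w, t.1.2.1 ≠ w → (pctfPoint hξ t).1 ≠ comp ξ 1 w := fun w hw h => by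
    obtain ⟨e, he0, he, -⟩ := exists_span_eq ξ w
    rw [← h] at he
    exact hξ.not_mem_three hw.symm (h ▸ he) he0 he.2
  exact ⟨inf_le_left, key _ t.ne.1.symm, key _ t.ne.2.1⟩

/-- The image determines the unordered pair of outer entries by `secant_unique`, and then the middle
entry by `secant_inter`; the orientation excludes the exchange of the outer entries. -/
lemma IsHyperconvexFrenet.pctfPoint_injective {θ : X ≃ₜ UnitAddCircle}
    (hξ : IsHyperconvexFrenet ξ) : Function.Injective (pctfPoint (θ := θ) hξ) := by
  intro t t' h
  have hs := hξ.pctfPoint_mem_secant t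
  have hs' := hξ.pctfPoint_mem_secant t'
  rw [← h] at hs'
  obtain ⟨u, hu0, hu⟩ := exists_rep (pctfPoint hξ t)
  have hum : u ∈ (pctfPoint hξ t).1 := hu ▸ Submodule.mem_span_singleton_self u
  have hum' : u ∈ (pctfPoint hξ t').1 := h ▸ hum
  have hy : ∀ y', y' ≠ t.1.1 → y' ≠ t.1.2.2 → u ∈ comp ξ 3 y' → t.1.2.1 = y' :=
    fun y' h1 h2 h3 => by
      by_contra hne
      exact hu0 (hξ.secant_inter θ t.ne.2.2 t.ne.1.symm t.ne.2.1 h1 h2 hne hum.1 hum.2 h3)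
  obtain ⟨⟨x, y, z⟩, ht⟩ := t
  obtain ⟨⟨x', y', z'⟩, ht'⟩ := t'
  obtain ⟨n1, n2, n3⟩ : x' ≠ y' ∧ y' ≠ z' ∧ x' ≠ z' :=
    PosTriple.ne (⟨(x', y', z'), ht'⟩ : PosTriple θ)
  have m3 : u ∈ comp ξ 3 y' := hum'.2
  rcases hξ.secant_unique (PosTriple.ne (⟨(x, y, z), ht⟩ : PosTriple θ)).2.2 n3 hs hs' with
    ⟨h1, h2⟩ | ⟨h1, h2⟩
  · change x' = x at h1
    change z' = z at h2
    subst h1 h2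
    have : y = y' := hy y' n1.symm n2 m3
    subst this
    rfl
  · change x' = z at h1
    change z' = x at h2
    subst h1 h2
    have : y = y' := hy y' n2 n1.symm m3
    subst this
    have k1 : sbtw (θ z') (θ y) (θ x') := ht
    have k2 : sbtw (θ x') (θ y) (θ z') := ht'
    exact absurd k2.btw (sbtw_iff_not_btw.1 k1)

/-- Every point of a secant line other than its end points lies on an osculating hyperplane at a
third point. -/
lemma IsHyperconvexFrenet.exists_mem_three (hξ : IsHyperconvexFrenet ξ) (θ : X ≃ₜ UnitAddCircle)
    {x z : X} (hxz : x ≠ z) {u : E 4} (hu : u ∈ comp ξ 1 x ⊔ comp ξ 1 z) (hux : u ∉ comp ξ 1 x)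
    (huz : u ∉ comp ξ 1 z) : ∃ y, y ≠ x ∧ y ≠ z ∧ u ∈ comp ξ 3 y := by
  obtain ⟨f, hf, c, hc, hf0, hc0, rfl⟩ := exists_decomposition hu hux huz
  obtain ⟨n, v, hv⟩ := hξ.exists_isLift x
  obtain ⟨ζ, hζ, rfl⟩ := exists_shift_eq θ hxz.symm
  have hvz := hv.mem _ hxz.symm
  have hvz0 := hv.ne_zero hxz.symm
  rw [comp_one_eq_span hvz hvz0] at hc
  obtain ⟨β, rfl⟩ := Submodule.mem_span_singleton.1 hc
  have hβ : β ≠ 0 := left_ne_zero_of_smul hc0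
  set e := v (shift θ x ζ) with he
  have ex : ∀ s : ℝ, ∃ ρ : ℝ, s ∈ Set.Ioo (0 : ℝ) 1 → e - ρ • f ∈ comp ξ 3 (shift θ x s) :=
    fun s => by
      by_cases h : s ∈ Set.Ioo (0 : ℝ) 1
      · obtain ⟨ρ, hρ⟩ := exists_coeff_mem ξ (e := e)
          (hξ.not_mem_three (shift_ne_base θ x h).symm hf hf0)
        exact ⟨ρ, fun _ => hρ⟩
      · exact ⟨0, fun h' => absurd h' h⟩
  choose r hr using ex
  have hrc : ContinuousOn r (Set.Ioo 0 1) := fun s hs => by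
    refine tendsto_coeff_of_tendsto_submodule (H := fun s => comp ξ 3 (shift θ x s))
      ((((hξ.continuous_comp 3).comp (continuous_shift θ x)).tendsto s).mono_left
        nhdsWithin_le_nhds) tendsto_const_nhds tendsto_const_nhds
      (hξ.not_mem_three (shift_ne_base θ x hs).symm hf hf0) ?_ (hr s hs)
    filter_upwards [self_mem_nhdsWithin] with t ht using hr t ht
  have hNe : e ∉ comp ξ 3 x := hξ.not_mem_three hxz.symm hvz hvz0
  -- Near both ends of (0,1) the osculating plane tends to ξ³(x), which contains `f` but not `e`. If
  -- `r` were bounded there, the distance of `e` from the plane would tend to 0 along with that of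
  -- `f`.
  have large : ∀ (c : ℝ) (l : Filter ℝ) [l.NeBot], shift θ x c = x → Tendsto id l (𝓝 c) →
      (∀ᶠ s in l, s ∈ Set.Ioo (0 : ℝ) 1) → ∀ M : ℝ, ∃ᶠ s in l, M < |r s| := by
    intro c l _ hcx hl hl1 M hM
    have hlim : Tendsto (fun s => comp ξ 3 (shift θ x s)) l (𝓝 (comp ξ 3 x)) := by
      have := ((hξ.continuous_comp 3).comp (continuous_shift θ x)).tendsto c
      simp only [Function.comp_def, hcx] at this
      exact this.comp hl
    have le := fun w : E 4 => ((tendsto_const_nhds (x := w)).sub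
      (tendsto_starProjection_apply hlim (tendsto_const_nhds (x := w)))).norm
    have hle := le_of_tendsto_of_tendsto (le e) ((le f).const_mul M) (by
      filter_upwards [hl1, hM] with s hs hsM
      have h1 := Submodule.starProjection_eq_self_iff.2 (hr s hs)
      rw [map_sub, map_smul] at h1
      have h2 : e - (comp ξ 3 (shift θ x s)).starProjection e =
          r s • (f - (comp ξ 3 (shift θ x s)).starProjection f) := by
        rw [smul_sub, sub_eq_sub_iff_sub_eq_sub, ← h1]
      rw [h2, norm_smul, Real.norm_eq_abs]
      exact mul_le_mul_of_nonneg_right (not_lt.1 hsM) (norm_nonneg _))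
    rw [Submodule.starProjection_eq_self_iff.2 (comp_mono ξ x (by decide : (1 : Fin 5) ≤ 3) hf),
      sub_self, norm_zero, mul_zero] at hle
    have := norm_le_zero_iff.1 hle
    exact hNe (Submodule.starProjection_eq_self_iff.1 (sub_eq_zero.1 this).symm)
  have lo : ∀ M : ℝ, ∃ s, 0 < s ∧ s < ζ ∧ M < |r s| := fun M => by
    have h1 : ∀ᶠ s : ℝ in 𝓝[>] 0, s ∈ Set.Ioo 0 ζ := Ioo_mem_nhdsGT hζ.1
    obtain ⟨s, h2, h3⟩ := ((large 0 (𝓝[>] 0) (shift_zero θ x) nhdsWithin_le_nhds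
      (h1.mono fun s hs => ⟨hs.1, hs.2.trans hζ.2⟩) M).and_eventually h1).exists
    exact ⟨s, h3.1, h3.2, h2⟩
  have hi : ∀ M : ℝ, ∃ s, ζ < s ∧ s < 1 ∧ M < |r s| := fun M => by
    have h1 : ∀ᶠ s : ℝ in 𝓝[<] 1, s ∈ Set.Ioo ζ 1 := Ioo_mem_nhdsLT hζ.2
    obtain ⟨s, h2, h3⟩ := ((large 1 (𝓝[<] 1) (shift_one θ x) nhdsWithin_le_nhds
      (h1.mono fun s hs => ⟨hζ.1.trans hs.1, hs.2⟩) M).and_eventually h1).exists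
    exact ⟨s, h3.1, h3.2, h2⟩
  obtain ⟨s, hs0, hsζ, hs⟩ := lo |(-β⁻¹)|
  obtain ⟨t, htζ, ht1, ht⟩ := hi |(-β⁻¹)|
  have hsI : s ∈ Set.Ioo (0 : ℝ) 1 := ⟨hs0, hsζ.trans hζ.2⟩
  have htI : t ∈ Set.Ioo (0 : ℝ) 1 := ⟨hζ.1.trans htζ, ht1⟩
  have hneg := (hξ.secant_coeff θ hv hf hf0 hζ hsI htI (hr s hsI) (hr t htI)
    (hsζ.trans htζ)).2.2 hsζ htζ
  have sub : Set.Icc s t ⊆ Set.Ioo 0 1 := fun w hw => ⟨hs0.trans_le hw.1, hw.2.trans_lt ht1⟩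
  -- The coordinate `r` is continuous across ζ, exceeds the target value in modulus on both sides,
  -- and has opposite signs there. The target `-β⁻¹` is the coordinate of `f + β • e`, up to
  -- scaling.
  have hw : ∃ w ∈ Set.Icc s t, r w = -β⁻¹ := by
    rcases mul_neg_iff.1 hneg with ⟨h1, h2⟩ | ⟨h1, h2⟩
    · rw [abs_of_pos h1] at hs
      rw [abs_of_neg h2] at ht
      exact intermediate_value_Icc' (hsζ.trans htζ).le (hrc.mono sub)
        ⟨by linarith [neg_abs_le (-β⁻¹)], by linarith [le_abs_self (-β⁻¹)]⟩
    · rw [abs_of_neg h1] at hs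
      rw [abs_of_pos h2] at ht
      exact intermediate_value_Icc (hsζ.trans htζ).le (hrc.mono sub)
        ⟨by linarith [neg_abs_le (-β⁻¹)], by linarith [le_abs_self (-β⁻¹)]⟩
  obtain ⟨w, hw, hrw⟩ := hw
  have hm := hr w (sub hw)
  rw [hrw] at hm
  -- The osculating plane at ζ contains `e` but not `f`, so its coordinate is 0; as `-β⁻¹` is
  -- nonzero, `w` differs from ζ.
  refine ⟨shift θ x w, shift_ne_base θ x (sub hw), fun h => ?_, ?_⟩
  · rw [h] at hm
    have h3 := (Submodule.sub_mem_iff_right _ (comp_mono ξ _ (by decide : (1 : Fin 5) ≤ 3) hvz)).1 hm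
    exact hξ.not_mem_three hxz hf hf0 ((Submodule.smul_mem_iff _ (by simpa using hβ)).1 h3)
  · have := Submodule.smul_mem _ β hm
    rw [smul_sub, smul_smul, mul_neg, mul_inv_cancel₀ hβ, neg_one_smul, sub_neg_eq_add] at this
    rwa [add_comm f]

/-- The union of the secant lines, punctured at their end points. -/
def secantUnion (ξ : X → FullFlag 4) : Set RP3 := {p | ∃ x z, x ≠ z ∧ p ∈ secant ξ x z}

lemma secant_comm (ξ : X → FullFlag 4) (x z : X) : secant ξ x z = secant ξ z x := by
  ext p
  simp only [secant, Set.mem_ofPred_eq]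
  rw [sup_comm, and_comm (a := p.1 ≠ comp ξ 1 x)]

/-- One of (x,y,z) and (z,y,x) is positive, where y is the third point supplied by
`exists_mem_three`. The two alternatives correspond to the two components of the punctured line. -/
lemma IsHyperconvexFrenet.exists_pctfPoint_eq {θ : X ≃ₜ UnitAddCircle}
    (hξ : IsHyperconvexFrenet ξ) {x z : X} (hxz : x ≠ z) {p : RP3} (hp : p ∈ secant ξ x z) :
    ∃ t : PosTriple θ, pctfPoint hξ t = p ∧
      ((t.1.1 = x ∧ t.1.2.2 = z) ∨ (t.1.1 = z ∧ t.1.2.2 = x)) := by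
  obtain ⟨u, hu, rfl⟩ := exists_eq_mkPoint p
  obtain ⟨h1, h2, h3⟩ := (mkPoint_mem_secant_iff hu).1 hp
  obtain ⟨y, hyx, hyz, hy⟩ := hξ.exists_mem_three θ hxz h1 h2 h3
  have hle : (mkPoint u hu).1 ≤ devPctf ξ x y z := by
    rw [mkPoint, Submodule.span_singleton_le_iff_mem]
    exact ⟨h1, hy⟩
  rcases sbtw_or_sbtw (θ.injective.ne hyx.symm) (θ.injective.ne hyz) (θ.injective.ne hxz)
    with h | h
  · exact ⟨⟨(x, y, z), h⟩, Subtype.ext (eq_of_le_of_finrank_one (mkPoint u hu).2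
      (pctfPoint hξ ⟨(x, y, z), h⟩).2 hle).symm, Or.inl ⟨rfl, rfl⟩⟩
  · rw [devPctf, sup_comm] at hle
    exact ⟨⟨(z, y, x), h⟩, Subtype.ext (eq_of_le_of_finrank_one (mkPoint u hu).2
      (pctfPoint hξ ⟨(z, y, x), h⟩).2 hle).symm, Or.inr ⟨rfl, rfl⟩⟩

lemma IsHyperconvexFrenet.range_pctfPoint {θ : X ≃ₜ UnitAddCircle}
    (hξ : IsHyperconvexFrenet ξ) : Set.range (pctfPoint (θ := θ) hξ) = secantUnion ξ := by
  ext p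
  constructor
  · rintro ⟨t, rfl⟩
    exact ⟨_, _, t.ne.2.2, hξ.pctfPoint_mem_secant t⟩
  · rintro ⟨x, z, hxz, hp⟩
    obtain ⟨t, ht, -⟩ := hξ.exists_pctfPoint_eq (θ := θ) hxz hp
    exact ⟨t, ht⟩

lemma IsHyperconvexFrenet.secantUnion_subset_Omega (hξ : IsHyperconvexFrenet ξ) :
    secantUnion ξ ⊆ Omega ξ := by
  rintro p ⟨x, z, hxz, hp⟩
  exact hξ.secant_subset_Omega hxz hp

end Secants

/-! ### Properness of dev_pctf as a map into Ω_ξ -/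

section Properness

variable {X : Type*} [TopologicalSpace X] {ξ : X → FullFlag 4} {θ : X ≃ₜ UnitAddCircle}

lemma preconnectedSpace_of_homeomorph (θ : X ≃ₜ UnitAddCircle) : PreconnectedSpace X :=
  θ.symm.surjective.denseRange.preconnectedSpace θ.symm.continuous

lemma PosTriple.continuous_ofParams {T : Type*} [TopologicalSpace T] {x : T → X} {s r : T → ℝ}
    (hx : Continuous x) (hs : Continuous s) (hr : Continuous r) (h1 : ∀ t, 0 < s t)
    (h2 : ∀ t, s t < r t) (h3 : ∀ t, r t < 1) :
    Continuous fun t => PosTriple.ofParams θ (x t) (s t) (r t) (h1 t) (h2 t) (h3 t) :=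
  Continuous.subtype_mk (hx.prodMk (((continuous_shift_uncurry θ).comp (hx.prodMk hs)).prodMk
    ((continuous_shift_uncurry θ).comp (hx.prodMk hr)))) _

/-- The parametrization by a base point and an increasing pair of distances is continuous and
surjective, from a product of connected spaces. -/
lemma preconnectedSpace_posTriple (θ : X ≃ₜ UnitAddCircle) : PreconnectedSpace (PosTriple θ) := by
  have := preconnectedSpace_of_homeomorph θ
  have : PreconnectedSpace (incPairs 0 1) :=
    isPreconnected_iff_preconnectedSpace.1 (isPreconnected_incPairs 0 1)
  have hc := PosTriple.continuous_ofParams (θ := θ)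
    (continuous_fst : Continuous fun q : X × incPairs 0 1 => q.1)
    (continuous_subtype_val.comp continuous_snd).fst (continuous_subtype_val.comp continuous_snd).snd
    (fun q => q.2.2.1) (fun q => q.2.2.2.1) (fun q => q.2.2.2.2)
  refine (Function.Surjective.denseRange fun t => ?_).preconnectedSpace hc
  obtain ⟨s, r, h1, h2, h3, h⟩ := t.exists_params
  exact ⟨(t.1.1, ⟨(s, r), h1, h2, h3⟩), h.symm⟩

lemma nonempty_posTriple (θ : X ≃ₜ UnitAddCircle) : Nonempty (PosTriple θ) :=
  ⟨PosTriple.ofParams θ (θ.symm 0) (1 / 3) (2 / 3) (by norm_num) (by norm_num) (by norm_num)⟩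

lemma isConnected_tripleLeaf (θ : X ≃ₜ UnitAddCircle) {x z : X} (hxz : x ≠ z) :
    IsConnected (tripleLeaf θ x z) := by
  obtain ⟨ζ, hζ, rfl⟩ := exists_shift_eq θ hxz.symm
  have hc := PosTriple.continuous_ofParams (θ := θ)
    (continuous_const : Continuous fun _ : Set.Ioo 0 ζ => x)
    continuous_subtype_val (continuous_const : Continuous fun _ : Set.Ioo 0 ζ => ζ)
    (fun s => s.2.1) (fun s => s.2.2) (fun _ => hζ.2)
  have : ConnectedSpace (Set.Ioo 0 ζ) := isConnected_iff_connectedSpace.1 (isConnected_Ioo hζ.1)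
  convert isConnected_range hc using 1
  ext t
  constructor
  · rintro ⟨h1, h2⟩
    obtain ⟨s, r, k1, k2, k3, h⟩ := t.exists_params
    have hr : r = ζ := by
      have h4 : t.1.2.2 = shift θ t.1.1 r := congrArg (fun t : PosTriple θ => t.1.2.2) h
      rw [h1, h2] at h4
      exact (shift_injOn θ x ⟨hζ.1.le, hζ.2⟩ ⟨(k1.trans k2).le, k3⟩ h4).symm
    subst hr
    refine ⟨⟨s, k1, k2⟩, ?_⟩
    rw [h]
    simp only [h1]
  · rintro ⟨s, rfl⟩
    exact ⟨rfl, rfl⟩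

lemma isClosed_tripleLeaf (θ : X ≃ₜ UnitAddCircle) (x z : X) : IsClosed (tripleLeaf θ x z) := by
  have := t2Space_of_homeomorph θ
  have c1 : Continuous fun t : PosTriple θ => t.1.1 := continuous_subtype_val.fst
  have c3 : Continuous fun t : PosTriple θ => t.1.2.2 := continuous_subtype_val.snd.snd
  exact (isClosed_eq c1 continuous_const).inter (isClosed_eq c3 continuous_const)

lemma IsHyperconvexFrenet.tendsto_sup_ne (hξ : IsHyperconvexFrenet ξ) {ι : Type*} {l : Filter ι}
    {a c : ι → X} {x z : X} (hxz : x ≠ z) (ha : Tendsto a l (𝓝 x)) (hc : Tendsto c l (𝓝 z))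
    [T2Space X] :
    Tendsto (fun i => comp ξ 1 (a i) ⊔ comp ξ 1 (c i)) l (𝓝 (comp ξ 1 x ⊔ comp ξ 1 z)) := by
  obtain ⟨n, v, hv⟩ := hξ.exists_isLift x
  have hvz := hv.mem _ hxz.symm
  have hvz0 := hv.ne_zero hxz.symm
  have := tendsto_sup_span_singleton (((hξ.continuous_comp 1).tendsto x).comp ha)
    ((hv.continuousAt z hxz.symm).tendsto.comp hc)
    (fun h => hvz0 (hξ.eq_zero_of_mem 1 1 (by decide) hxz h hvz))
  rw [← comp_one_eq_span hvz hvz0] at this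
  refine this.congr' ?_
  filter_upwards [hc.eventually_ne hxz.symm] with i hi
  rw [Function.comp_apply, Function.comp_apply, ← comp_one_eq_span (hv.mem _ hi) (hv.ne_zero hi)]

/-- The map `dev_pctf` with values in `Ω_ξ`. -/
def pctfOmega (hξ : IsHyperconvexFrenet ξ) (t : PosTriple θ) : Omega ξ :=
  ⟨pctfPoint hξ t, hξ.secant_subset_Omega t.ne.2.2 (hξ.pctfPoint_mem_secant t)⟩

/-- By compactness of the circle, triples converge along any ultrafilter. If the outer entries
merge, the secant lines tend to a tangent line ξ²(x); if the middle entry merges with an outer one,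
the image tends to ξ¹ of that point. Neither limit lies in Ω_ξ, so a limit in Ω_ξ forces a
nondegenerate limit triple. -/
lemma IsHyperconvexFrenet.isProperMap_pctfOmega (hξ : IsHyperconvexFrenet ξ) :
    IsProperMap (pctfOmega (θ := θ) hξ) := by
  have := t2Space_of_homeomorph θ
  have : CompactSpace X := θ.symm.compactSpace
  refine isProperMap_iff_ultrafilter_of_t2.2 ⟨hξ.continuous_pctfPoint.subtype_mk _, ?_⟩
  intro 𝒰 p hp
  obtain ⟨⟨x, y, z⟩, -, hq⟩ := isCompact_univ.ultrafilter_le_nhds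
    (𝒰.map (fun t : PosTriple θ => t.1)) (by simp)
  have hq : Tendsto (fun t : PosTriple θ => t.1) (𝒰 : Filter (PosTriple θ)) (𝓝 (x, y, z)) := hq
  have lx : Tendsto (fun t : PosTriple θ => t.1.1) 𝒰 (𝓝 x) := (continuous_fst.tendsto _).comp hq
  have ly : Tendsto (fun t : PosTriple θ => t.1.2.1) 𝒰 (𝓝 y) :=
    (continuous_snd.fst.tendsto _).comp hq
  have lz : Tendsto (fun t : PosTriple θ => t.1.2.2) 𝒰 (𝓝 z) :=
    (continuous_snd.snd.tendsto _).comp hq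
  have lp : Tendsto (fun t : PosTriple θ => (pctfPoint hξ t).1) 𝒰 (𝓝 p.1.1) :=
    tendsto_rp3_iff.1 ((continuous_subtype_val.tendsto p).comp hp)
  obtain ⟨u, hu0, hu⟩ := exists_rep p.1
  have hum : u ∈ p.1.1 := hu ▸ Submodule.mem_span_singleton_self u
  have hxz : x ≠ z := by
    rintro rfl
    have h2 : Tendsto (fun t : PosTriple θ => comp ξ 1 t.1.1 ⊔ comp ξ 1 t.1.2.2) 𝒰
        (𝓝 (comp ξ 2 x)) :=
      Tendsto.comp (g := fun p : X × X => comp ξ 1 p.1 ⊔ comp ξ 1 p.2)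
        (f := fun t : PosTriple θ => (t.1.1, t.1.2.2)) (hξ.tendsto_sup_pair θ x) (tendsto_inf.2 ⟨lx.prodMk_nhds lz,
        tendsto_principal.2 (Eventually.of_forall fun t => t.ne.2.2)⟩)
    exact p.2 ⟨x, le_of_tendsto_submodule lp h2 (Eventually.of_forall fun t => inf_le_left)⟩
  have h1 : p.1.1 ≤ comp ξ 1 x ⊔ comp ξ 1 z := le_of_tendsto_submodule lp
    (hξ.tendsto_sup_ne hxz lx lz) (Eventually.of_forall fun t => inf_le_left)
  have h3 : p.1.1 ≤ comp ξ 3 y := le_of_tendsto_submodule lp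
    (((hξ.continuous_comp 3).tendsto y).comp ly) (Eventually.of_forall fun t => inf_le_right)
  obtain ⟨a, ha, c, hc, hac⟩ := Submodule.mem_sup.1 (h1 hum)
  have end1 : ∀ w, u ∉ comp ξ 1 w := fun w hw => p.2 ⟨w, by
    rw [hu, Submodule.span_singleton_le_iff_mem]
    exact comp_mono ξ w (by decide) hw⟩
  have hyx : x ≠ y := by
    rintro rfl
    have hcx : c ∈ comp ξ 3 x := (Submodule.add_mem_iff_right _
      (comp_mono ξ x (by decide : (1 : Fin 5) ≤ 3) ha)).1 (hac ▸ h3 hum)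
    have hc0 : c = 0 := hξ.eq_zero_of_mem 1 3 (by decide) hxz.symm hc hcx
    rw [hc0, add_zero] at hac
    exact end1 x (hac ▸ ha)
  have hyz : y ≠ z := by
    rintro rfl
    have hay : a ∈ comp ξ 3 y := (Submodule.add_mem_iff_left _
      (comp_mono ξ y (by decide : (1 : Fin 5) ≤ 3) hc)).1 (hac ▸ h3 hum)
    have ha0 : a = 0 := hξ.eq_zero_of_mem 1 3 (by decide) hxz ha hay
    rw [ha0, zero_add] at hac
    exact end1 y (hac ▸ hc)
  rcases sbtw_or_sbtw (θ.injective.ne hyx) (θ.injective.ne hyz) (θ.injective.ne hxz) with h | h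
  · exact ⟨⟨(x, y, z), h⟩, tendsto_subtype_rng.2 hq⟩
  -- Negatively oriented triples form an open set as well, so no such triple is a limit of positive
  -- ones.
  · exfalso
    have hopen : IsOpen {t : X × X × X | sbtw (θ t.2.2) (θ t.2.1) (θ t.1)} :=
      (isOpen_posTriple θ).preimage
        (f := fun t : X × X × X => (t.2.2, t.2.1, t.1)) (by fun_prop)
    obtain ⟨t, ht⟩ := (hq.eventually (hopen.mem_nhds h)).exists
    exact absurd ht.btw (sbtw_iff_not_btw.1 t.2)

end Properness

/-! ### Openness of the union of the secant lines -/

section Openness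

lemma eventually_vol_ne_zero {V : ℝ → E 4} {x₀ : ℝ} (hV : ContinuousAt V x₀) {u₀ a o : E 4}
    (h : vol a (V x₀) u₀ o ≠ 0) :
    ∃ η > 0, ∀ᶠ u in 𝓝 u₀, ∀ x ∈ Set.Icc (x₀ - η) (x₀ + η), vol a (V x) u o ≠ 0 := by
  have hc : Tendsto (fun q : E 4 × ℝ => vol a (V q.2) q.1 o) (𝓝 (u₀, x₀))
      (𝓝 (vol a (V x₀) u₀ o)) :=
    tendsto_vol tendsto_const_nhds (hV.tendsto.comp (continuous_snd.tendsto (u₀, x₀)))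
      (continuous_fst.tendsto (u₀, x₀)) tendsto_const_nhds
  obtain ⟨P, hP, Q, hQ, hPQ⟩ := eventually_prod_iff.1 ((nhds_prod_eq (x := u₀) (y := x₀)) ▸
    hc.eventually_ne h)
  obtain ⟨δ, hδ, hδQ⟩ := Metric.eventually_nhds_iff_ball.1 hQ
  refine ⟨δ / 2, by positivity, hP.mono fun u hu x hx => hPQ hu (hδQ x ?_)⟩
  rw [Metric.mem_ball, Real.dist_eq, abs_lt]
  constructor <;> linarith [hx.1, hx.2]

lemma signed_sum_pos {s t A B : ℝ} (hst : 0 < s * t) (hs : s ≠ 0) (hA : 0 ≤ A) (hB : 0 ≤ B)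
    (h : 0 < A ∨ 0 < B) : 0 < s * (s * A + t * B) := by
  have hs2 : 0 < s * s := mul_self_pos.2 hs
  rcases h with h | h
  · nlinarith [mul_pos hs2 h, mul_nonneg hst.le hB]
  · nlinarith [mul_pos hst h, mul_nonneg hs2.le hA]

/-- Vectors on the secant lines of a convex curve form an open set. -/
lemma eventually_mem_secant {V : ℝ → E 4} {o : E 4} (hV : ContinuousOn V (Set.Ioo 0 1))
    (h4 : ∀ a b c d, 0 < a → a < b → b < c → c < d → d < 1 → vol (V a) (V b) (V c) (V d) ≠ 0)
    (h3 : ∀ a b c, 0 < a → a < b → b < c → c < 1 → vol (V a) (V b) (V c) o ≠ 0)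
    {x₀ α z₀ s t : ℝ} (h0 : 0 < x₀) (h1 : x₀ < α) (h2 : α < z₀) (h5 : z₀ < 1) (hs : s ≠ 0)
    (ht : t ≠ 0) :
    ∀ᶠ u in 𝓝 (s • V x₀ + t • V z₀), ∃ x z, 0 < x ∧ x < z ∧ z < 1 ∧
      ∃ c d : ℝ, c ≠ 0 ∧ d ≠ 0 ∧ u = c • V x + d • V z := by
  set u₀ := s • V x₀ + t • V z₀ with hu₀
  have cont : ∀ x, 0 < x → x < 1 → ContinuousAt V x := fun x k1 k2 =>
    hV.continuousAt (Ioo_mem_nhds k1 k2)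
  -- These two determinants being nonzero makes both coefficients of the final decomposition of `u`
  -- nonzero. The first one also gives uniqueness of zeros on horizontal lines.
  obtain ⟨η₁, hη₁, ev₁⟩ := eventually_vol_ne_zero (u₀ := u₀) (a := V α) (o := o)
    (cont z₀ (by linarith) h5) (by
      have : vol (V α) (V z₀) u₀ o = s * vol (V x₀) (V α) (V z₀) o := by
        rw [hu₀]; simp only [vol, PiLp.add_apply, PiLp.smul_apply, smul_eq_mul]; ring
      rw [this]
      exact mul_ne_zero hs (h3 _ _ _ h0 h1 h2 h5))
  obtain ⟨η₂, hη₂, ev₂⟩ := eventually_vol_ne_zero (u₀ := u₀) (a := V α) (o := o)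
    (cont x₀ h0 (by linarith)) (by
      have : vol (V α) (V x₀) u₀ o = -(t * vol (V x₀) (V α) (V z₀) o) := by
        rw [hu₀]; simp only [vol, PiLp.add_apply, PiLp.smul_apply, smul_eq_mul]; ring
      rw [this]
      exact neg_ne_zero.2 (mul_ne_zero ht (h3 _ _ _ h0 h1 h2 h5)))
  obtain ⟨η, hη, b1, b2, b3, b4, b5, b6⟩ : ∃ η > 0, 0 < x₀ - η ∧ x₀ + η < α ∧ α < z₀ - η ∧
      z₀ + η < 1 ∧ η ≤ η₁ ∧ η ≤ η₂ := by
    have hm : ∀ᶠ η : ℝ in 𝓝[>] 0, 0 < x₀ - η ∧ x₀ + η < α ∧ α < z₀ - η ∧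
        z₀ + η < 1 ∧ η ≤ η₁ ∧ η ≤ η₂ := by
      have lt : ∀ {a : ℝ}, 0 < a → ∀ᶠ η : ℝ in 𝓝[>] 0, η < a := fun ha =>
        (eventually_lt_nhds ha).filter_mono nhdsWithin_le_nhds
      filter_upwards [lt h0, lt (sub_pos.2 h1), lt (sub_pos.2 h2), lt (sub_pos.2 h5), lt hη₁,
        lt hη₂] with η k1 k2 k3 k4 k5 k6
      exact ⟨by linarith, by linarith, by linarith, by linarith, k5.le, k6.le⟩
    obtain ⟨η, hη, hη'⟩ := (hm.and self_mem_nhdsWithin).exists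
    exact ⟨η, hη', hη⟩
  obtain ⟨σ, hσ1, hσ⟩ := exists_sign_quadruples hV h4
  obtain ⟨κ, hκ1, hκ⟩ := exists_sign_triples hV h3
  have hσ0 : σ ≠ 0 := by rcases hσ1 with rfl | rfl <;> norm_num
  have hκ0 : κ ≠ 0 := by rcases hκ1 with rfl | rfl <;> norm_num
  -- In the basis `V α`, `o`, `V x`, `V z`, the vector `u` lies in the span of the last two exactly
  -- when its first two coordinates vanish. By Cramer's rule these are, up to nonzero factors, `gb`
  -- and `ga`.
  set ga : E 4 → ℝ → ℝ → ℝ := fun u x z => -(σ * s) * vol u (V α) (V x) (V z) with hga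
  set gb : E 4 → ℝ → ℝ → ℝ := fun u x z => κ * s * vol u o (V x) (V z) with hgb
  have ca : ∀ p, ∀ x ∈ Set.Icc (x₀ - η) (x₀ + η), ∀ z ∈ Set.Icc (z₀ - η) (z₀ + η),
      ContinuousAt (fun q : E 4 × ℝ × ℝ => ga q.1 q.2.1 q.2.2) (p, x, z) := fun p x hx z hz =>
    (tendsto_vol (continuous_fst.tendsto (p, x, z)) tendsto_const_nhds
      ((cont x (by linarith [hx.1]) (by linarith [hx.2])).tendsto.comp
        (continuous_snd.fst.tendsto (p, x, z)))
      ((cont z (by linarith [hz.1]) (by linarith [hz.2])).tendsto.comp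
        (continuous_snd.snd.tendsto (p, x, z)))).const_mul _
  have cb : ∀ p, ∀ x ∈ Set.Icc (x₀ - η) (x₀ + η), ∀ z ∈ Set.Icc (z₀ - η) (z₀ + η),
      ContinuousAt (fun q : E 4 × ℝ × ℝ => gb q.1 q.2.1 q.2.2) (p, x, z) := fun p x hx z hz =>
    (tendsto_vol (continuous_fst.tendsto (p, x, z)) tendsto_const_nhds
      ((cont x (by linarith [hx.1]) (by linarith [hx.2])).tendsto.comp
        (continuous_snd.fst.tendsto (p, x, z)))
      ((cont z (by linarith [hz.1]) (by linarith [hz.2])).tendsto.comp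
        (continuous_snd.snd.tendsto (p, x, z)))).const_mul _
  have ea : ∀ x z, ga u₀ x z = s * (s * (-(σ * vol (V x₀) (V α) (V x) (V z))) +
      t * (-(σ * vol (V z₀) (V α) (V x) (V z)))) := fun x z => by
    simp only [hga, hu₀, vol_lin1]; ring
  have eb : ∀ x z, gb u₀ x z = s * (s * (κ * vol (V x₀) o (V x) (V z)) +
      t * (κ * vol (V z₀) o (V x) (V z))) := fun x z => by
    simp only [hgb, hu₀, vol_lin1]; ring
  have a0 : ∀ z, vol (V x₀) (V α) (V x₀) (V z) = 0 := fun z => by unfold vol; ring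
  have a0' : ∀ x, vol (V z₀) (V α) (V x) (V z₀) = 0 := fun x => by unfold vol; ring
  have b0 : ∀ z, vol (V x₀) o (V x₀) (V z) = 0 := fun z => by unfold vol; ring
  have b0' : ∀ x, vol (V z₀) o (V x) (V z₀) = 0 := fun x => by unfold vol; ring
  have a1 : ∀ x z, x₀ < x → x < α → α < z → z < 1 →
      0 < -(σ * vol (V x₀) (V α) (V x) (V z)) := fun x z k1 k2 k3 k4 => by
    rw [vol_swap23, ← mul_neg, neg_neg]; exact hσ _ _ _ _ h0 k1 k2 k3 k4
  have a2 : ∀ x z, 0 < x → x < x₀ → α < z → z < 1 →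
      0 < σ * vol (V x₀) (V α) (V x) (V z) := fun x z k1 k2 k3 k4 => by
    rw [vol_swap23, vol_swap12, neg_neg]; exact hσ _ _ _ _ k1 k2 h1 k3 k4
  have a3 : ∀ x z, 0 < x → x < α → z₀ < z → z < 1 →
      0 < -(σ * vol (V z₀) (V α) (V x) (V z)) := fun x z k1 k2 k3 k4 => by
    have : vol (V z₀) (V α) (V x) (V z) = -vol (V x) (V α) (V z₀) (V z) := by unfold vol; ring
    rw [this, ← mul_neg, neg_neg]; exact hσ _ _ _ _ k1 k2 h2 k3 k4
  have a4 : ∀ x z, 0 < x → x < α → α < z → z < z₀ →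
      0 < σ * vol (V z₀) (V α) (V x) (V z) := fun x z k1 k2 k3 k4 => by
    have : vol (V z₀) (V α) (V x) (V z) = vol (V x) (V α) (V z) (V z₀) := by unfold vol; ring
    rw [this]; exact hσ _ _ _ _ k1 k2 k3 k4 h5
  have c1 : ∀ x z, x₀ < x → x < α → α < z → z < 1 →
      0 < κ * vol (V x₀) o (V x) (V z) := fun x z k1 k2 k3 k4 => by
    have : vol (V x₀) o (V x) (V z) = vol (V x₀) (V x) (V z) o := by unfold vol; ring
    rw [this]; exact hκ _ _ _ h0 k1 (k2.trans k3) k4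
  have c2 : ∀ x z, 0 < x → x < x₀ → α < z → z < 1 →
      0 < -(κ * vol (V x₀) o (V x) (V z)) := fun x z k1 k2 k3 k4 => by
    have : vol (V x₀) o (V x) (V z) = -vol (V x) (V x₀) (V z) o := by unfold vol; ring
    rw [this, ← mul_neg, neg_neg]; exact hκ _ _ _ k1 k2 (h1.trans k3) k4
  have c3 : ∀ x z, 0 < x → x < α → z₀ < z → z < 1 →
      0 < -(κ * vol (V z₀) o (V x) (V z)) := fun x z k1 k2 k3 k4 => by
    have : vol (V z₀) o (V x) (V z) = -vol (V x) (V z₀) (V z) o := by unfold vol; ring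
    rw [this, ← mul_neg, neg_neg]; exact hκ _ _ _ k1 (k2.trans h2) k3 k4
  have c4 : ∀ x z, 0 < x → x < α → α < z → z < z₀ →
      0 < κ * vol (V z₀) o (V x) (V z) := fun x z k1 k2 k3 k4 => by
    have : vol (V z₀) o (V x) (V z) = vol (V x) (V z) (V z₀) o := by unfold vol; ring
    rw [this]; exact hκ _ _ _ k1 (k2.trans k3) k4 h5
  have sa : ∀ x ∈ Set.Icc (x₀ - η) (x₀ + η), ∀ z ∈ Set.Icc (z₀ - η) (z₀ + η),
      (x₀ ≤ x → 0 ≤ -(σ * vol (V x₀) (V α) (V x) (V z))) ∧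
      (x ≤ x₀ → 0 ≤ σ * vol (V x₀) (V α) (V x) (V z)) ∧
      (z₀ ≤ z → 0 ≤ -(σ * vol (V z₀) (V α) (V x) (V z))) ∧
      (z ≤ z₀ → 0 ≤ σ * vol (V z₀) (V α) (V x) (V z)) := by
    intro x hx z hz
    refine ⟨fun h => ?_, fun h => ?_, fun h => ?_, fun h => ?_⟩ <;> rcases h.eq_or_lt with h | h
    · rw [← h, a0]; simp
    · exact (a1 x z h (by linarith [hx.2]) (by linarith [hz.1]) (by linarith [hz.2])).le
    · rw [h, a0]; simp
    · exact (a2 x z (by linarith [hx.1]) h (by linarith [hz.1]) (by linarith [hz.2])).le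
    · rw [← h, a0']; simp
    · exact (a3 x z (by linarith [hx.1]) (by linarith [hx.2]) h (by linarith [hz.2])).le
    · rw [h, a0']; simp
    · exact (a4 x z (by linarith [hx.1]) (by linarith [hx.2]) (by linarith [hz.1]) h).le
  have sb : ∀ x ∈ Set.Icc (x₀ - η) (x₀ + η), ∀ z ∈ Set.Icc (z₀ - η) (z₀ + η),
      (x₀ ≤ x → 0 ≤ κ * vol (V x₀) o (V x) (V z)) ∧
      (x ≤ x₀ → 0 ≤ -(κ * vol (V x₀) o (V x) (V z))) ∧
      (z₀ ≤ z → 0 ≤ -(κ * vol (V z₀) o (V x) (V z))) ∧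
      (z ≤ z₀ → 0 ≤ κ * vol (V z₀) o (V x) (V z)) := by
    intro x hx z hz
    refine ⟨fun h => ?_, fun h => ?_, fun h => ?_, fun h => ?_⟩ <;> rcases h.eq_or_lt with h | h
    · rw [← h, b0]; simp
    · exact (c1 x z h (by linarith [hx.2]) (by linarith [hz.1]) (by linarith [hz.2])).le
    · rw [h, b0]; simp
    · exact (c2 x z (by linarith [hx.1]) h (by linarith [hz.1]) (by linarith [hz.2])).le
    · rw [← h, b0']; simp
    · exact (c3 x z (by linarith [hx.1]) (by linarith [hx.2]) h (by linarith [hz.2])).le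
    · rw [h, b0']; simp
    · exact (c4 x z (by linarith [hx.1]) (by linarith [hx.2]) (by linarith [hz.1]) h).le
  have ord : ∀ z ∈ Set.Icc (z₀ - η) (z₀ + η), ∀ x ∈ Set.Icc (x₀ - η) (x₀ + η),
      ∀ x' ∈ Set.Icc (x₀ - η) (x₀ + η), x ≠ x' →
      vol (V α) (V z) (V x) (V x') ≠ 0 ∧ vol o (V z) (V x) (V x') ≠ 0 := by
    have main : ∀ z ∈ Set.Icc (z₀ - η) (z₀ + η), ∀ x ∈ Set.Icc (x₀ - η) (x₀ + η),
        ∀ x' ∈ Set.Icc (x₀ - η) (x₀ + η), x < x' →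
        vol (V α) (V z) (V x) (V x') ≠ 0 ∧ vol o (V z) (V x) (V x') ≠ 0 := by
      intro z hz x hx x' hx' hxx
      constructor
      · have : vol (V α) (V z) (V x) (V x') = vol (V x) (V x') (V α) (V z) := by unfold vol; ring
        rw [this]
        exact h4 _ _ _ _ (by linarith [hx.1]) hxx (by linarith [hx'.2]) (by linarith [hz.1])
          (by linarith [hz.2])
      · have : vol o (V z) (V x) (V x') = -vol (V x) (V x') (V z) o := by unfold vol; ring
        rw [this]
        exact neg_ne_zero.2 (h3 _ _ _ (by linarith [hx.1]) hxx (by linarith [hx'.2, hz.1])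
          (by linarith [hz.2]))
    intro z hz x hx x' hx' hxx
    rcases lt_or_gt_of_ne hxx with h | h
    · exact main z hz x hx x' hx' h
    · obtain ⟨k1, k2⟩ := main z hz x' hx' x hx h
      rw [vol_swap34 _ _ (V x') (V x)]
      rw [vol_swap34 o _ (V x') (V x)]
      exact ⟨neg_ne_zero.2 k1, neg_ne_zero.2 k2⟩
  have subz : ∀ z ∈ Set.Icc (z₀ - η) (z₀ + η), z ∈ Set.Icc (z₀ - η₁) (z₀ + η₁) := fun z hz =>
    ⟨by linarith [hz.1], by linarith [hz.2]⟩
  have subx : ∀ x ∈ Set.Icc (x₀ - η) (x₀ + η), x ∈ Set.Icc (x₀ - η₂) (x₀ + η₂) := fun x hx =>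
    ⟨by linarith [hx.1], by linarith [hx.2]⟩
  -- Two distinct zeros `x`, `x'` at the same height would, by the Plücker relation, make the
  -- product of the determinants of `V α, V z, u, o` and of `V α, V z, V x, V x'` vanish.
  have ua : ∀ᶠ u in 𝓝 u₀, ∀ z ∈ Set.Icc (z₀ - η) (z₀ + η), ∀ x ∈ Set.Icc (x₀ - η) (x₀ + η),
      ∀ x' ∈ Set.Icc (x₀ - η) (x₀ + η), ga u x z = 0 → ga u x' z = 0 → x = x' := by
    filter_upwards [ev₁] with u hu z hz x hx x' hx' k1 k2
    by_contra hne
    have k1 := (mul_eq_zero.1 k1).resolve_left (neg_ne_zero.2 (mul_ne_zero hσ0 hs))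
    have k2 := (mul_eq_zero.1 k2).resolve_left (neg_ne_zero.2 (mul_ne_zero hσ0 hs))
    have e1 : ∀ y, vol (V α) (V z) u (V y) = vol u (V α) (V y) (V z) * (-1) := fun y => by
      unfold vol; ring
    have := vol_plucker (V α) (V z) u o (V x) (V x')
    rw [e1, e1, k1, k2] at this
    simp only [zero_mul, mul_zero, sub_zero] at this
    rcases mul_eq_zero.1 this.symm with h | h
    · exact hu z (subz z hz) h
    · exact (ord z hz x hx x' hx' hne).1 h
  have ub : ∀ᶠ u in 𝓝 u₀, ∀ z ∈ Set.Icc (z₀ - η) (z₀ + η), ∀ x ∈ Set.Icc (x₀ - η) (x₀ + η),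
      ∀ x' ∈ Set.Icc (x₀ - η) (x₀ + η), gb u x z = 0 → gb u x' z = 0 → x = x' := by
    filter_upwards [ev₁] with u hu z hz x hx x' hx' k1 k2
    by_contra hne
    have k1 := (mul_eq_zero.1 k1).resolve_left (mul_ne_zero hκ0 hs)
    have k2 := (mul_eq_zero.1 k2).resolve_left (mul_ne_zero hκ0 hs)
    have e1 : ∀ y, vol o (V z) u (V y) = vol u o (V y) (V z) * (-1) := fun y => by
      unfold vol; ring
    have := vol_plucker o (V z) u (V α) (V x) (V x')
    rw [e1, e1, k1, k2] at this
    simp only [zero_mul, mul_zero, sub_zero] at this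
    rcases mul_eq_zero.1 this.symm with h | h
    · refine hu z (subz z hz) ?_
      have e2 : vol (V α) (V z) u o = vol o (V z) u (V α) * (-1) := by unfold vol; ring
      rw [e2, h, zero_mul]
    · exact (ord z hz x hx x' hx' hne).2 h
  have sol : ∀ᶠ u in 𝓝 u₀, ∃ x ∈ Set.Icc (x₀ - η) (x₀ + η), ∃ z ∈ Set.Icc (z₀ - η) (z₀ + η),
      ga u x z = 0 ∧ gb u x z = 0 := by
    have up : ∀ y₀ : ℝ, Set.Icc y₀ (y₀ + η) ⊆ Set.Icc (y₀ - η) (y₀ + η) := fun y₀ =>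
      Set.Icc_subset_Icc_left (by linarith)
    have dn : ∀ y₀ : ℝ, Set.Icc (y₀ - η) y₀ ⊆ Set.Icc (y₀ - η) (y₀ + η) := fun y₀ =>
      Set.Icc_subset_Icc_right (by linarith)
    -- The two terms of `ga` change sign in the same direction with `x - x₀` and `z - z₀`, those of
    -- `gb` in opposite directions. A negative product `s * t` reverses one term, so `ga` and `gb`
    -- exchange roles, according to the component of the punctured line containing `u₀`.
    rcases lt_or_gt_of_ne (mul_ne_zero hs ht) with hst | hst
    · have hst' : 0 < s * -t := by linarith
      have := eventually_exists_common_zero hη cb ca ?_ ?_ ?_ ?_ ub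
      · exact this.mono fun u ⟨x, hx, z, hz, k1, k2⟩ => ⟨x, hx, z, hz, k2, k1⟩
      · intro x hx z hz hne
        obtain ⟨k1, -, k3, -⟩ := sb x (up _ hx) z (up _ hz)
        have := signed_sum_pos hst' hs (k1 hx.1) (k3 hz.1) (hne.imp
          (fun h => c1 x z (lt_of_le_of_ne hx.1 h.symm) (by linarith [hx.2]) (by linarith [hz.1])
            (by linarith [hz.2]))
          (fun h => c3 x z (by linarith [hx.1]) (by linarith [hx.2])
            (lt_of_le_of_ne hz.1 h.symm) (by linarith [hz.2])))
        rw [eb]; linarith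
      · intro x hx z hz hne
        obtain ⟨-, k2, -, k4⟩ := sb x (dn _ hx) z (dn _ hz)
        have := signed_sum_pos hst' hs (k2 hx.2) (k4 hz.2) (hne.imp
          (fun h => c2 x z (by linarith [hx.1]) (lt_of_le_of_ne hx.2 h) (by linarith [hz.1])
            (by linarith [hz.2]))
          (fun h => c4 x z (by linarith [hx.1]) (by linarith [hx.2]) (by linarith [hz.1])
            (lt_of_le_of_ne hz.2 h)))
        rw [eb]; linarith
      · intro x hx z hz hne
        obtain ⟨k1, -, -, k4⟩ := sa x (up _ hx) z (dn _ hz)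
        have := signed_sum_pos hst' hs (k1 hx.1) (k4 hz.2) (hne.imp
          (fun h => a1 x z (lt_of_le_of_ne hx.1 h.symm) (by linarith [hx.2]) (by linarith [hz.1])
            (by linarith [hz.2]))
          (fun h => a4 x z (by linarith [hx.1]) (by linarith [hx.2]) (by linarith [hz.1])
            (lt_of_le_of_ne hz.2 h)))
        rw [ea]; linarith
      · intro x hx z hz hne
        obtain ⟨-, k2, k3, -⟩ := sa x (dn _ hx) z (up _ hz)
        have := signed_sum_pos hst' hs (k2 hx.2) (k3 hz.1) (hne.imp
          (fun h => a2 x z (by linarith [hx.1]) (lt_of_le_of_ne hx.2 h) (by linarith [hz.1])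
            (by linarith [hz.2]))
          (fun h => a3 x z (by linarith [hx.1]) (by linarith [hx.2])
            (lt_of_le_of_ne hz.1 h.symm) (by linarith [hz.2])))
        rw [ea]; linarith
    · refine eventually_exists_common_zero hη ca cb ?_ ?_ ?_ ?_ ua
      · intro x hx z hz hne
        obtain ⟨k1, -, k3, -⟩ := sa x (up _ hx) z (up _ hz)
        have := signed_sum_pos hst hs (k1 hx.1) (k3 hz.1) (hne.imp
          (fun h => a1 x z (lt_of_le_of_ne hx.1 h.symm) (by linarith [hx.2]) (by linarith [hz.1])
            (by linarith [hz.2]))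
          (fun h => a3 x z (by linarith [hx.1]) (by linarith [hx.2])
            (lt_of_le_of_ne hz.1 h.symm) (by linarith [hz.2])))
        rw [ea]; linarith
      · intro x hx z hz hne
        obtain ⟨-, k2, -, k4⟩ := sa x (dn _ hx) z (dn _ hz)
        have := signed_sum_pos hst hs (k2 hx.2) (k4 hz.2) (hne.imp
          (fun h => a2 x z (by linarith [hx.1]) (lt_of_le_of_ne hx.2 h) (by linarith [hz.1])
            (by linarith [hz.2]))
          (fun h => a4 x z (by linarith [hx.1]) (by linarith [hx.2]) (by linarith [hz.1])
            (lt_of_le_of_ne hz.2 h)))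
        rw [ea]; linarith
      · intro x hx z hz hne
        obtain ⟨k1, -, -, k4⟩ := sb x (up _ hx) z (dn _ hz)
        have := signed_sum_pos hst hs (k1 hx.1) (k4 hz.2) (hne.imp
          (fun h => c1 x z (lt_of_le_of_ne hx.1 h.symm) (by linarith [hx.2]) (by linarith [hz.1])
            (by linarith [hz.2]))
          (fun h => c4 x z (by linarith [hx.1]) (by linarith [hx.2]) (by linarith [hz.1])
            (lt_of_le_of_ne hz.2 h)))
        rw [eb]; linarith
      · intro x hx z hz hne
        obtain ⟨-, k2, k3, -⟩ := sb x (dn _ hx) z (up _ hz)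
        have := signed_sum_pos hst hs (k2 hx.2) (k3 hz.1) (hne.imp
          (fun h => c2 x z (by linarith [hx.1]) (lt_of_le_of_ne hx.2 h) (by linarith [hz.1])
            (by linarith [hz.2]))
          (fun h => c3 x z (by linarith [hx.1]) (by linarith [hx.2])
            (lt_of_le_of_ne hz.1 h.symm) (by linarith [hz.2])))
        rw [eb]; linarith
  filter_upwards [sol, ev₁, ev₂] with u ⟨x, hx, z, hz, k1, k2⟩ hu1 hu2
  have k1 := (mul_eq_zero.1 k1).resolve_left (neg_ne_zero.2 (mul_ne_zero hσ0 hs))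
  have k2 := (mul_eq_zero.1 k2).resolve_left (mul_ne_zero hκ0 hs)
  have hD : vol (V α) o (V x) (V z) ≠ 0 := by
    have : vol (V α) o (V x) (V z) = -vol (V x) (V α) (V z) o := by unfold vol; ring
    rw [this]
    exact neg_ne_zero.2 (h3 _ _ _ (by linarith [hx.1]) (by linarith [hx.2]) (by linarith [hz.1])
      (by linarith [hz.2]))
  have hcr := vol_cramer (V α) o (V x) (V z) u
  have e1 : vol (V α) u (V x) (V z) = 0 := by rw [vol_swap12, k1, neg_zero]
  rw [k2, e1, zero_smul, zero_smul, zero_add, zero_add] at hcr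
  refine ⟨x, z, by linarith [hx.1], by linarith [hx.2, hz.1], by linarith [hz.2],
    (vol (V α) o (V x) (V z))⁻¹ * vol (V α) o u (V z),
    (vol (V α) o (V x) (V z))⁻¹ * vol (V α) o (V x) u, ?_, ?_, ?_⟩
  · refine mul_ne_zero (inv_ne_zero hD) fun h => hu1 z (subz z hz) ?_
    have : vol (V α) (V z) u o = -vol (V α) o u (V z) := by unfold vol; ring
    rw [this, h, neg_zero]
  · refine mul_ne_zero (inv_ne_zero hD) fun h => hu2 x (subx x hx) ?_
    have : vol (V α) (V x) u o = vol (V α) o (V x) u := by unfold vol; ring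
    rw [this, h]
  · rw [mul_smul, mul_smul, ← smul_add, eq_inv_smul_iff₀ hD, hcr]

variable {X : Type*} [TopologicalSpace X] {ξ : X → FullFlag 4}

lemma IsHyperconvexFrenet.isOpen_secantUnion (hξ : IsHyperconvexFrenet ξ)
    (θ : X ≃ₜ UnitAddCircle) : IsOpen (secantUnion ξ) := by
  refine isOpen_iff_mem_nhds.2 ?_
  rintro p₀ ⟨x, z, hxz, hp⟩
  -- The base point of the lift must avoid both end points of the secant line.
  have hb : ∃ b, x ≠ b ∧ z ≠ b := by
    obtain ⟨ζ, hζ, rfl⟩ := exists_shift_eq θ hxz.symm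
    have hm : (ζ + 1) / 2 ∈ Set.Ioo (0 : ℝ) 1 := ⟨by linarith [hζ.1], by linarith [hζ.2]⟩
    exact ⟨shift θ x ((ζ + 1) / 2), (shift_ne_base θ x hm).symm,
      shift_ne θ x hζ hm (by linarith [hζ.2])⟩
  obtain ⟨b, hxb, hzb⟩ := hb
  obtain ⟨n, v, hv⟩ := hξ.exists_isLift b
  obtain ⟨o, ho0, ho, -⟩ := exists_span_eq ξ b
  obtain ⟨u₀, hu0, rfl⟩ := exists_eq_mkPoint p₀
  obtain ⟨h1, h2, h3⟩ := (mkPoint_mem_secant_iff hu0).1 hp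
  have key : ∀ᶠ u in 𝓝 u₀, ∃ x z, x ≠ z ∧ u ∈ comp ξ 1 x ⊔ comp ξ 1 z ∧ u ∉ comp ξ 1 x ∧
      u ∉ comp ξ 1 z := by
    have main : ∀ r w : ℝ, r ∈ Set.Ioo (0 : ℝ) 1 → w ∈ Set.Ioo (0 : ℝ) 1 → r < w →
        u₀ ∈ comp ξ 1 (shift θ b r) ⊔ comp ξ 1 (shift θ b w) → u₀ ∉ comp ξ 1 (shift θ b r) →
        u₀ ∉ comp ξ 1 (shift θ b w) → ∀ᶠ u in 𝓝 u₀, ∃ x z, x ≠ z ∧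
        u ∈ comp ξ 1 x ⊔ comp ξ 1 z ∧ u ∉ comp ξ 1 x ∧ u ∉ comp ξ 1 z := by
      intro r w hr hw hrw k1 k2 k3
      have eq1 : ∀ r ∈ Set.Ioo (0 : ℝ) 1, comp ξ 1 (shift θ b r) = ℝ ∙ v (shift θ b r) :=
        fun r hr => comp_one_eq_span (hv.mem _ (shift_ne_base θ b hr))
          (hv.ne_zero (shift_ne_base θ b hr))
      obtain ⟨a, ha, c, hc, ha0, hc0, rfl⟩ := exists_decomposition k1 k2 k3
      rw [eq1 r hr] at ha
      rw [eq1 w hw] at hc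
      obtain ⟨s, rfl⟩ := Submodule.mem_span_singleton.1 ha
      obtain ⟨t, rfl⟩ := Submodule.mem_span_singleton.1 hc
      have := eventually_mem_secant (hv.continuousOn_shift θ) (o := o)
        (fun a b c d h1 h2 h3 h4 h5 => hv.vol_shift_ne_zero hξ θ h1 h2 h3 h4 h5)
        (fun a b c h1 h2 h3 h4 => hv.vol_shift_base_ne_zero hξ θ ho ho0 h1 h2 h3 h4)
        hr.1 (show r < (r + w) / 2 by linarith) (show (r + w) / 2 < w by linarith) hw.2
        (left_ne_zero_of_smul ha0) (left_ne_zero_of_smul hc0)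
      refine this.mono ?_
      rintro u ⟨y, q, hy, hyq, hq, c, d, hc, hd, rfl⟩
      have my : y ∈ Set.Ioo (0 : ℝ) 1 := ⟨hy, by linarith⟩
      have mq : q ∈ Set.Ioo (0 : ℝ) 1 := ⟨by linarith, hq⟩
      have hne := shift_ne θ b my mq hyq.ne
      have l1 := Submodule.smul_mem _ c (hv.mem _ (shift_ne_base θ b my))
      have l2 := Submodule.smul_mem _ d (hv.mem _ (shift_ne_base θ b mq))
      refine ⟨_, _, hne, Submodule.add_mem _ (Submodule.mem_sup_left l1)
        (Submodule.mem_sup_right l2), ?_, ?_⟩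
      · exact hξ.not_mem_of_add hne l1 l2 (smul_ne_zero hd (hv.ne_zero (shift_ne_base θ b mq)))
      · rw [add_comm (c • _)]
        exact hξ.not_mem_of_add hne.symm l2 l1
          (smul_ne_zero hc (hv.ne_zero (shift_ne_base θ b my)))
    obtain ⟨r, hr, rfl⟩ := exists_shift_eq θ hxb
    obtain ⟨w, hw, rfl⟩ := exists_shift_eq θ hzb
    rcases lt_trichotomy r w with h | h | h
    · exact main r w hr hw h h1 h2 h3
    · exact absurd (by rw [h]) hxz
    · exact main w r hw hr h (by rwa [sup_comm]) h3 h2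
  -- Projecting `u₀` onto a nearby line `p` gives a representative of `p` that is continuous in `p`,
  -- so openness passes from vectors to projective points.
  have hlim : Tendsto (fun p : RP3 => p.1.starProjection u₀) (𝓝 (mkPoint u₀ hu0)) (𝓝 u₀) := by
    have h := tendsto_starProjection_apply (tendsto_rp3_iff.1
      (tendsto_id (x := 𝓝 (mkPoint u₀ hu0)))) (tendsto_const_nhds (x := u₀))
    rwa [Submodule.starProjection_eq_self_iff.2
      (show u₀ ∈ (mkPoint u₀ hu0).1 from Submodule.mem_span_singleton_self u₀)] at h
  filter_upwards [hlim.eventually key, hlim.eventually_ne hu0] with p ⟨x, z, hxz, k⟩ hne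
  have hp : p = mkPoint _ hne := Subtype.ext (eq_of_le_of_finrank_one (mkPoint _ hne).2 p.2
    ((Submodule.span_singleton_le_iff_mem _ _).2 (Submodule.starProjection_apply_mem _ _))).symm
  rw [hp]
  exact ⟨x, z, hxz, (mkPoint_mem_secant_iff hne).2 k⟩

end Openness

/-! ### The union of the secant lines as a component of Ω_ξ -/

section Component

variable {X : Type*} [TopologicalSpace X] {ξ : X → FullFlag 4} {θ : X ≃ₜ UnitAddCircle}

/-- The union is relatively closed as the range of a proper map, open by the planar argument, and
connected as the image of the positive triples. -/
lemma IsHyperconvexFrenet.connectedComponentIn_Omega (hξ : IsHyperconvexFrenet ξ)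
    (θ : X ≃ₜ UnitAddCircle) {q : RP3} (hq : q ∈ secantUnion ξ) :
    connectedComponentIn (Omega ξ) q = secantUnion ξ := by
  have hqΩ := hξ.secantUnion_subset_Omega hq
  apply Set.Subset.antisymm
  · rw [connectedComponentIn_eq_image hqΩ]
    have hcl : IsClopen (Subtype.val ⁻¹' secantUnion ξ : Set (Omega ξ)) := by
      refine ⟨?_, (hξ.isOpen_secantUnion θ).preimage continuous_subtype_val⟩
      have h : Subtype.val ⁻¹' secantUnion ξ = Set.range (pctfOmega (θ := θ) hξ) := by
        ext p
        rw [Set.mem_preimage, ← hξ.range_pctfPoint (θ := θ)]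
        exact ⟨fun ⟨t, ht⟩ => ⟨t, Subtype.ext ht⟩, fun ⟨t, ht⟩ => ⟨t, congrArg Subtype.val ht⟩⟩
      rw [h]
      exact (hξ.isProperMap_pctfOmega (θ := θ)).isClosedMap.isClosed_range
    rintro _ ⟨p, hp, rfl⟩
    exact hcl.connectedComponent_subset (x := (⟨q, hqΩ⟩ : Omega ξ)) hq hp
  · have := preconnectedSpace_posTriple θ
    refine IsPreconnected.subset_connectedComponentIn ?_ hq hξ.secantUnion_subset_Omega
    rw [← hξ.range_pctfPoint (θ := θ)]
    exact isPreconnected_range hξ.continuous_pctfPoint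

end Component

/-! ### Position of the points dev_pcf -/

section Developing

variable {X : Type*} [TopologicalSpace X] {ξ : X → FullFlag 4}

lemma exists_mem_restr (hξ : IsHyperconvexFrenet ξ) {x z : X} (hxz : x ≠ z) :
    ∃ c ∈ restr ξ x z, c ≠ 0 := by
  obtain ⟨f, hf0, hf, -⟩ := exists_span_eq ξ z
  obtain ⟨e, he, he1⟩ := exists_mem_two_not_mem_one ξ z
  obtain ⟨ρ, hρ⟩ := exists_coeff_mem ξ (e := e) (hξ.not_mem_three hxz.symm hf hf0)
  refine ⟨e - ρ • f, ⟨Submodule.sub_mem _ he (Submodule.smul_mem _ _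
    (comp_mono ξ z (by decide) hf)), hρ⟩, fun h => he1 ?_⟩
  rw [sub_eq_zero.1 h]
  exact Submodule.smul_mem _ _ hf

lemma IsHyperconvexFrenet.not_mem_two_of_restr (hξ : IsHyperconvexFrenet ξ) {x z : X}
    (hxz : x ≠ z) {c : E 4} (hc : c ∈ restr ξ x z) (hc0 : c ≠ 0) : c ∉ comp ξ 2 x := fun h =>
  hc0 (hξ.eq_zero_of_mem 2 2 (by decide) hxz h hc.1)

/-- Three vectors spanning `ξ³(x)` together with a vector outside of it. -/
lemma vol_ne_zero_of_flag {x : X} {o e r g : E 4} (ho : o ∈ comp ξ 1 x) (ho0 : o ≠ 0)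
    (he : e ∈ comp ξ 2 x) (he1 : e ∉ comp ξ 1 x) (hr : r ∈ comp ξ 3 x) (hr2 : r ∉ comp ξ 2 x)
    (hg : g ∉ comp ξ 3 x) : vol g o r e ≠ 0 := by
  intro h
  obtain ⟨w, hw, h0⟩ := exists_relation_of_vol_eq_zero h
  have ho2 := comp_mono ξ x (by decide : (1 : Fin 5) ≤ 2) ho
  have m2 : w 1 • o + w 3 • e ∈ comp ξ 2 x :=
    Submodule.add_mem _ (Submodule.smul_mem _ _ ho2) (Submodule.smul_mem _ _ he)
  have z0 : w 0 = 0 := by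
    by_contra hne
    refine hg ((Submodule.smul_mem_iff _ hne).1 ?_)
    have : w 0 • g = -(w 1 • o + w 3 • e + w 2 • r) := by
      rw [eq_neg_iff_add_eq_zero, ← h0]; abel
    rw [this]
    exact Submodule.neg_mem _ (Submodule.add_mem _ (comp_mono ξ x (by decide) m2)
      (Submodule.smul_mem _ _ hr))
  have z2 : w 2 = 0 := by
    by_contra hne
    refine hr2 ((Submodule.smul_mem_iff _ hne).1 ?_)
    have : w 2 • r = -(w 1 • o + w 3 • e) := by
      rw [eq_neg_iff_add_eq_zero, ← h0, z0]; simp; abel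
    rw [this]
    exact Submodule.neg_mem _ m2
  rw [z0, z2, zero_smul, zero_smul, zero_add, add_zero, add_comm] at h0
  obtain ⟨z3, z1⟩ := coeff_eq_zero he1 ho ho0 h0
  exact hw (by ext i; fin_cases i <;> assumption)

/-- Projected from the point `ξ¹(x)`, the tangent lines of the curve cut the line spanned by `c`
and `e` monotonically, and its secant lines cut it in an interlacing way. -/
lemma IsHyperconvexFrenet.exists_sign_tangent_ratio (hξ : IsHyperconvexFrenet ξ)
    (θ : X ≃ₜ UnitAddCircle) {x : X} {n : E 4} {v : X → E 4} (hv : IsLift ξ x n v) {o e c : E 4}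
    (ho : o ∈ comp ξ 1 x) (ho0 : o ≠ 0) (he : e ∈ comp ξ 2 x) (he1 : e ∉ comp ξ 1 x)
    (hc : c ∈ comp ξ 3 x) (hc2 : c ∉ comp ξ 2 x) :
    ∃ σ : ℝ, σ ≠ 0 ∧ ∀ s ∈ Set.Ioo (0 : ℝ) 1, ∀ ρ : ℝ,
      c - ρ • e ∈ comp ξ 2 (shift θ x s) ⊔ comp ξ 1 x →
      (∀ a b, 0 < a → a < b → b < s → σ * (vol (v (shift θ x a)) (v (shift θ x b)) o c /
        vol (v (shift θ x a)) (v (shift θ x b)) o e) < σ * ρ) ∧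
      (∀ a b, s < a → a < b → b < 1 → σ * ρ < σ * (vol (v (shift θ x a)) (v (shift θ x b)) o c /
        vol (v (shift θ x a)) (v (shift θ x b)) o e)) := by
  have h2 : ∀ a b, 0 < a → a < b → b < 1 →
      vol (v (shift θ x a)) (v (shift θ x b)) o e ≠ 0 := fun a b h1 h2 h3 => by
    have m₁ : a ∈ Set.Ioo (0 : ℝ) 1 := ⟨by linarith, by linarith⟩
    have m₂ : b ∈ Set.Ioo (0 : ℝ) 1 := ⟨by linarith, by linarith⟩
    rw [vol_swap34]
    exact neg_ne_zero.2 (hξ.vol_tangent_ne_zero (shift_ne_base θ x m₁).symm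
      (shift_ne θ x m₁ m₂ h2.ne) (shift_ne_base θ x m₂).symm (hv.mem _ (shift_ne_base θ x m₁))
      (hv.mem _ (shift_ne_base θ x m₂)) he he1 ho (hv.ne_zero (shift_ne_base θ x m₁))
      (hv.ne_zero (shift_ne_base θ x m₂)) ho0)
  obtain ⟨σ, hσ0, hσ⟩ := exists_sign_pair_ratio (hv.continuousOn_shift θ) (o := o) (e := c) (f := e)
    (fun a b c h1 h2 h3 h4 => hv.vol_shift_base_ne_zero hξ θ ho ho0 h1 h2 h3 h4) h2
    (fun a h1 h3 => by
      have m : a ∈ Set.Ioo (0 : ℝ) 1 := ⟨h1, h3⟩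
      have hx := shift_ne_base θ x m
      exact vol_ne_zero_of_flag ho ho0 he he1 hc hc2
        (hξ.not_mem_three hx (hv.mem _ hx) (hv.ne_zero hx)))
  refine ⟨σ, hσ0, fun s hs ρ hρ => ?_⟩
  have hsx := shift_ne_base θ x hs
  have hspan := comp_one_eq_span ho ho0
  have heH : e ∉ comp ξ 2 (shift θ x s) ⊔ comp ξ 1 x := fun h => by
    obtain ⟨a, ha, b, hb, hab⟩ := Submodule.mem_sup.1 h
    have : a = 0 := hξ.eq_zero_of_mem 2 2 (by decide) hsx ha
      ((Submodule.add_mem_iff_left _ (comp_mono ξ x (by decide) hb)).1 (hab ▸ he))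
    rw [this, zero_add] at hab
    exact he1 (hab ▸ hb)
  have lim : Tendsto (fun h => vol (v (shift θ x s)) (v (shift θ x (s + 1 * h))) o c /
      vol (v (shift θ x s)) (v (shift θ x (s + 1 * h))) o e) (𝓝[>] 0) (𝓝 ρ) := by
    rw [hspan] at hρ heH
    refine tendsto_coeff_of_tendsto_submodule
      (tendsto_sup_span_singleton (hξ.tendsto_sup_pair_shift θ x hs)
        (tendsto_const_nhds (x := o)) fun h => ho0 (hξ.eq_zero_of_mem 1 2 (by decide) hsx.symm ho h))
      tendsto_const_nhds tendsto_const_nhds heH ?_ hρ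
    filter_upwards [eventually_add_mul_lt hs.2 1, self_mem_nhdsWithin] with h h1 hp
    have hp : 0 < h := hp
    exact coeff_mem (hv.mem _ hsx)
      (hv.mem _ (shift_ne_base θ x ⟨by linarith [hs.1], by linarith⟩))
      (Submodule.mem_span_singleton_self o) (h2 _ _ hs.1 (by linarith) h1)
  constructor
  -- The tangent line at `s` is a limit of secants starting at `s`. A pair inserted strictly between
  -- `b` and `s` keeps the inequality strict.
  · intro a b ha hab hb
    have := ge_of_tendsto (lim.const_mul σ)
      (b := σ * (vol (v (shift θ x (b + (s - b) / 3))) (v (shift θ x (b + 2 * ((s - b) / 3)))) o c /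
        vol (v (shift θ x (b + (s - b) / 3))) (v (shift θ x (b + 2 * ((s - b) / 3)))) o e)) (by
      filter_upwards [eventually_add_mul_lt hs.2 1, self_mem_nhdsWithin] with h h1 hp
      have hp : 0 < h := hp
      exact (hσ _ _ _ _ (by linarith) (by linarith) (by linarith) (by linarith) h1).le)
    exact (hσ a b _ _ ha hab (by linarith) (by linarith) (by linarith [hs.2])).trans_le this
  · intro a b ha hab hb
    have := le_of_tendsto (lim.const_mul σ)
      (b := σ * (vol (v (shift θ x (s + (a - s) / 3))) (v (shift θ x (s + 2 * ((a - s) / 3)))) o c /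
        vol (v (shift θ x (s + (a - s) / 3))) (v (shift θ x (s + 2 * ((a - s) / 3)))) o e)) (by
      filter_upwards [eventually_add_mul_lt (show s < s + (a - s) / 3 by linarith) 1,
        self_mem_nhdsWithin] with h h1 hp
      have hp : 0 < h := hp
      exact (hσ _ _ _ _ hs.1 (by linarith) h1 (by linarith) (by linarith)).le)
    exact this.trans_lt (hσ _ _ a b (by linarith [hs.1]) (by linarith) (by linarith) hab hb)

/-- Seen from ξ¹(x), the tangent line at `z` passes through `c`. Secants between `z` and `w`
separate the traces of the two tangents, so the one at `w` misses `c`. -/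
lemma IsHyperconvexFrenet.not_mem_sup_of_restr (hξ : IsHyperconvexFrenet ξ) (θ : X ≃ₜ UnitAddCircle)
    {x z w : X} (hxz : x ≠ z) (hwx : w ≠ x) (hwz : w ≠ z) {c : E 4} (hc : c ∈ restr ξ x z)
    (hc0 : c ≠ 0) : c ∉ comp ξ 2 w ⊔ comp ξ 1 x := by
  intro hw
  obtain ⟨n, v, hv⟩ := hξ.exists_isLift x
  obtain ⟨o, ho0, ho, -⟩ := exists_span_eq ξ x
  obtain ⟨e, he, he1⟩ := exists_mem_two_not_mem_one ξ x
  obtain ⟨σ, hσ0, hσ⟩ := hξ.exists_sign_tangent_ratio θ hv ho ho0 he he1 hc.2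
    (hξ.not_mem_two_of_restr hxz hc hc0)
  have key : ∀ s t, 0 < s → s < t → t < 1 → c ∈ comp ξ 2 (shift θ x s) ⊔ comp ξ 1 x →
      c ∈ comp ξ 2 (shift θ x t) ⊔ comp ξ 1 x → False := fun s t h1 h2 h3 k1 k2 => by
    have l1 := (hσ s ⟨h1, by linarith⟩ 0 (by simpa using k1)).2 (s + (t - s) / 3)
      (s + 2 * ((t - s) / 3)) (by linarith) (by linarith) (by linarith)
    have l2 := (hσ t ⟨by linarith, h3⟩ 0 (by simpa using k2)).1 (s + (t - s) / 3)
      (s + 2 * ((t - s) / 3)) (by linarith) (by linarith) (by linarith)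
    exact lt_asymm l1 l2
  have hz : c ∈ comp ξ 2 z ⊔ comp ξ 1 x := Submodule.mem_sup_left hc.1
  obtain ⟨s, hs, rfl⟩ := exists_shift_eq θ hwx
  obtain ⟨t, ht, rfl⟩ := exists_shift_eq θ hxz.symm
  rcases lt_trichotomy s t with h | h | h
  · exact key s t hs.1 h ht.2 hw hz
  · exact hwz (by rw [h])
  · exact key t s ht.1 h hs.2 hz hw

/-- The projective line through `o` and `c` meets the tangent lines only in these two points, so
each of its two open segments is a connected subset of Ω_ξ. -/
lemma IsHyperconvexFrenet.not_mem_two_of_combination (hξ : IsHyperconvexFrenet ξ)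
    (θ : X ≃ₜ UnitAddCircle) {x z : X} (hxz : x ≠ z) {o c : E 4} (ho : o ∈ comp ξ 1 x)
    (ho0 : o ≠ 0) (hc : c ∈ restr ξ x z) (hc0 : c ≠ 0) {a b : ℝ} (ha : a ≠ 0) (hb : b ≠ 0)
    (w : X) : a • o + b • c ∉ comp ξ 2 w := by
  intro hw
  rcases eq_or_ne w x with rfl | hwx
  · exact hξ.not_mem_two_of_restr hxz hc hc0 ((Submodule.smul_mem_iff _ hb).1
      ((Submodule.add_mem_iff_right _ (Submodule.smul_mem _ _
        (comp_mono ξ w (by decide) ho))).1 hw))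
  rcases eq_or_ne w z with rfl | hwz
  · exact ho0 (hξ.eq_zero_of_mem 1 2 (by decide) hxz ho ((Submodule.smul_mem_iff _ ha).1
      ((Submodule.add_mem_iff_left _ (Submodule.smul_mem _ _ hc.1)).1 hw)))
  refine hξ.not_mem_sup_of_restr θ hxz hwx hwz hc hc0 ((Submodule.smul_mem_iff _ hb).1 ?_)
  have : b • c = (a • o + b • c) + (-(a • o)) := by abel
  rw [this]
  exact Submodule.add_mem _ (Submodule.mem_sup_left hw)
    (Submodule.mem_sup_right (Submodule.neg_mem _ (Submodule.smul_mem _ _ ho)))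

/-- Differences of normalized points of the curve. -/
lemma IsLift.sub_mem_three {x : X} {n : E 4} {v : X → E 4} (hv : IsLift ξ x n v) {y w : X}
    (hy : y ≠ x) (hw : w ≠ x) : v w - v y ∈ comp ξ 3 x := by
  rw [hv.mem_iff, inner_sub_right, hv.inner_eq _ hy, hv.inner_eq _ hw, sub_self]

lemma IsLift.sub_spec (hξ : IsHyperconvexFrenet ξ) {x : X} {n : E 4} {v : X → E 4}
    (hv : IsLift ξ x n v) {y w : X} (hy : y ≠ x) (hw : w ≠ x) (hyw : y ≠ w) :
    v w - v y ∈ comp ξ 1 y ⊔ comp ξ 1 w ∧ v w - v y ∉ comp ξ 1 y ∧ v w - v y ∉ comp ξ 1 w := by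
  have my := Submodule.neg_mem _ (hv.mem _ hy)
  have mw := hv.mem _ hw
  refine ⟨Submodule.sub_mem _ (Submodule.mem_sup_right mw)
    (Submodule.mem_sup_left (hv.mem _ hy)), ?_, ?_⟩
  · rw [sub_eq_add_neg, add_comm (v w)]
    exact hξ.not_mem_of_add hyw my mw (hv.ne_zero hw)
  · rw [sub_eq_add_neg]
    exact hξ.not_mem_of_add hyw.symm mw my (neg_ne_zero.2 (hv.ne_zero hy))

/-- Some secant line of the curve meets the line spanned by `ξ¹(x)` and `ξ²(z) ∩ ξ³(x)`. -/
lemma IsHyperconvexFrenet.exists_secant_combination (hξ : IsHyperconvexFrenet ξ)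
    (θ : X ≃ₜ UnitAddCircle) {x z : X} (hxz : x ≠ z) {n : E 4} {v : X → E 4} (hv : IsLift ξ x n v)
    {o c : E 4} (ho : o ∈ comp ξ 1 x) (ho0 : o ≠ 0) (hc : c ∈ restr ξ x z) (hc0 : c ≠ 0) :
    ∃ s t, 0 < s ∧ s < t ∧ t < 1 ∧ ∃ a b : ℝ, a ≠ 0 ∧ b ≠ 0 ∧
      v (shift θ x t) - v (shift θ x s) = a • o + b • c := by
  obtain ⟨e, he, he1⟩ := exists_mem_two_not_mem_one ξ x
  have hc2 := hξ.not_mem_two_of_restr hxz hc hc0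
  have ho2 := comp_mono ξ x (by decide : (1 : Fin 5) ≤ 2) ho
  obtain ⟨s, t, hs, hst, ht, h0⟩ : ∃ s t, 0 < s ∧ s < t ∧ t < 1 ∧
      vol (v (shift θ x s)) (v (shift θ x t)) o c = 0 := by
    -- If the determinant with `o` and `c` never vanished, its quotient by the one with `o` and `e`
    -- would have constant sign over all pairs. But the tangent at `z` has coordinate 0, and pairs
    -- before and after ζ lie on different sides of it.
    by_contra! hne
    obtain ⟨σ, hσ0, hσ⟩ := hξ.exists_sign_tangent_ratio θ hv ho ho0 he he1 hc.2 hc2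
    obtain ⟨ζ, hζ, rfl⟩ := exists_shift_eq θ hxz.symm
    obtain ⟨k1, k2⟩ := hσ ζ hζ 0 (by simpa using Submodule.mem_sup_left hc.1)
    have l1 := k1 (ζ / 3) (ζ / 2) (by linarith [hζ.1]) (by linarith [hζ.1]) (by linarith [hζ.1])
    have l2 := k2 ((2 * ζ + 1) / 3) ((ζ + 1) / 2) (by linarith [hζ.2]) (by linarith [hζ.2])
      (by linarith [hζ.2])
    obtain ⟨τ, hτ, h1⟩ := exists_sign_pairs (hv.continuousOn_shift θ) hne
    obtain ⟨κ, hκ, h2⟩ := exists_sign_pairs (e := o) (f := e) (hv.continuousOn_shift θ) (l := 0)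
      (r := 1) (fun a b h1 h2 h3 => by
        have m₁ : a ∈ Set.Ioo (0 : ℝ) 1 := ⟨by linarith, by linarith⟩
        have m₂ : b ∈ Set.Ioo (0 : ℝ) 1 := ⟨by linarith, by linarith⟩
        rw [vol_swap34]
        exact neg_ne_zero.2 (hξ.vol_tangent_ne_zero (shift_ne_base θ x m₁).symm
          (shift_ne θ x m₁ m₂ h2.ne) (shift_ne_base θ x m₂).symm
          (hv.mem _ (shift_ne_base θ x m₁)) (hv.mem _ (shift_ne_base θ x m₂)) he he1 ho
          (hv.ne_zero (shift_ne_base θ x m₁)) (hv.ne_zero (shift_ne_base θ x m₂)) ho0))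
    have q1 := mul_pos_of_sign
      (h1 (ζ / 3) (ζ / 2) (by linarith [hζ.1]) (by linarith [hζ.1]) (by linarith [hζ.1, hζ.2]))
      (h1 ((2 * ζ + 1) / 3) ((ζ + 1) / 2) (by linarith [hζ.1]) (by linarith [hζ.2])
        (by linarith [hζ.2]))
    have q2 := mul_pos_of_sign
      (h2 (ζ / 3) (ζ / 2) (by linarith [hζ.1]) (by linarith [hζ.1]) (by linarith [hζ.1, hζ.2]))
      (h2 ((2 * ζ + 1) / 3) ((ζ + 1) / 2) (by linarith [hζ.1]) (by linarith [hζ.2])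
        (by linarith [hζ.2]))
    have q3 := div_pos q1 q2
    rw [mul_div_mul_comm] at q3
    rw [mul_zero] at l1 l2
    have q4 := mul_neg_of_neg_of_pos l1 l2
    nlinarith [mul_self_nonneg σ, mul_nonneg (mul_self_nonneg σ) q3.le]
  have m₁ : s ∈ Set.Ioo (0 : ℝ) 1 := ⟨by linarith, by linarith⟩
  have m₂ : t ∈ Set.Ioo (0 : ℝ) 1 := ⟨by linarith, by linarith⟩
  have nx₁ := shift_ne_base θ x m₁
  have nx₂ := shift_ne_base θ x m₂
  have hne := shift_ne θ x m₁ m₂ hst.ne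
  obtain ⟨w, hw, h0⟩ := exists_relation_of_vol_eq_zero h0
  -- Both `o` and `c` lie in ξ³(x), so pairing the relation with the normal `n` leaves only the two
  -- normalized points of the curve.
  have h01 : w 1 = -w 0 := by
    have := congrArg (inner ℝ n) h0
    rw [inner_add_right, inner_add_right, inner_add_right, inner_smul_right, inner_smul_right,
      inner_smul_right, inner_smul_right, hv.inner_eq _ nx₁, hv.inner_eq _ nx₂,
      (hv.mem_iff _).1 (comp_mono ξ x (by decide : (1 : Fin 5) ≤ 3) ho), (hv.mem_iff _).1 hc.2,
      inner_zero_right] at this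
    linarith
  have w0 : w 0 ≠ 0 := by
    intro w0
    rw [h01, w0, neg_zero, zero_smul, zero_smul, zero_add, zero_add, add_comm] at h0
    obtain ⟨w3, w2⟩ := coeff_eq_zero hc2 ho2 ho0 h0
    have w1 : w 1 = 0 := by rw [h01, w0, neg_zero]
    exact hw (by ext i; fin_cases i <;> assumption)
  have hq : v (shift θ x t) - v (shift θ x s) = ((w 0)⁻¹ * w 2) • o + ((w 0)⁻¹ * w 3) • c := by
    rw [mul_smul, mul_smul, ← smul_add, eq_inv_smul_iff₀ w0, ← sub_eq_zero, ← neg_eq_zero, ← h0,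
      h01, smul_sub, neg_smul]
    abel
  -- A vanishing coefficient would place a point of a punctured secant line on ξ²(z) or ξ²(x).
  have hΩ : ∀ y, v (shift θ x t) - v (shift θ x s) ∉ comp ξ 2 y := by
    obtain ⟨h1, h2, h3⟩ := hv.sub_spec hξ nx₁ nx₂ hne
    have hu : v (shift θ x t) - v (shift θ x s) ≠ 0 := fun h => h2 (h ▸ Submodule.zero_mem _)
    exact (mkPoint_mem_Omega_iff hu).1
      (hξ.secant_subset_Omega hne ((mkPoint_mem_secant_iff hu).2 ⟨h1, h2, h3⟩))
  refine ⟨s, t, hs, hst, ht, _, _, ?_, ?_, hq⟩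
  · intro h
    rw [h, zero_smul, zero_add] at hq
    exact hΩ z (hq ▸ Submodule.smul_mem _ _ hc.1)
  · intro h
    rw [h, zero_smul, add_zero] at hq
    exact hΩ x (hq ▸ Submodule.smul_mem _ _ ho2)

/-- The position of the tangent directions of the curve relative to `ξ³(z)` and `ξ²(x)`. -/
lemma IsHyperconvexFrenet.exists_sign_tangent (hξ : IsHyperconvexFrenet ξ)
    (θ : X ≃ₜ UnitAddCircle) {x z : X} (hxz : x ≠ z) {n m : E 4} {v : X → E 4}
    (hv : IsLift ξ x n v) (hm : ∀ u, u ∈ comp ξ 3 z ↔ inner ℝ m u = 0)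
    {o e : E 4} (ho : o ∈ comp ξ 1 x) (ho0 : o ≠ 0)
    (he : e ∈ comp ξ 2 x) (he1 : e ∉ comp ξ 1 x) :
    ∃ κ : ℝ, (∀ s t, 0 < s → s < t → t < 1 →
        0 < κ * (inner ℝ m (v (shift θ x t) - v (shift θ x s)) *
          vol (v z) o (v (shift θ x t) - v (shift θ x s)) e)) ∧
      ∀ y, y ≠ x → y ≠ z → ∀ c ∈ restr ξ x y, c ≠ 0 →
        0 < κ * (inner ℝ m c * vol (v z) o c e) := by
  have hg := hξ.not_mem_three hxz.symm (hv.mem _ hxz.symm) (hv.ne_zero hxz.symm)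
  have hvc := hv.continuousOn_shift θ
  have hinc : ∀ p ∈ incPairs 0 1, p.1 ∈ Set.Ioo (0 : ℝ) 1 ∧ p.2 ∈ Set.Ioo (0 : ℝ) 1 :=
    fun p ⟨h1, h2, h3⟩ => ⟨⟨by linarith, by linarith⟩, ⟨by linarith, by linarith⟩⟩
  have hd : ContinuousOn (fun p : ℝ × ℝ => v (shift θ x p.2) - v (shift θ x p.1)) (incPairs 0 1) :=
    (hvc.comp continuousOn_snd fun p hp => (hinc p hp).2).sub
      (hvc.comp continuousOn_fst fun p hp => (hinc p hp).1)
  -- On ξ³(x) the two factors vanish exactly along ξ³(z) and ξ²(x), so their product tells the sides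
  -- apart and ignores rescaling of the vector. It has no zero at a secant direction, by
  -- `secant_inter` and because secants avoid the tangent lines.
  have hF : ContinuousOn (fun p : ℝ × ℝ => inner ℝ m (v (shift θ x p.2) - v (shift θ x p.1)) *
      vol (v z) o (v (shift θ x p.2) - v (shift θ x p.1)) e) (incPairs 0 1) :=
    (continuousOn_const.inner hd).mul
      (continuousOn_vol continuousOn_const continuousOn_const hd continuousOn_const)
  obtain ⟨κ, hκ, hs⟩ := exists_sign (isPreconnected_incPairs 0 1) hF (by
    rintro ⟨s, t⟩ hp
    obtain ⟨m₁, m₂⟩ := hinc _ hp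
    have nx₁ := shift_ne_base θ x m₁
    have nx₂ := shift_ne_base θ x m₂
    have hne := shift_ne θ x m₁ m₂ hp.2.1.ne
    obtain ⟨h1, h2, h3⟩ := hv.sub_spec hξ nx₁ nx₂ hne
    have hu : v (shift θ x t) - v (shift θ x s) ≠ 0 := fun h => h2 (h ▸ Submodule.zero_mem _)
    have hΩ := (mkPoint_mem_Omega_iff hu).1
      (hξ.secant_subset_Omega hne ((mkPoint_mem_secant_iff hu).2 ⟨h1, h2, h3⟩))
    refine mul_ne_zero (fun h => ?_) (vol_ne_zero_of_flag ho ho0 he he1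
      (hv.sub_mem_three nx₁ nx₂) (hΩ x) hg)
    have h := (hm _).2 h
    by_cases e1 : shift θ x s = z
    · have := (Submodule.sub_mem_iff_left _
        (comp_mono ξ z (by decide : (1 : Fin 5) ≤ 3) (e1 ▸ hv.mem _ nx₁))).1 h
      exact hξ.not_mem_three (e1 ▸ hne.symm) (hv.mem _ nx₂) (hv.ne_zero nx₂) this
    by_cases e2 : shift θ x t = z
    · have := (Submodule.sub_mem_iff_right _
        (comp_mono ξ z (by decide : (1 : Fin 5) ≤ 3) (e2 ▸ hv.mem _ nx₂))).1 h
      exact hξ.not_mem_three (e2 ▸ hne) (hv.mem _ nx₁) (hv.ne_zero nx₁) this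
    exact hu (hξ.secant_inter θ hne nx₁.symm nx₂.symm (Ne.symm e1) (Ne.symm e2) hxz h1
      (hv.sub_mem_three nx₁ nx₂) h))
  refine ⟨κ, fun s t h1 h2 h3 => hs (s, t) ⟨h1, h2, h3⟩, ?_⟩
  intro y hyx hyz c hc hc0
  have n1 : inner ℝ m c ≠ 0 := fun h =>
    hc0 (hξ.tangent_inter θ hyx hxz hyz hc.1 hc.2 ((hm _).2 h))
  have n2 : vol (v z) o c e ≠ 0 := vol_ne_zero_of_flag ho ho0 he he1 hc.2
    (hξ.not_mem_two_of_restr hyx.symm hc hc0) hg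
  have hκ0 : κ ≠ 0 := by rcases hκ with rfl | rfl <;> norm_num
  refine lt_of_le_of_ne ?_ (mul_ne_zero hκ0 (mul_ne_zero n1 n2)).symm
  obtain ⟨s, hsm, rfl⟩ := exists_shift_eq θ hyx
  -- The vector `c` on the tangent line is approximated by its projections to nearby secants. A
  -- correction along `v (shift θ x s)` returns them to ξ³(x), where they are multiples of
  -- differences of `v`, so the constant sign passes to `c` weakly; nonvanishing makes it strict.
  set P : ℝ → E 4 := fun h => (comp ξ 1 (shift θ x s) ⊔
    comp ξ 1 (shift θ x (s + 1 * h))).starProjection c with hP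
  have hPl : Tendsto P (𝓝[>] 0) (𝓝 c) := by
    have := tendsto_starProjection_apply (hξ.tendsto_sup_pair_shift θ x hsm)
      (tendsto_const_nhds (x := c))
    rwa [Submodule.starProjection_eq_self_iff.2 hc.1] at this
  have hQl : Tendsto (fun h => P h - (inner ℝ n (P h) : ℝ) • v (shift θ x s)) (𝓝[>] 0) (𝓝 c) := by
    have h1 : Tendsto (fun h => (inner ℝ n (P h) : ℝ)) (𝓝[>] 0) (𝓝 (inner ℝ n c)) :=
      tendsto_const_nhds.inner hPl
    have := hPl.sub (h1.smul_const (v (shift θ x s)))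
    rwa [(hv.mem_iff _).1 hc.2, zero_smul, sub_zero] at this
  have hlim := ((tendsto_const_nhds (x := m)).inner hQl (𝕜 := ℝ)).mul (tendsto_vol
    (tendsto_const_nhds (x := v z)) (tendsto_const_nhds (x := o)) hQl
    (tendsto_const_nhds (x := e)))
  refine ge_of_tendsto (hlim.const_mul κ) ?_
  filter_upwards [eventually_add_mul_lt hsm.2 1, self_mem_nhdsWithin] with h h1 hp
  have hp : 0 < h := hp
  have m₂ : s + 1 * h ∈ Set.Ioo (0 : ℝ) 1 := ⟨by linarith [hsm.1], h1⟩
  have nx₂ := shift_ne_base θ x m₂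
  have hPm : P h ∈ comp ξ 1 (shift θ x s) ⊔ comp ξ 1 (shift θ x (s + 1 * h)) :=
    Submodule.starProjection_apply_mem _ _
  rw [comp_one_eq_span (hv.mem _ hyx) (hv.ne_zero hyx),
    comp_one_eq_span (hv.mem _ nx₂) (hv.ne_zero nx₂)] at hPm
  obtain ⟨a', ha, b', hb, hab⟩ := Submodule.mem_sup.1 hPm
  obtain ⟨a, rfl⟩ := Submodule.mem_span_singleton.1 ha
  obtain ⟨b, rfl⟩ := Submodule.mem_span_singleton.1 hb
  have hQ : P h - (inner ℝ n (P h) : ℝ) • v (shift θ x s) =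
      b • (v (shift θ x (s + 1 * h)) - v (shift θ x s)) := by
    rw [← hab, inner_add_right, inner_smul_right, inner_smul_right, hv.inner_eq _ hyx,
      hv.inner_eq _ nx₂, mul_one, mul_one, add_smul, smul_sub]
    abel
  have hpos := hs (s, s + 1 * h) ⟨hsm.1, by simp only; linarith, h1⟩
  have hvs : ∀ r : E 4, vol (v z) o (b • r) e = b * vol (v z) o r e := fun r => by
    simp only [vol, PiLp.smul_apply, smul_eq_mul]; ring
  rw [hQ, inner_smul_right, hvs]
  have := mul_nonneg (mul_self_nonneg b) hpos.le
  simp only at this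
  linarith

/-- The developing map `dev_pcf` in coordinates. -/
lemma IsHyperconvexFrenet.devPcf_spec (hξ : IsHyperconvexFrenet ξ) (θ : X ≃ₜ UnitAddCircle)
    {x y z : X} (hxy : x ≠ y) (hyz : y ≠ z) (hxz : x ≠ z) {n : E 4} {v : X → E 4}
    (hv : IsLift ξ x n v) {o c : E 4} (ho : o ∈ comp ξ 1 x) (ho0 : o ≠ 0)
    (hc : c ∈ restr ξ x z) (hc0 : c ≠ 0) :
    ∃ a b : ℝ, devPcf ξ x y z = ℝ ∙ (a • o + b • c) ∧ ∀ s t, 0 < s → s < t → t < 1 →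
      ∀ a' b' : ℝ, v (shift θ x t) - v (shift θ x s) = a' • o + b' • c →
      0 < (a * b) * (a' * b') := by
  obtain ⟨e, he, he1⟩ := exists_mem_two_not_mem_one ξ x
  obtain ⟨m, hm⟩ := exists_normal ξ z
  obtain ⟨d, hd, hd0⟩ := exists_mem_restr hξ hxy
  have ho2 := comp_mono ξ x (by decide : (1 : Fin 5) ≤ 2) ho
  have hg := hξ.not_mem_three hxz.symm (hv.mem _ hxz.symm) (hv.ne_zero hxz.symm)
  obtain ⟨κ, hκ1, hκ2⟩ := hξ.exists_sign_tangent θ hxz hv hm ho ho0 he he1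
  have hd' := hκ2 y hxy.symm hyz d hd hd0
  set β : E 4 → ℝ := fun r => vol (v z) o r e with hβ
  have βlin : ∀ (s t : ℝ) (u w : E 4), β (s • u + t • w) = s * β u + t * β w := fun s t u w => by
    simp only [hβ, vol, PiLp.add_apply, PiLp.smul_apply, smul_eq_mul]; ring
  have β2 : ∀ r ∈ comp ξ 3 x, β r = 0 → r ∈ comp ξ 2 x := fun r hr h => by
    by_contra h2
    exact vol_ne_zero_of_flag ho ho0 he he1 hr h2 hg h
  have βo : β o = 0 := by simp only [hβ]; unfold vol; ring
  have βe : β e = 0 := by simp only [hβ]; unfold vol; ring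
  have βc : β c ≠ 0 := fun h => hξ.not_mem_two_of_restr hxz hc hc0 (β2 c hc.2 h)
  have β0 : ∀ r ∈ comp ξ 2 x, β r = 0 := fun r hr => by
    have hle : ℝ ∙ o ⊔ ℝ ∙ e ≤ comp ξ 2 x := sup_le
      ((Submodule.span_singleton_le_iff_mem _ _).2 ho2)
      ((Submodule.span_singleton_le_iff_mem _ _).2 he)
    have hlt : ℝ ∙ o < ℝ ∙ o ⊔ ℝ ∙ e := lt_of_le_of_ne le_sup_left fun h => he1 (by
      rw [comp_one_eq_span ho ho0, h]
      exact Submodule.mem_sup_right (Submodule.mem_span_singleton_self e))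
    have h2 := Submodule.finrank_lt_finrank_of_lt hlt
    rw [finrank_span_singleton ho0] at h2
    have heq := Submodule.eq_of_le_of_finrank_le hle (by
      rw [finrank_comp]; exact h2)
    rw [← heq] at hr
    obtain ⟨_, hi, _, hj, rfl⟩ := Submodule.mem_sup.1 hr
    obtain ⟨i, rfl⟩ := Submodule.mem_span_singleton.1 hi
    obtain ⟨j, rfl⟩ := Submodule.mem_span_singleton.1 hj
    rw [βlin, βo, βe]; ring
  have αo : inner ℝ m o ≠ 0 := fun h => hξ.not_mem_three hxz ho ho0 ((hm o).2 h)
  have αc : inner ℝ m c = 0 := (hm c).1 (comp_mono ξ z (by decide) hc.1)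
  -- The coefficients are chosen so that `a • o + b • c - d` lies in both ξ³(z) and ξ²(x): pairing
  -- with `m` kills `c`, and `β` kills `o`, which isolates `a` and `b`.
  set a := inner ℝ m d / inner ℝ m o with ha
  set b := β d / β c with hb
  have ha' : inner ℝ m d = a * inner ℝ m o := by rw [ha, div_mul_cancel₀ _ αo]
  have hb' : β d = b * β c := by rw [hb, div_mul_cancel₀ _ βc]
  have hw : (a • o + b • c) - d ∈ restr ξ z x := by
    have h3 : (a • o + b • c) - d ∈ comp ξ 3 x := Submodule.sub_mem _ (Submodule.add_mem _
      (Submodule.smul_mem _ _ (comp_mono ξ x (by decide) ho)) (Submodule.smul_mem _ _ hc.2)) hd.2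
    refine ⟨β2 _ h3 ?_, (hm _).2 ?_⟩
    · have := βlin 1 (-1) (a • o + b • c) d
      rw [one_smul, neg_one_smul, ← sub_eq_add_neg] at this
      rw [this, βlin, βo, hb']; ring
    · rw [inner_sub_right, inner_add_right, inner_smul_right, inner_smul_right, αc, ha']; ring
  refine ⟨a, b, le_antisymm ?_ ?_, ?_⟩
  · rintro u ⟨hu1, hu2⟩
    obtain ⟨o', ho', c', hc', rfl⟩ := Submodule.mem_sup.1 hu1
    obtain ⟨w', hw', d', hd', he'⟩ := Submodule.mem_sup.1 hu2
    rw [comp_one_eq_span ho ho0] at ho'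
    obtain ⟨p, rfl⟩ := Submodule.mem_span_singleton.1 ho'
    have prop : ∀ {q : X} {r r' : E 4}, x ≠ q → r ∈ restr ξ x q → r' ∈ restr ξ x q → r ≠ 0 →
        ∃ k : ℝ, r' = k • r := by
      intro q r r' hxq hr hr' hr0
      have hβr : β r ≠ 0 := fun h => hξ.not_mem_two_of_restr hxq hr hr0 (β2 r hr.2 h)
      refine ⟨β r' / β r, ?_⟩
      have hmem := Submodule.sub_mem _ hr' (Submodule.smul_mem _ (β r' / β r) hr)
      rw [← sub_eq_zero]
      refine hξ.eq_zero_of_mem 2 2 (by decide) hxq (β2 _ hmem.2 ?_) hmem.1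
      have := βlin 1 (-(β r' / β r)) r' r
      rw [one_smul, neg_smul, ← sub_eq_add_neg] at this
      rw [this, neg_mul, div_mul_cancel₀ _ hβr]; ring
    obtain ⟨q, rfl⟩ := prop hxz hc hc' hc0
    obtain ⟨k, rfl⟩ := prop hxy hd hd' hd0
    have hq : q = k * b := by
      have := congrArg β he'
      have e1 := βlin 1 k w' d
      rw [one_smul] at e1
      rw [βlin, e1, β0 w' hw'.1, βo, hb'] at this
      refine mul_right_cancel₀ βc ?_
      linarith
    have hp : p = k * a := by
      have := congrArg (inner ℝ m) he'
      rw [inner_add_right, inner_add_right, inner_smul_right, inner_smul_right, inner_smul_right,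
        αc, (hm w').1 hw'.2, ha'] at this
      refine mul_right_cancel₀ αo ?_
      linarith
    rw [hp, hq, mul_smul, mul_smul, ← smul_add]
    exact Submodule.smul_mem _ _ (Submodule.mem_span_singleton_self _)
  · rw [Submodule.span_singleton_le_iff_mem]
    refine ⟨Submodule.add_mem _ (Submodule.mem_sup_left (Submodule.smul_mem _ _ ho))
      (Submodule.mem_sup_right (Submodule.smul_mem _ _ hc)), ?_⟩
    rw [← sub_add_cancel (a • o + b • c) d]
    exact Submodule.add_mem _ (Submodule.mem_sup_left hw) (Submodule.mem_sup_right hd)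
  -- On `p • o + q • c` the product of the two functionals is `p * q` times a fixed nonzero
  -- constant, so equal signs of it mean equal signs of the products of coefficients.
  · intro s t h1 h2 h3 a' b' h
    have k1 := hκ1 s t h1 h2 h3
    change 0 < κ * (inner ℝ m d * β d) at hd'
    change 0 < κ * (_ * β _) at k1
    rw [h, βlin, βo, inner_add_right, inner_smul_right, inner_smul_right, αc] at k1
    rw [ha', hb'] at hd'
    have := mul_pos_of_sign hd' k1
    have e1 : a * inner ℝ m o * (b * β c) * ((a' * inner ℝ m o + b' * 0) * (a' * 0 + b' * β c)) =
      (a * b) * (a' * b') * ((inner ℝ m o * β c) * (inner ℝ m o * β c)) := by ring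
    rw [e1] at this
    exact pos_of_mul_pos_left this (mul_self_nonneg _)

/-- The values of `dev_pcf` lie on secant lines of the curve. -/
lemma IsHyperconvexFrenet.exists_devPcf (hξ : IsHyperconvexFrenet ξ) (θ : X ≃ₜ UnitAddCircle)
    {x y z : X} (hxy : x ≠ y) (hyz : y ≠ z) (hxz : x ≠ z) :
    ∃ p ∈ secantUnion ξ, p.1 = devPcf ξ x y z := by
  obtain ⟨n, v, hv⟩ := hξ.exists_isLift x
  obtain ⟨o, ho0, ho, -⟩ := exists_span_eq ξ x
  obtain ⟨c, hc, hc0⟩ := exists_mem_restr hξ hxz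
  obtain ⟨s, t, hs, hst, ht, a', b', ha', hb', hq⟩ :=
    hξ.exists_secant_combination θ hxz hv ho ho0 hc hc0
  obtain ⟨a, b, hdev, hab⟩ := hξ.devPcf_spec θ hxy hyz hxz hv ho ho0 hc hc0
  have hpos := hab s t hs hst ht a' b' hq
  -- This open quadrant parametrizes the segment between `o` and `c` that contains the crossing with
  -- a secant line. The segment is connected and avoids the tangent lines, so it stays in one
  -- component.
  set T : Set (ℝ × ℝ) := {p | 0 < p.1 * a' ∧ 0 < p.2 * b'} with hT
  have hTc : IsPreconnected T := by
    refine Convex.isPreconnected ?_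
    rintro ⟨p1, p2⟩ ⟨h1, h2⟩ ⟨r1, r2⟩ ⟨k1, k2⟩ i j hi hj hij
    have g0 : ∀ {p r d : ℝ}, 0 < p * d → 0 < r * d → 0 < (i * p + j * r) * d := by
      intro p r d hp hr
      have e1 : (i * p + j * r) * d = i * (p * d) + j * (r * d) := by ring
      rw [e1]
      rcases hi.eq_or_lt with rfl | hi
      · have : j = 1 := by linarith
        subst this; simpa
      · have := mul_pos hi hp
        have := mul_nonneg hj hr.le
        linarith
    exact ⟨g0 h1 k1, g0 h2 k2⟩
  have hne : ∀ p : T, p.1.1 • o + p.1.2 • c ∉ (⊥ : Submodule ℝ (E 4)) ∧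
      ∀ w, p.1.1 • o + p.1.2 • c ∉ comp ξ 2 w := fun p => by
    have := hξ.not_mem_two_of_combination θ hxz ho ho0 hc hc0
      (left_ne_zero_of_mul p.2.1.ne') (left_ne_zero_of_mul p.2.2.ne')
    exact ⟨fun h => this x (by rw [(Submodule.mem_bot ℝ).1 h]; exact Submodule.zero_mem _), this⟩
  set g : T → RP3 := fun p => mkPoint (p.1.1 • o + p.1.2 • c) (hne p).1 with hg
  have hgc : Continuous g := continuous_iff_continuousAt.2 fun p => tendsto_rp3_iff.2 (by
    refine tendsto_span_singleton ?_ (hne p).1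
    exact (by fun_prop : Continuous fun p : T => p.1.1 • o + p.1.2 • c).tendsto p)
  have : PreconnectedSpace T := isPreconnected_iff_preconnectedSpace.1 hTc
  have m₁ : s ∈ Set.Ioo (0 : ℝ) 1 := ⟨by linarith, by linarith⟩
  have m₂ : t ∈ Set.Ioo (0 : ℝ) 1 := ⟨by linarith, by linarith⟩
  have hst' := shift_ne θ x m₁ m₂ hst.ne
  set q : T := ⟨(a', b'), mul_self_pos.2 ha', mul_self_pos.2 hb'⟩ with hqT
  have hgq : g q ∈ secantUnion ξ := by
    refine ⟨_, _, hst', (mkPoint_mem_secant_iff (hne q).1).2 ?_⟩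
    have := hv.sub_spec hξ (shift_ne_base θ x m₁) (shift_ne_base θ x m₂) hst'
    rwa [hq] at this
  have hsub : Set.range g ⊆ secantUnion ξ := by
    rw [← hξ.connectedComponentIn_Omega θ hgq]
    refine (isPreconnected_range hgc).subset_connectedComponentIn ⟨q, rfl⟩ ?_
    rintro _ ⟨p, rfl⟩
    exact (mkPoint_mem_Omega_iff _).2 (hne p).2
  -- Equal signs of `a * b` and `a' * b'` put `(a, b)` in the quadrant or in its opposite, and both
  -- represent the same projective segment.
  have hpos' : (0 < a * a' ∧ 0 < b * b') ∨ (0 < -a * a' ∧ 0 < -b * b') := by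
    have : 0 < (a * a') * (b * b') := by linarith
    rcases pos_and_pos_or_neg_and_neg_of_mul_pos this with h | h
    · exact Or.inl h
    · exact Or.inr ⟨by linarith [h.1], by linarith [h.2]⟩
  rcases hpos' with h | h
  · exact ⟨g ⟨(a, b), h⟩, hsub ⟨_, rfl⟩, hdev.symm⟩
  · refine ⟨g ⟨(-a, -b), h⟩, hsub ⟨_, rfl⟩, ?_⟩
    rw [hdev]
    change ℝ ∙ ((-a) • o + (-b) • c) = _
    rw [neg_smul, neg_smul, ← neg_add, ← neg_one_smul ℝ (a • o + b • c)]
    exact Submodule.span_singleton_smul_eq (by simp) _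

end Developing

/-! ### Leaves, embedding and identification of Ω_ξ^1 -/

section Leaves

variable {X : Type*} [TopologicalSpace X] {ξ : X → FullFlag 4} {θ : X ≃ₜ UnitAddCircle}

/-- The punctured line is the disjoint union of the images of the leaves for (x,z) and (z,x). Both
are relatively closed by properness, hence clopen, and each is connected. -/
lemma IsHyperconvexFrenet.connectedComponentIn_secant (hξ : IsHyperconvexFrenet ξ) {x z : X}
    (hxz : x ≠ z) {t : PosTriple θ} (ht : t ∈ tripleLeaf θ x z) :
    connectedComponentIn (secant ξ x z) (pctfPoint hξ t) = pctfPoint hξ '' tripleLeaf θ x z := by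
  have hsub : ∀ {x z : X}, pctfPoint hξ '' tripleLeaf θ x z ⊆ secant ξ x z := by
    rintro x z _ ⟨t, ⟨rfl, rfl⟩, rfl⟩
    exact hξ.pctfPoint_mem_secant t
  have htm := hsub ⟨t, ht, rfl⟩
  apply Set.Subset.antisymm
  · rw [connectedComponentIn_eq_image htm]
    have hcl : ∀ x' z', IsClosed
        (Subtype.val ⁻¹' (pctfPoint hξ '' tripleLeaf θ x' z') : Set (secant ξ x z)) := fun x' z' => by
      have h1 := (hξ.isProperMap_pctfOmega (θ := θ)).isClosedMap _ (isClosed_tripleLeaf θ x' z')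
      have h2 := h1.preimage (continuous_inclusion (hξ.secant_subset_Omega hxz))
      convert h2 using 1
      ext p
      exact ⟨fun ⟨t, ht, h⟩ => ⟨t, ht, Subtype.ext h⟩,
        fun ⟨t, ht, h⟩ => ⟨t, ht, congrArg Subtype.val h⟩⟩
    have hco : (Subtype.val ⁻¹' (pctfPoint hξ '' tripleLeaf θ x z) : Set (secant ξ x z))ᶜ =
        Subtype.val ⁻¹' (pctfPoint hξ '' tripleLeaf θ z x) := by
      ext p
      constructor
      · intro hp
        obtain ⟨t, ht, h | h⟩ := hξ.exists_pctfPoint_eq (θ := θ) hxz p.2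
        · exact absurd ⟨t, h, ht⟩ hp
        · exact ⟨t, h, ht⟩
      · rintro ⟨t, ht, h⟩ ⟨t', ht', h'⟩
        have := hξ.pctfPoint_injective (h.trans h'.symm)
        subst this
        exact hxz (ht'.1.symm.trans ht.1)
    have hclopen : IsClopen
        (Subtype.val ⁻¹' (pctfPoint hξ '' tripleLeaf θ x z) : Set (secant ξ x z)) :=
      ⟨hcl x z, isClosed_compl_iff.1 (hco ▸ hcl z x)⟩
    rintro _ ⟨p, hp, rfl⟩
    exact hclopen.connectedComponent_subset (x := (⟨_, htm⟩ : secant ξ x z)) ⟨t, ht, rfl⟩ hp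
  · exact ((isConnected_tripleLeaf θ hxz).isPreconnected.image _
      hξ.continuous_pctfPoint.continuousOn).subset_connectedComponentIn ⟨t, ht, rfl⟩ hsub

lemma IsHyperconvexFrenet.isEmbedding_pctfPoint (hξ : IsHyperconvexFrenet ξ) :
    IsEmbedding (pctfPoint (θ := θ) hξ) := by
  have hp := hξ.isProperMap_pctfOmega (θ := θ)
  have hi : Function.Injective (pctfOmega (θ := θ) hξ) := fun t t' h =>
    hξ.pctfPoint_injective (congrArg Subtype.val h)
  exact IsEmbedding.subtypeVal.comp
    (IsClosedEmbedding.of_continuous_injective_isClosedMap hp.continuous hi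
      hp.isClosedMap).isEmbedding

/-- All points dev_pcf lie in the union of the secant lines, which is a single component; hence the
choice of triple is irrelevant. -/
lemma IsHyperconvexFrenet.Omega1_eq (hξ : IsHyperconvexFrenet ξ) (θ : X ≃ₜ UnitAddCircle) :
    Omega1 θ ξ = secantUnion ξ := by
  have key : ∀ (t : PosTriple θ) (q : RP3), q.1 = devPcf ξ t.1.1 t.1.2.1 t.1.2.2 →
      q ∈ secantUnion ξ := fun t q hq => by
    obtain ⟨p, hp, h⟩ := hξ.exists_devPcf θ t.ne.1 t.ne.2.1 t.ne.2.2
    have : p = q := Subtype.ext (h.trans hq.symm)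
    exact this ▸ hp
  ext p
  constructor
  · rintro ⟨t, q, hq, hp⟩
    rwa [hξ.connectedComponentIn_Omega θ (key t q hq)] at hp
  · intro hp
    obtain ⟨t⟩ := nonempty_posTriple θ
    obtain ⟨q, hq, h⟩ := hξ.exists_devPcf θ t.ne.1 t.ne.2.1 t.ne.2.2
    exact ⟨t, q, h, by rwa [hξ.connectedComponentIn_Omega θ hq]⟩

end Leaves

/-! ### The foliation of the space of positive triples -/

section Foliation

variable {X : Type*} [TopologicalSpace X]

lemma isOpenMap_shift (θ : X ≃ₜ UnitAddCircle) (b : X) : IsOpenMap (shift θ b) :=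
  θ.symm.isOpenMap.comp ((Homeomorph.addLeft (θ b)).isOpenMap.comp
    QuotientAddGroup.isOpenMap_coe)

lemma shift_injOn_ball (θ : X ≃ₜ UnitAddCircle) (b : X) :
    Set.InjOn (shift θ b) (Metric.ball 0 (1 / 2)) := by
  intro s hs t ht h
  rw [Metric.mem_ball, dist_zero_right, Real.norm_eq_abs, abs_lt] at hs ht
  have h1 : (s : UnitAddCircle) = t := add_left_cancel (θ.symm.injective h)
  have h2 : ((s + 1 / 2 : ℝ) : UnitAddCircle) = ((t + 1 / 2 : ℝ) : UnitAddCircle) := by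
    rw [AddCircle.coe_add, AddCircle.coe_add, h1]
  have := coe_injOn_Ico (show s + 1 / 2 ∈ Set.Ico (0 : ℝ) 1 from ⟨by linarith, by linarith⟩)
    (show t + 1 / 2 ∈ Set.Ico (0 : ℝ) 1 from ⟨by linarith, by linarith⟩) h2
  linarith

/-- Small parametrized intervals in a topological circle. -/
lemma exists_interval (θ : X ≃ₜ UnitAddCircle) (b : X) {U : Set X} (hU : U ∈ 𝓝 b) :
    ∃ j : ℝ → X, IsOpenEmbedding j ∧ j 0 = b ∧ ∀ r, j r ∈ U := by
  have h0 : shift θ b ⁻¹' U ∈ 𝓝 (0 : ℝ) :=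
    (continuous_shift θ b).continuousAt.preimage_mem_nhds (by rwa [shift_zero])
  obtain ⟨ε, hε, hεU⟩ := Metric.mem_nhds_iff.1 h0
  -- The bound 1/2 keeps the interval within one turn of the circle, so that `shift` is injective on
  -- it.
  have hδ : 0 < min ε (1 / 2) := lt_min hε (by norm_num)
  set f := OpenPartialHomeomorph.univBall (0 : ℝ) (min ε (1 / 2)) with hf
  have hfs : f.source = Set.univ := OpenPartialHomeomorph.univBall_source _ _
  have hft : ∀ r, f r ∈ Metric.ball (0 : ℝ) (min ε (1 / 2)) := fun r => by
    rw [← OpenPartialHomeomorph.univBall_target (0 : ℝ) hδ]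
    exact f.map_source (hfs ▸ Set.mem_univ r)
  have hfo : IsOpenEmbedding f := f.isOpenEmbedding hfs
  refine ⟨shift θ b ∘ f, IsOpenEmbedding.of_continuous_injective_isOpenMap
    ((continuous_shift θ b).comp hfo.continuous) (fun r r' h => hfo.injective ?_)
    ((isOpenMap_shift θ b).comp hfo.isOpenMap), ?_, fun r => ?_⟩
  · exact shift_injOn_ball θ b (Metric.ball_subset_ball (min_le_right _ _) (hft r))
      (Metric.ball_subset_ball (min_le_right _ _) (hft r')) h
  · rw [Function.comp_apply, hf, OpenPartialHomeomorph.univBall_apply_zero, shift_zero]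
  · exact hεU (Metric.ball_subset_ball (min_le_left _ _) (hft r))

/-- Coordinates on `ℝ × ℝ²`, the first factor being the middle one. -/
def tripleCoord : E 1 × E 2 ≃ₜ ℝ × ℝ × ℝ where
  toFun p := (p.2 0, p.1 0, p.2 1)
  invFun q := (!₂[q.2.1], !₂[q.1, q.2.2])
  left_inv p := by
    refine Prod.ext ?_ ?_
    · ext i; fin_cases i; rfl
    · ext i; fin_cases i <;> rfl
  right_inv q := rfl
  continuous_toFun := by fun_prop
  continuous_invFun := by
    refine Continuous.prodMk ?_ ?_ <;> refine (PiLp.continuous_toLp 2 _).comp ?_ <;>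
      refine continuous_pi fun i => ?_ <;> fin_cases i <;> simp <;> fun_prop

/-- The map forgetting the middle entry of a triple is a foliation chart near every triple. -/
lemma exists_foliation_chart {θ : X ≃ₜ UnitAddCircle} (t₀ : PosTriple θ) :
    ∃ k : E 1 × E 2 → PosTriple θ, IsOpenEmbedding k ∧ t₀ ∈ Set.range k ∧
      ∀ p q, ((k p).1.1 = (k q).1.1 ∧ (k p).1.2.2 = (k q).1.2.2) ↔ p.2 = q.2 := by
  obtain ⟨⟨x, y, z⟩, ht⟩ := t₀
  have ho := isOpen_posTriple θ
  have hn : {t : X × X × X | sbtw (θ t.1) (θ t.2.1) (θ t.2.2)} ∈ 𝓝 (x, y, z) := ho.mem_nhds ht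
  obtain ⟨U, hU, W, hW, hUW⟩ := mem_nhds_prod_iff.1 hn
  obtain ⟨U', hU', W', hW', hUW'⟩ := mem_nhds_prod_iff.1 hW
  obtain ⟨j₁, hj₁, h1, k1⟩ := exists_interval θ x hU
  obtain ⟨j₂, hj₂, h2, k2⟩ := exists_interval θ y hU'
  obtain ⟨j₃, hj₃, h3, k3⟩ := exists_interval θ z hW'
  have hK : IsOpenEmbedding (Prod.map j₁ (Prod.map j₂ j₃) ∘ tripleCoord) :=
    (hj₁.prodMap (hj₂.prodMap hj₃)).comp tripleCoord.isOpenEmbedding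
  set k : E 1 × E 2 → PosTriple θ := fun p => ⟨Prod.map j₁ (Prod.map j₂ j₃) (tripleCoord p),
    hUW ⟨k1 _, hUW' ⟨k2 _, k3 _⟩⟩⟩ with hk
  refine ⟨k, IsOpenEmbedding.of_comp k ho.isOpenEmbedding_subtypeVal hK, ⟨0, ?_⟩, fun p q => ?_⟩
  · refine Subtype.ext (Prod.ext h1 (Prod.ext h2 h3))
  · constructor
    · rintro ⟨l1, l2⟩
      have l1 := hj₁.injective l1
      have l2 := hj₃.injective l2
      ext i
      fin_cases i
      exacts [l1, l2]
    · intro h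
      constructor
      · change j₁ (p.2 0) = j₁ (q.2 0)
        rw [h]
      · change j₃ (p.2 1) = j₃ (q.2 1)
        rw [h]

/-- In a product chart the trace of a leaf is a single plaque, because the outer entries are
injective coordinates there. Being connected, it is its own component. -/
lemma isFoliation_tripleLeaf {θ : X ≃ₜ UnitAddCircle} {M : Type*} [TopologicalSpace M]
    (Φ : PosTriple θ ≃ₜ M) :
    IsFoliation 1 2 {l : Set M | ∃ x z, x ≠ z ∧ l = Φ '' tripleLeaf θ x z} := by
  have hconn : ∀ l ∈ {l : Set M | ∃ x z, x ≠ z ∧ l = Φ '' tripleLeaf θ x z}, IsConnected l := by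
    rintro _ ⟨x, z, hxz, rfl⟩
    exact (isConnected_tripleLeaf θ hxz).image _ Φ.continuous.continuousOn
  refine ⟨⟨fun h => (hconn _ h).nonempty.ne_empty rfl, fun p => ?_⟩, hconn, fun p => ?_⟩
  · obtain ⟨t, rfl⟩ := Φ.surjective p
    refine ⟨Φ '' tripleLeaf θ t.1.1 t.1.2.2, ⟨⟨_, _, t.ne.2.2, rfl⟩, ⟨t, ⟨rfl, rfl⟩, rfl⟩⟩, ?_⟩
    rintro _ ⟨⟨x, z, hxz, rfl⟩, ⟨t', ⟨h1, h2⟩, h⟩⟩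
    rw [← Φ.injective h, h1, h2]
  · obtain ⟨t, rfl⟩ := Φ.surjective p
    obtain ⟨k, hk, ⟨q₀, hq₀⟩, hkl⟩ := exists_foliation_chart t
    have hJ : IsOpenEmbedding (Φ ∘ k) := Φ.isOpenEmbedding.comp hk
    set φ := (hJ.toOpenPartialHomeomorph (Φ ∘ k)).symm with hφ
    have hsrc : φ.source = Set.range (Φ ∘ k) := by
      rw [hφ, OpenPartialHomeomorph.symm_source]
      exact hJ.toOpenPartialHomeomorph_target _
    have hφJ : ∀ q, φ (Φ (k q)) = q := fun q =>
      (hJ.toOpenPartialHomeomorph (Φ ∘ k)).left_inv (Set.mem_univ q)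
    refine ⟨φ, hsrc ▸ ⟨q₀, by rw [Function.comp_apply, hq₀]⟩, rfl, ?_⟩
    rintro _ ⟨x, z, hxz, rfl⟩ a ⟨ha, t', ⟨h1, h2⟩, hta⟩
    rw [hsrc] at ha ⊢
    obtain ⟨q, rfl⟩ := ha
    have htq : t' = k q := Φ.injective hta
    rw [htq] at h1 h2
    have htrace : Set.range (Φ ∘ k) ∩ Φ '' tripleLeaf θ x z = (Φ ∘ k) '' {v | v.2 = q.2} := by
      ext b
      constructor
      · rintro ⟨⟨r, rfl⟩, s, ⟨e1, e2⟩, hs⟩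
        have hs : s = k r := Φ.injective hs
        rw [hs] at e1 e2
        exact ⟨r, (hkl r q).1 ⟨e1.trans h1.symm, e2.trans h2.symm⟩, rfl⟩
      · rintro ⟨r, hr, rfl⟩
        obtain ⟨e1, e2⟩ := (hkl r q).2 hr
        exact ⟨⟨r, rfl⟩, k r, ⟨e1.trans h1, e2.trans h2⟩, rfl⟩
    have hpl : IsPreconnected {v : E 1 × E 2 | v.2 = q.2} := by
      have : {v : E 1 × E 2 | v.2 = q.2} = Set.univ ×ˢ {q.2} := by ext v; simp
      rw [this]
      exact isPreconnected_univ.prod isPreconnected_singleton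
    have hcc := (hpl.image (Φ ∘ k) hJ.continuous.continuousOn).connectedComponentIn
      (x := (Φ ∘ k) q) ⟨q, rfl, rfl⟩
    rw [htrace, hcc, Set.image_image]
    have : ∀ v, φ ((Φ ∘ k) v) = v := hφJ
    simp only [this, Set.image_id']

end Foliation

end FrenetCurve

end

/-! ### The proposition -/

open FrenetCurve in
theorem proposition3p7 {X : Type*} [TopologicalSpace X] (θ : X ≃ₜ UnitAddCircle)
    (ξ : X → FullFlag 4) (hξ : IsHyperconvexFrenet ξ) :
    (∃ q ∈ Omega ξ, Omega1 θ ξ = connectedComponentIn (Omega ξ) q ∧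
      ∀ t : PosTriple θ, ∃ p ∈ Omega1 θ ξ, p.1 = devPcf ξ t.1.1 t.1.2.1 t.1.2.2) ∧
    ∃ Φ : PosTriple θ ≃ₜ Omega1 θ ξ,
      (∀ t : PosTriple θ, (Φ t).1.1 = devPctf ξ t.1.1 t.1.2.1 t.1.2.2) ∧
      (∀ x z : X, x ≠ z → secant ξ x z ⊆ Omega1 θ ξ) ∧
      (∀ x z : X, x ≠ z → ∃ p ∈ secant ξ x z,
        Subtype.val '' (Φ '' tripleLeaf θ x z) = connectedComponentIn (secant ξ x z) p) ∧
      IsFoliation 1 2 (tcfLeaves θ ξ) := by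
  have hΩ := hξ.Omega1_eq θ
  have hsec : ∀ x z : X, x ≠ z → secant ξ x z ⊆ Omega1 θ ξ := fun x z hxz p hp =>
    hΩ ▸ ⟨x, z, hxz, hp⟩
  refine ⟨?_, ?_⟩
  · obtain ⟨t⟩ := nonempty_posTriple θ
    have hq : pctfPoint hξ t ∈ secantUnion ξ := hξ.range_pctfPoint ▸ ⟨t, rfl⟩
    refine ⟨pctfPoint hξ t, hξ.secantUnion_subset_Omega hq, ?_, fun t => ?_⟩
    · rw [hΩ, hξ.connectedComponentIn_Omega θ hq]
    · rw [hΩ]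
      exact hξ.exists_devPcf θ t.ne.1 t.ne.2.1 t.ne.2.2
  · set Φ : PosTriple θ ≃ₜ Omega1 θ ξ := hξ.isEmbedding_pctfPoint.toHomeomorph.trans
      (Homeomorph.setCongr (hξ.range_pctfPoint.trans hΩ.symm)) with hΦ
    have hval : ∀ t, (Φ t).1 = pctfPoint hξ t := fun t => rfl
    have himg : ∀ s : Set (PosTriple θ), Subtype.val '' (Φ '' s) = pctfPoint hξ '' s := fun s => by
      rw [Set.image_image]; rfl
    have hleaf : ∀ x z : X, x ≠ z → ∃ p ∈ secant ξ x z,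
        Subtype.val '' (Φ '' tripleLeaf θ x z) = connectedComponentIn (secant ξ x z) p := by
      intro x z hxz
      obtain ⟨t, ht⟩ := (isConnected_tripleLeaf θ hxz).nonempty
      refine ⟨pctfPoint hξ t, ?_, ?_⟩
      · have := hξ.pctfPoint_mem_secant t
        rwa [ht.1, ht.2] at this
      · rw [himg, hξ.connectedComponentIn_secant hxz ht]
    refine ⟨Φ, fun t => rfl, hsec, hleaf, ?_⟩
    -- A component of ℓ_xz is the image of the leaf for (x,z) or of the leaf for (z,x); the second
    -- case uses that ℓ_xz and ℓ_zx coincide.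
    have hL : tcfLeaves θ ξ = {l | ∃ x z, x ≠ z ∧ l = Φ '' tripleLeaf θ x z} := by
      ext l
      constructor
      · rintro ⟨x, z, hxz, p, hp, h⟩
        have hinj := Set.image_injective.2 (Subtype.val_injective (p := (· ∈ Omega1 θ ξ)))
        obtain ⟨t, rfl, ht | ht⟩ := hξ.exists_pctfPoint_eq (θ := θ) hxz hp
        · refine ⟨x, z, hxz, hinj ?_⟩
          exact h.trans ((hξ.connectedComponentIn_secant hxz ht).trans (himg _).symm)
        · refine ⟨z, x, hxz.symm, hinj ?_⟩
          rw [secant_comm] at h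
          exact h.trans ((hξ.connectedComponentIn_secant hxz.symm ht).trans (himg _).symm)
      · rintro ⟨x, z, hxz, rfl⟩
        obtain ⟨p, hp, h⟩ := hleaf x z hxz
        exact ⟨x, z, hxz, p, hp, h⟩
    rw [hL]
    exact isFoliation_tripleLeaf Φ
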